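/- **Setting.** Let $V$ be a separable real Hilbert space and let $-A$ be a densely defined, symmetric, strictly positive operator on $V$ with compact inverse. Let $(e_k)_{k\ge1}$ be a complete orthonormal base of eigenelements of $-A$ with eigenvalues $0<\lambda_1\le\lambda_2\le\cdots$, let $S(t)=e^{tA}$, and let $V_\delta=D((-A)^\delta)$ with norm $|v|_{V_\delta}=|(-A)^\delta v|$. Let $G:V\to L_2(V)$ (Hilbert–Schmidt operators) be twice continuously Fréchet differentiable with bounded first and second derivatives. Fix $\tfrac12<\beta<\beta'<\beta''<1$ and $1-\beta'<\alpha<\beta$. Write $$|||u|||_{\beta,a,b}=\sup_{a\le s<t\le b}\frac{|u(t)-u(s)|}{|t-s|^\beta},\qquad \|u\|_{\beta,a,b}=\sup_{s\in[a,b]}|u(s)|+|||u|||_{\beta,a,b}.$$ Let $C^{\beta}([a,b];V)$ be the space of functions with $\|u\|_{\beta,a,b}<\infty$, and $C^{\beta,\sim}([a,b];V)$ the space of continuous functions with $\sup_{a<s<t\le b}(s-a)^\beta\frac{|u(t)-u(s)|}{|t-s|^\beta}<\infty$. Let $\Omega$ be the set of paths $\omega:\mathbb R\to V$ with $\omega(0)=0$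 that are $\beta''$-Hölder continuous on every compact interval, and let $\theta_t\omega=\omega(t+\cdot)-\omega(t)$. For $\mu>0$ put $$T(\omega)=\inf\{\tau>0:|||\omega|||_{\beta',0,\tau}+\mu\tau^{1-\beta'}\ge\mu\},\qquad \hat T(\omega)=\sup\{\tau<0:|||\omega|||_{\beta',\tau,0}+\mu|\tau|^{1-\beta'}\ge\mu\},$$ and $T_0(\omega)=0$, $T_i(\omega)=T_{i-1}(\omega)+T(\theta_{T_{i-1}(\omega)}\omega)$ for $i\ge1$, $T_i(\omega)=T_{i+1}(\omega)+\hat T(\theta_{T_{i+1}(\omega)}\omega)$ for $i\le-1$. For $u_0\in V$ a pathwise mild solution driven by $\omega\in\Omega$ is a function $u$ with $$u(t)=S(t)u_0+\int_0^tS(t-r)G(u(r))\,d\omega(r),\qquad t\ge0,$$ which belongs to $C^{\beta,\sim}([0,\tau];V)$ for every $\tau>0$, and to $C^\beta([0,\tau];V)$ for every $\tau>0$ if $u_0\in V_\beta$. Here $$\int_a^bK\,d\omega=-\int_a^b D^\alpha_{a+}K[r]\,D^{1-\alpha}_{b-}\omega_{b-}[r]\,dr,$$ $$D^\alpha_{a+}K[r]=\frac1{\Gamma(1-\alpha)}\Big(\frac{K(r)}{(r-a)^\alpha}+\alpha\int_a^r\frac{K(r)-K(q)}{(r-q)^{1+\alpha}}dq\Big),$$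 $$D^{1-\alpha}_{b-}\omega_{b-}[r]=\frac1{\Gamma(\alpha)}\Big(\frac{\omega(r)-\omega(b)}{(b-r)^{1-\alpha}}+(1-\alpha)\int_r^b\frac{\omega(r)-\omega(q)}{(q-r)^{2-\alpha}}dq\Big).$$ Let $\phi(t,\omega,u_0)$ be the value at time $t$ of the solution (set $\phi=0$ if there is none), and for $i\in\mathbb N$, $j\in\mathbb Z$ put $\Phi(i,j,\omega,u_0)=\phi(T_i(\theta_{T_j(\omega)}\omega),\theta_{T_j(\omega)}\omega,u_0)$. **Claim.** There is a constant $c>0$, independent of $\mu$, $\omega$, $i$, $j$, $u_0$ and $u$, such that the following two assertions hold. (1) For all $\mu>0$, $\omega\in\Omega$, $j\in\mathbb Z$, $u_0\in V_\beta$, every pathwise mild solution $u$ driven by $\theta_{T_j(\omega)}\omega$ with initial value $u_0$, and every $i\ge1$, with $t_m:=T_m(\theta_{T_j(\omega)}\omega)$, $$\|u\|_{\beta,t_{i-1},t_i}\le c\,e^{-\lambda_1t_{i-1}}|u_0|_{V_\beta}+c\mu\|u\|_{\beta,t_{i-1},t_i}+\sum_{m=1}^{i-1}c\mu\, e^{-\lambda_1(t_{i-1}-t_m)}\|u\|_{\beta,t_{m-1},t_m}+\sum_{m=1}^{i-1}e^{-\lambda_1(t_{i-1}-t_m)}c\mu+c\mu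 .$$ (2) With the same $c$, let $\mu>0$ be so small that $c\mu<1$ and that $k_1:=\frac{c\mu}{1-c\mu}<1$ satisfies $1<-\frac2{\lambda_1}\log k_1$, and put $k_0=\frac c{1-c\mu}$, $k_2=k_1$. Then for all $\omega\in\Omega$, $j\in\mathbb Z$, $u_0\in V_\beta$, $i\ge1$, with $t_m:=T_m(\theta_{T_j(\omega)}\omega)$, $$|\Phi(i,j,\omega,u_0)|\le(1+k_1)^{i-1}e^{-\frac{\lambda_1}2t_{i-1}}\big(k_0|u_0|_{V_\beta}+k_2\big)+\sum_{m=1}^{i-1}2k_2(1+k_1)^{i-1-m}e^{-\frac{\lambda_1}2(t_{i-1}-t_m)},$$ and the same bound holds for $|u(t_i)|$ for every pathwise mild solution $u$ driven by $\theta_{T_j(\omega)}\omega$ with initial value $u_0$. (Sums over $1\le m\le i-1$ are zero for $i=1$.) -/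

import Mathlib

open Set
open scoped RealInnerProductSpace

namespace HolderSPDE

noncomputable section

section HilbertSchmidt

variable {V : Type*} [NormedAddCommGroup V] [InnerProductSpace ℝ V]

/-- The bounded operators `T` on `V` with `∑ i, ‖T (e i)‖ ^ 2 < ∞`. -/
def hsSubmodule (e : HilbertBasis ℕ ℝ V) : Submodule ℝ (V →L[ℝ] V) where
  carrier := {T | Memℓp (fun i => T (e i)) 2}
  add_mem' := fun ha hb => Memℓp.add ha hb
  zero_mem' := zero_memℓp
  smul_mem' := fun c _ hx => Memℓp.const_smul hx c

/-- The space `L₂(V)` of Hilbert-Schmidt operators on `V`. It is a type of its own, so that it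
carries the Hilbert-Schmidt norm and not the operator norm. -/
def HSOp (e : HilbertBasis ℕ ℝ V) : Type _ := hsSubmodule e

instance (e : HilbertBasis ℕ ℝ V) : AddCommGroup (HSOp e) :=
  inferInstanceAs (AddCommGroup (hsSubmodule e))

instance (e : HilbertBasis ℕ ℝ V) : Module ℝ (HSOp e) :=
  inferInstanceAs (Module ℝ (hsSubmodule e))

/-- The bounded operator underlying a Hilbert-Schmidt operator. -/
def HSOp.toCLM {e : HilbertBasis ℕ ℝ V} (T : HSOp e) : V →L[ℝ] V := T.1

/-- The square-summable sequence `(T (e i))` of the values of `T` on the base. -/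
def HSOp.toSeq (e : HilbertBasis ℕ ℝ V) : HSOp e →ₗ[ℝ] lp (fun _ : ℕ => V) 2 where
  toFun T := ⟨fun i => T.toCLM (e i), T.2⟩
  map_add' _ _ := rfl
  map_smul' _ _ := rfl

theorem HSOp.toSeq_injective (e : HilbertBasis ℕ ℝ V) :
    Function.Injective (HSOp.toSeq e) := by
  intro S T h
  apply Subtype.ext
  apply ContinuousLinearMap.ext_on (s := range e)
  · have := e.dense_span
    exact Submodule.dense_iff_topologicalClosure_eq_top.mpr this
  · rintro _ ⟨i, rfl⟩
    exact congrFun (congrArg Subtype.val h) i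

/-- The Hilbert-Schmidt norm `‖T‖ = (∑ i, ‖T (e i)‖ ^ 2) ^ (1/2)`. -/
instance (e : HilbertBasis ℕ ℝ V) : NormedAddCommGroup (HSOp e) :=
  NormedAddCommGroup.induced (HSOp e) (lp (fun _ : ℕ => V) 2) (HSOp.toSeq e)
    (HSOp.toSeq_injective e)

instance (e : HilbertBasis ℕ ℝ V) : NormedSpace ℝ (HSOp e) :=
  NormedSpace.induced ℝ (HSOp e) (lp (fun _ : ℕ => V) 2) (HSOp.toSeq e)

theorem HSOp.norm_sq_eq {e : HilbertBasis ℕ ℝ V} (T : HSOp e) :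
    ‖T‖ ^ 2 = ∑' i, ‖T.toCLM (e i)‖ ^ 2 := by
  have h := lp.norm_rpow_eq_tsum (p := 2) (by norm_num) (HSOp.toSeq e T)
  norm_num at h
  exact h

theorem HSOp.toSeq_surjective [CompleteSpace V] (e : HilbertBasis ℕ ℝ V) :
    Function.Surjective (HSOp.toSeq e) := by
  intro f
  have hf : Summable fun i => ‖f i‖ ^ (2 : ℝ) := by
    have := (memℓp_gen_iff (p := 2) (by norm_num)).1 (lp.memℓp f)
    simpa using this
  have hv : ∀ v : V, Summable fun i => ‖e.repr v i‖ ^ (2 : ℝ) := fun v => by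
    have := (memℓp_gen_iff (p := 2) (by norm_num)).1 (lp.memℓp (e.repr v))
    simpa using this
  have hpq : (2 : ℝ).HolderConjugate 2 := Real.HolderConjugate.two_two
  have hS := fun v => Real.summable_and_inner_le_Lp_mul_Lq_tsum_of_nonneg hpq
    (fun i => norm_nonneg (e.repr v i)) (fun i => norm_nonneg (f i)) (hv v) hf
  have hs : ∀ v, Summable fun i => ‖e.repr v i • f i‖ := fun v => by
    simpa only [norm_smul] using (hS v).1
  have hnorm : ∀ v, (∑' i, ‖e.repr v i‖ ^ (2 : ℝ)) ^ (1 / (2 : ℝ)) = ‖v‖ := fun v => by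
    have := lp.norm_eq_tsum_rpow (p := 2) (by norm_num) (e.repr v)
    rw [e.repr.norm_map] at this
    simpa using this.symm
  let L : V →ₗ[ℝ] V :=
    { toFun := fun v => ∑' i, e.repr v i • f i
      map_add' := fun v w => by
        rw [← (hs v).of_norm.tsum_add (hs w).of_norm]
        simp [add_smul]
      map_smul' := fun c v => by
        rw [RingHom.id_apply, ← (hs v).of_norm.tsum_const_smul]
        simp [mul_smul] }
  let T : V →L[ℝ] V := L.mkContinuous ((∑' i, ‖f i‖ ^ (2 : ℝ)) ^ (1 / (2 : ℝ))) (fun v => by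
    refine (norm_tsum_le_tsum_norm (hs v)).trans ?_
    simp only [norm_smul]
    refine (hS v).2.trans ?_
    rw [hnorm, mul_comm])
  have hT : ∀ j, T (e j) = f j := fun j => by
    change ∑' i, e.repr (e j) i • f i = f j
    rw [tsum_eq_single j]
    · rw [e.repr_self, lp.single_apply_self, one_smul]
    · intro i hi
      rw [e.repr_self, lp.single_apply_ne _ _ _ hi, zero_smul]
  refine ⟨⟨T, ?_⟩, ?_⟩
  · change Memℓp (fun i => T (e i)) 2
    simp only [hT]
    exact lp.memℓp f
  · apply Subtype.ext
    funext j
    exact hT j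

instance [CompleteSpace V] (e : HilbertBasis ℕ ℝ V) : CompleteSpace (HSOp e) := by
  have hi : Isometry (HSOp.toSeq e) := AddMonoidHomClass.isometry_of_norm _ (fun _ => rfl)
  have h : IsUniformInducing (HSOp.toSeq e) := hi.isUniformInducing
  rw [completeSpace_iff_isComplete_range h, (HSOp.toSeq_surjective e).range_eq]
  exact isComplete_univ

/-- The composition `B ∘ T` of a bounded operator `B` and a Hilbert-Schmidt operator `T`. -/
def HSOp.lcomp {e : HilbertBasis ℕ ℝ V} (B : V →L[ℝ] V) (T : HSOp e) : HSOp e :=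
  ⟨B.comp T.toCLM, by
    have h : Memℓp (fun i => T.toCLM (e i)) 2 := T.2
    refine (memℓp_gen_iff (p := 2) (by norm_num)).2 ?_
    have h' := (memℓp_gen_iff (p := 2) (by norm_num)).1 h
    refine Summable.of_nonneg_of_le (fun i => by positivity) (fun i => ?_)
      (h'.mul_left (‖B‖ ^ (2 : ENNReal).toReal))
    rw [← Real.mul_rpow (norm_nonneg _) (norm_nonneg _)]
    exact Real.rpow_le_rpow (norm_nonneg _) (B.le_opNorm _) (by norm_num)⟩

end HilbertSchmidt

section Operator

variable {V : Type*} [NormedAddCommGroup V] [InnerProductSpace ℝ V]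

/-- `-A` is a densely defined, symmetric, strictly positive operator with a compact (everywhere
defined) inverse, and `e` is a complete orthonormal base of eigenelements of `-A` with the
eigenvalues `lam 0 ≤ lam 1 ≤ …`; in particular `lam 0` is the smallest eigenvalue of `-A`. -/
structure IsGeneratorData (A : V →ₗ.[ℝ] V) (e : HilbertBasis ℕ ℝ V) (lam : ℕ → ℝ) : Prop where
  dense_domain : Dense (A.domain : Set V)
  symmetric : ∀ x y : A.domain, ⟪A x, (y : V)⟫ = ⟪(x : V), A y⟫
  positive : ∀ x : A.domain, x ≠ 0 → 0 < ⟪-A x, (x : V)⟫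
  compact_inverse : ∃ R : V →L[ℝ] V, IsCompactOperator R ∧
    (∀ v : V, ∃ h : R v ∈ A.domain, -A ⟨R v, h⟩ = v) ∧ ∀ x : A.domain, R (-A x) = x
  eigen : ∀ i, ∃ h : e i ∈ A.domain, -A ⟨e i, h⟩ = lam i • e i
  monotone : Monotone lam

/-- The operator acting on the base by `e i ↦ m i • e i`; it is meaningful (and used) for bounded
sequences `m` only. -/
def diagOp (e : HilbertBasis ℕ ℝ V) (m : ℕ → ℝ) : V →L[ℝ] V :=
  open scoped Classical in
  if h : ∃ C : ℝ, ∀ i, |m i| ≤ C then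
    have hmem : ∀ f : lp (fun _ : ℕ => ℝ) 2, Memℓp (fun i => m i * f i) 2 := fun f => by
      obtain ⟨C, hC⟩ := h
      refine (lp.memℓp (C • f)).mono' fun i => ?_
      have hC0 : 0 ≤ C := (abs_nonneg _).trans (hC i)
      simp only [norm_mul, Real.norm_eq_abs, lp.coeFn_smul, Pi.smul_apply, smul_eq_mul,
        abs_of_nonneg hC0]
      exact mul_le_mul_of_nonneg_right (hC i) (abs_nonneg _)
    LinearMap.mkContinuousOfExistsBound
      { toFun := fun v => e.repr.symm ⟨fun i => m i * e.repr v i, hmem (e.repr v)⟩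
        map_add' := fun v w => by
          rw [← map_add]
          congr 1
          ext i
          simp only [map_add, lp.coeFn_add, Pi.add_apply, mul_add]
        map_smul' := fun c v => by
          rw [RingHom.id_apply, ← map_smul]
          congr 1
          ext i
          simp only [map_smul, lp.coeFn_smul, Pi.smul_apply, smul_eq_mul]
          ring }
      (by
        obtain ⟨C, hC⟩ := h
        have hC0 : 0 ≤ C := (abs_nonneg _).trans (hC 0)
        refine ⟨C, fun v => ?_⟩
        change ‖e.repr.symm _‖ ≤ _
        rw [LinearIsometryEquiv.norm_map, ← e.repr.norm_map v]
        have h1 : ‖C • e.repr v‖ = C * ‖e.repr v‖ := by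
          rw [norm_smul, Real.norm_eq_abs, abs_of_nonneg hC0]
        rw [← h1]
        refine lp.norm_mono (by norm_num) fun i => ?_
        simp only [norm_mul, Real.norm_eq_abs, lp.coeFn_smul, Pi.smul_apply, smul_eq_mul,
          abs_of_nonneg hC0]
        exact mul_le_mul_of_nonneg_right (hC i) (abs_nonneg _))
  else 0

theorem repr_diagOp (e : HilbertBasis ℕ ℝ V) {m : ℕ → ℝ} (h : ∃ C : ℝ, ∀ i, |m i| ≤ C) (v : V)
    (i : ℕ) : e.repr (diagOp e m v) i = m i * e.repr v i := by
  rw [diagOp, dif_pos h]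
  change (e.repr (e.repr.symm _)) i = _
  rw [LinearIsometryEquiv.apply_symm_apply]

/-- The semigroup `S(t) = exp(tA)`, `t ≥ 0`, generated by `A`. -/
def semigroup (e : HilbertBasis ℕ ℝ V) (lam : ℕ → ℝ) (t : ℝ) : V →L[ℝ] V :=
  diagOp e fun i => Real.exp (-lam i * t)

/-- `v ∈ V_δ`, the domain of the fractional power `(-A)^δ`. -/
def MemFrac (e : HilbertBasis ℕ ℝ V) (lam : ℕ → ℝ) (δ : ℝ) (v : V) : Prop :=
  Summable fun i => (lam i ^ δ * ⟪e i, v⟫) ^ 2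

/-- The norm `|v|_{V_δ} = |(-A)^δ v|` of `v ∈ V_δ`. -/
def fracNorm (e : HilbertBasis ℕ ℝ V) (lam : ℕ → ℝ) (δ : ℝ) (v : V) : ℝ :=
  √(∑' i, (lam i ^ δ * ⟪e i, v⟫) ^ 2)

end Operator

section Holder

variable {E : Type*} [NormedAddCommGroup E]

/-- `f ∈ C^β([a,b])`. -/
def MemHolder (β : ℝ) (f : ℝ → E) (a b : ℝ) : Prop :=
  ∃ C : NNReal, HolderOnWith C β.toNNReal f (Icc a b)

/-- `f ∈ C^{β,∼}([a,b])`. -/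
def MemHolderTilde (β : ℝ) (f : ℝ → E) (a b : ℝ) : Prop :=
  ContinuousOn f (Icc a b) ∧
    ∃ C : ℝ, ∀ s t, a < s → s < t → t ≤ b → (s - a) ^ β * (‖f t - f s‖ / |t - s| ^ β) ≤ C

/-- The seminorm `|||f|||_{β,a,b}`, finite for `f ∈ C^β([a,b])`. -/
def holderSeminorm (β : ℝ) (f : ℝ → E) (a b : ℝ) : ℝ :=
  sSup {x | ∃ s t, a ≤ s ∧ s < t ∧ t ≤ b ∧ x = ‖f t - f s‖ / |t - s| ^ β}

/-- The norm `‖f‖_{β,a,b}`, finite for `f ∈ C^β([a,b])`. -/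
def holderNorm (β : ℝ) (f : ℝ → E) (a b : ℝ) : ℝ :=
  sSup ((fun s => ‖f s‖) '' Icc a b) + holderSeminorm β f a b

end Holder

section Integral

variable {E : Type*} [NormedAddCommGroup E] [NormedSpace ℝ E]

/-- The left-sided Weyl fractional derivative `D_{a+}^α K [r]`. -/
def leftFracDeriv (α a : ℝ) (K : ℝ → E) (r : ℝ) : E :=
  (Real.Gamma (1 - α))⁻¹ • (((r - a) ^ α)⁻¹ • K r +
    α • ∫ q in a..r, ((r - q) ^ (1 + α))⁻¹ • (K r - K q))

/-- The right-sided Weyl fractional derivative `D_{b-}^γ f [r]`, without the factor `(-1)^γ`. -/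
def rightFracDeriv (γ b : ℝ) (f : ℝ → E) (r : ℝ) : E :=
  (Real.Gamma (1 - γ))⁻¹ • (((b - r) ^ γ)⁻¹ • f r +
    γ • ∫ q in r..b, ((q - r) ^ (1 + γ))⁻¹ • (f r - f q))

/-- The pathwise integral
`∫_a^b K dω = (-1)^α ∫_a^b D_{a+}^α K [r] D_{b-}^{1-α} ω_{b-} [r] dr`, `ω_{b-} = ω - ω(b)`,
of an operator-valued function with respect to a continuous path. The leading `-1` is the product
of the factor `(-1)^α` and the factor `(-1)^{1-α}` of the right-sided derivative. -/
def pathIntegral {V : Type*} [NormedAddCommGroup V] [InnerProductSpace ℝ V]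
    {e : HilbertBasis ℕ ℝ V} (α a b : ℝ) (K : ℝ → HSOp e) (ω : ℝ → V) : V :=
  -∫ r in a..b, (leftFracDeriv α a K r).toCLM
    (rightFracDeriv (1 - α) b (fun s => ω s - ω b) r)

end Integral

section Paths

variable {V : Type*} [NormedAddCommGroup V]

/-- The set `Ω` of paths that are zero at zero and `β''`-Hölder on every compact interval. -/
def pathSpace (V : Type*) [NormedAddCommGroup V] (β'' : ℝ) : Set (ℝ → V) :=
  {ω | ω 0 = 0 ∧ ∀ a b, MemHolder β'' ω a b}

/-- The shift `θ_t ω = ω(t + ·) - ω(t)`. -/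
def shift (t : ℝ) (ω : ℝ → V) : ℝ → V := fun s => ω (t + s) - ω t

/-- The stopping time `T(ω)`. -/
def stopFwd (μ β' : ℝ) (ω : ℝ → V) : ℝ :=
  sInf {τ | 0 < τ ∧ μ ≤ holderSeminorm β' ω 0 τ + μ * τ ^ (1 - β')}

/-- The stopping time `T̂(ω)`. -/
def stopBwd (μ β' : ℝ) (ω : ℝ → V) : ℝ :=
  sSup {τ | τ < 0 ∧ μ ≤ holderSeminorm β' ω τ 0 + μ * |τ| ^ (1 - β')}

/-- `T_n(ω)`, `n = 0, 1, 2, …`. -/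
def stopPos (μ β' : ℝ) (ω : ℝ → V) : ℕ → ℝ
  | 0 => 0
  | n + 1 => stopPos μ β' ω n + stopFwd μ β' (shift (stopPos μ β' ω n) ω)

/-- `T_{-n}(ω)`, `n = 0, 1, 2, …`. -/
def stopNeg (μ β' : ℝ) (ω : ℝ → V) : ℕ → ℝ
  | 0 => 0
  | n + 1 => stopNeg μ β' ω n + stopBwd μ β' (shift (stopNeg μ β' ω n) ω)

/-- The sequence of stopping times `T_i(ω)`, `i ∈ ℤ`. -/
def stopTime (μ β' : ℝ) (ω : ℝ → V) : ℤ → ℝ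
  | Int.ofNat n => stopPos μ β' ω n
  | Int.negSucc n => stopNeg μ β' ω (n + 1)

end Paths

section Equation

variable {V : Type*} [NormedAddCommGroup V] [InnerProductSpace ℝ V]

/-- `u` is the pathwise mild solution on `[0,∞)` of `du = Au dt + G(u) dω`, `u(0) = u₀`. As usual
for this equation, solutions are sought in `C^{β,∼}([0,T];V)`, and in `C^β([0,T];V)` when
`u₀ ∈ V_β`. -/
structure IsMildSolution (e : HilbertBasis ℕ ℝ V) (lam : ℕ → ℝ) (G : V → HSOp e) (α β : ℝ)
    (ω : ℝ → V) (u₀ : V) (u : ℝ → V) : Prop where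
  mem_tilde : ∀ T > 0, MemHolderTilde β u 0 T
  mem_holder : MemFrac e lam β u₀ → ∀ T > 0, MemHolder β u 0 T
  eq : ∀ t ≥ 0, u t = semigroup e lam t u₀ +
    pathIntegral α 0 t (fun r => HSOp.lcomp (semigroup e lam (t - r)) (G (u r))) ω

/-- The solution map `φ(t,ω,u₀)`, the value at time `t` of the pathwise mild solution. -/
def solutionMap (e : HilbertBasis ℕ ℝ V) (lam : ℕ → ℝ) (G : V → HSOp e) (α β : ℝ)
    (t : ℝ) (ω : ℝ → V) (u₀ : V) : V :=
  open scoped Classical in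
  if h : ∃ u, IsMildSolution e lam G α β ω u₀ u then h.choose t else 0

/-- `Φ(i,j,ω,u₀) = φ(T_i(θ_{T_j(ω)}ω), θ_{T_j(ω)}ω, u₀)`. -/
def Phi (e : HilbertBasis ℕ ℝ V) (lam : ℕ → ℝ) (G : V → HSOp e) (α β β' μ : ℝ)
    (i : ℕ) (j : ℤ) (ω : ℝ → V) (u₀ : V) : V :=
  solutionMap e lam G α β (stopTime μ β' (shift (stopTime μ β' ω j) ω) i)
    (shift (stopTime μ β' ω j) ω) u₀

end Equation

end

end HolderSPDE

open HolderSPDE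

namespace HolderSPDE

open MeasureTheory

/-! ### Power kernels and Beta integrals -/

section PowerIntegrals

/-! The half-line is cut at the stopping times `t_m`. Each interval `[t_{m-1}, t_m]` has length at
most 1, because at `τ = 1` the term `μ τ ^ (1 - β')` alone reaches the threshold, and on it `ω` is
`β'`-Hölder with constant `μ`. Write `J(a,b) = ∫_a^b S(b-r) G(u(r)) dω(r)` (`convInt`). The relation
`J(0,c) = S(c-b) J(0,b) + J(b,c)` shows that on the last interval `u(t)` is `S(t) u₀`, plus the
blocks `S(t - t_m) J(t_{m-1}, t_m)`, plus `J(t_{i-1}, t)`. Since `G` has linear growth and is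
Lipschitz, each block is of order `μ (1 + ‖u‖)`, with the norm of `u` on its own interval only. The
factor `S(t - t_m)` supplies the decay `exp(-λ₁ (t_{i-1} - t_m))`. This is assertion (1), with `c`
built from the integral estimates, the Lipschitz constant and `λ₁`, hence free of `μ` and `ω`.

Two facts about the integral carry this. The first is the estimate `norm_fracIntegral_le`: the
right-sided derivative of `ω` vanishes at `b` fast enough to absorb the singularity of `S(b-r)`, and
even that of `(S(h) - 1) S(b-r)` at the price of `h ^ β`; the latter gives the Hölder seminorm of
`u`. The second is additivity in the interval (`fracIntegral_add_adjacent`), which is not evident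
because both fractional derivatives depend on the endpoints. It holds for constant integrands, by
inversion of the fractional derivative (`fracIntegral_const`). For Hölder integrands the failure of
additivity over a short first piece of length `h` is `O(h ^ (1 + β - α))`, and a function with such
increments is constant. The convolution kernel is singular at its right end, so additivity is proved
after applying the injective operator `S(1)` (`convInt_add_adjacent`).

For assertion (2), the term `c μ ‖u‖` is absorbed on the left, which turns `c` into `k₀` and `c μ`
into `k₁`. The logarithmic condition says `k₁ < exp(-λ₁/2)`. With interval lengths at most 1 this
gives `k₁ ≤ y` for `y = exp(-λ₁ (t_i - t_{i-1})/2)`, so `(1 - y)(y - k₁) ≥ 0`, that is `y² + k₁ ≤ (1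
+ k₁) y`: half of the decay rate is given up and the memory becomes a factor `1 + k₁` per step
(`discrete_gronwall`). -/

theorem intervalIntegrable_sub_rpow_left {p : ℝ} (hp : -1 < p) (a c d : ℝ) :
    IntervalIntegrable (fun r => (r - a) ^ p) volume c d := by
  have := (intervalIntegral.intervalIntegrable_rpow' (a := c - a) (b := d - a) hp).comp_sub_right a
  simpa using this

theorem intervalIntegrable_sub_rpow_right {p : ℝ} (hp : -1 < p) (b c d : ℝ) :
    IntervalIntegrable (fun r => (b - r) ^ p) volume c d := by
  have := (intervalIntegral.intervalIntegrable_rpow' (a := b - c) (b := b - d) hp).comp_sub_left b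
  simpa using this

theorem integral_sub_rpow_left {p : ℝ} (hp : -1 < p) (a c : ℝ) :
    ∫ r in a..c, (r - a) ^ p = (c - a) ^ (p + 1) / (p + 1) := by
  rw [intervalIntegral.integral_comp_sub_right (fun x => x ^ p), integral_rpow (Or.inl hp), sub_self,
    Real.zero_rpow (by linarith), sub_zero]

theorem integral_sub_rpow_right {p : ℝ} (hp : -1 < p) (a c : ℝ) :
    ∫ r in a..c, (c - r) ^ p = (c - a) ^ (p + 1) / (p + 1) := by
  rw [intervalIntegral.integral_comp_sub_left (fun x => x ^ p), integral_rpow (Or.inl hp), sub_self,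
    Real.zero_rpow (by linarith), sub_zero]

theorem intervalIntegrable_beta {p q : ℝ} (hp : -1 < p) (hq : -1 < q) {a b : ℝ} (hab : a ≤ b) :
    IntervalIntegrable (fun r => (r - a) ^ p * (b - r) ^ q) volume a b := by
  rcases hab.eq_or_lt with rfl | hab
  · exact IntervalIntegrable.refl
  have h1 : IntervalIntegrable (fun r => (r - a) ^ p * (b - r) ^ q) volume a ((a + b) / 2) := by
    refine (intervalIntegrable_sub_rpow_left hp a _ _).mul_continuousOn ?_
    refine ContinuousOn.rpow_const (by fun_prop) fun x hx => Or.inl ?_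
    rw [uIcc_of_le (by linarith)] at hx
    linarith [hx.2]
  have h2 : IntervalIntegrable (fun r => (r - a) ^ p * (b - r) ^ q) volume ((a + b) / 2) b := by
    refine (intervalIntegrable_sub_rpow_right hq b _ _).continuousOn_mul ?_
    refine ContinuousOn.rpow_const (by fun_prop) fun x hx => Or.inl ?_
    rw [uIcc_of_le (by linarith)] at hx
    linarith [hx.1]
  exact h1.trans h2

/-- The Beta integral `∫₀¹ x ^ p (1 - x) ^ q dx`. -/
noncomputable def betaInt (p q : ℝ) : ℝ := ∫ x in (0 : ℝ)..1, x ^ p * (1 - x) ^ q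

theorem betaInt_nonneg (p q : ℝ) : 0 ≤ betaInt p q :=
  intervalIntegral.integral_nonneg zero_le_one fun x hx =>
    mul_nonneg (Real.rpow_nonneg hx.1 _) (Real.rpow_nonneg (by linarith [hx.2]) _)

theorem integral_beta (p q : ℝ) {a b : ℝ} (hab : a < b) :
    ∫ r in a..b, (r - a) ^ p * (b - r) ^ q = (b - a) ^ (p + q + 1) * betaInt p q := by
  have hba : 0 < b - a := sub_pos.2 hab
  have h := intervalIntegral.integral_comp_mul_add (a := 0) (b := 1)
    (fun r => (r - a) ^ p * (b - r) ^ q) hba.ne' a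
  simp only [mul_zero, zero_add, mul_one, sub_add_cancel, smul_eq_mul] at h
  have h' : ∫ r in a..b, (r - a) ^ p * (b - r) ^ q
      = (b - a) * ∫ x in (0 : ℝ)..1,
        ((b - a) * x + a - a) ^ p * (b - ((b - a) * x + a)) ^ q := by
    rw [h]; field_simp
  rw [h', betaInt, ← intervalIntegral.integral_const_mul, ← intervalIntegral.integral_const_mul]
  refine intervalIntegral.integral_congr fun x hx => ?_
  rw [uIcc_of_le zero_le_one] at hx
  have e1 : (b - a) * x + a - a = (b - a) * x := by ring
  have e2 : b - ((b - a) * x + a) = (b - a) * (1 - x) := by ring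
  simp only [e1, e2]
  rw [Real.mul_rpow hba.le hx.1, Real.mul_rpow hba.le (by linarith [hx.2]), Real.rpow_add hba,
    Real.rpow_add hba, Real.rpow_one]
  ring

theorem betaInt_eq_Gamma {γ : ℝ} (h0 : 0 < γ) (h1 : γ < 1) :
    betaInt (γ - 1) (-γ) = Real.Gamma γ * Real.Gamma (1 - γ) := by
  have h := Complex.Gamma_mul_Gamma_eq_betaIntegral (s := (γ : ℂ)) (t := ((1 - γ : ℝ) : ℂ))
    (by simpa using h0) (by simpa using h1)
  have e : (γ : ℂ) + ((1 - γ : ℝ) : ℂ) = 1 := by push_cast; ring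
  rw [e, Complex.Gamma_one, one_mul, Complex.Gamma_ofReal, Complex.Gamma_ofReal,
    Complex.betaIntegral] at h
  have h2 : (∫ x : ℝ in (0 : ℝ)..1, (x : ℂ) ^ ((γ : ℂ) - 1) *
      (1 - (x : ℂ)) ^ (((1 - γ : ℝ) : ℂ) - 1)) = ((betaInt (γ - 1) (-γ) : ℝ) : ℂ) := by
    rw [betaInt, ← intervalIntegral.integral_ofReal]
    refine intervalIntegral.integral_congr fun x hx => ?_
    rw [uIcc_of_le zero_le_one] at hx
    simp only [Complex.ofReal_mul]
    rw [Complex.ofReal_cpow hx.1, Complex.ofReal_cpow (by linarith [hx.2])]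
    push_cast
    ring_nf
  rw [h2] at h
  exact_mod_cast h.symm

theorem integral_sub_rpow_neg_left {α a s r : ℝ} (hα : 0 < α) (has : a ≤ s) (hsr : s < r) :
    ∫ q in a..s, ((r - q) ^ (1 + α))⁻¹ = ((r - s) ^ (-α) - (r - a) ^ (-α)) / α := by
  have h : ∫ q in a..s, ((r - q) ^ (1 + α))⁻¹ = ∫ q in a..s, (r - q) ^ (-1 - α) := by
    refine intervalIntegral.integral_congr fun x hx => ?_
    rw [uIcc_of_le has] at hx
    rw [← Real.rpow_neg (by linarith [hx.2])]
    ring_nf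
  rw [h, intervalIntegral.integral_comp_sub_left (fun x => x ^ (-1 - α)), integral_rpow]
  · have : -1 - α + 1 = -α := by ring
    rw [this, div_neg, ← neg_div, neg_sub]
  · refine Or.inr ⟨by linarith, ?_⟩
    rw [uIcc_of_le (by linarith)]
    intro h0
    linarith [h0.1]

theorem intervalIntegrable_sub_rpow_neg_left {α a s r : ℝ} (has : a ≤ s) (hsr : s < r) :
    IntervalIntegrable (fun q => ((r - q) ^ (1 + α))⁻¹) volume a s := by
  refine ContinuousOn.intervalIntegrable ?_
  rw [uIcc_of_le has]
  refine ContinuousOn.inv₀ (ContinuousOn.rpow_const (by fun_prop) fun x hx => Or.inl ?_)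
    fun x hx => (Real.rpow_pos_of_pos ?_ _).ne'
  · linarith [hx.2]
  · linarith [hx.2]

end PowerIntegrals

/-! ### Bounds and measurability of the Weyl derivatives -/

section FracDeriv

variable {E : Type*} [NormedAddCommGroup E] [NormedSpace ℝ E]

/-- Time reversal: bounds and measurability then need proof for the left-sided derivative only. -/
theorem rightFracDeriv_eq_left (γ b : ℝ) (f : ℝ → E) (r : ℝ) :
    rightFracDeriv γ b f r = leftFracDeriv γ (-b) (fun s => f (-s)) (-r) := by
  simp only [rightFracDeriv, leftFracDeriv, neg_neg]
  have h := intervalIntegral.integral_comp_neg (E := E) (a := -b) (b := -r)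
    (fun q : ℝ => ((q - r) ^ (1 + γ))⁻¹ • (f r - f q))
  simp only [neg_neg] at h
  have e1 : -r - -b = b - r := by ring
  have e2 : ∀ q : ℝ, -r - q = -q - r := fun q => by ring
  simp only [e1, e2, h]

theorem norm_kernel_smul_le {α δ Q r q : ℝ} {x : E} (hqr : q < r) (hx : ‖x‖ ≤ Q * (r - q) ^ δ) :
    ‖((r - q) ^ (1 + α))⁻¹ • x‖ ≤ Q * (r - q) ^ (δ - 1 - α) := by
  have h0 : 0 < r - q := sub_pos.2 hqr
  rw [norm_smul, norm_inv, Real.norm_of_nonneg (Real.rpow_nonneg h0.le _)]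
  calc ((r - q) ^ (1 + α))⁻¹ * ‖x‖ ≤ ((r - q) ^ (1 + α))⁻¹ * (Q * (r - q) ^ δ) := by
        gcongr
    _ = Q * (r - q) ^ (δ - 1 - α) := by
        rw [← Real.rpow_neg h0.le, mul_left_comm, ← Real.rpow_add h0]
        ring_nf

theorem norm_left_inner_le {α δ a r Q : ℝ} {K : ℝ → E} (hαδ : α < δ) (har : a ≤ r)
    (hQ : ∀ q, a ≤ q → q < r → ‖K r - K q‖ ≤ Q * (r - q) ^ δ) :
    ‖∫ q in a..r, ((r - q) ^ (1 + α))⁻¹ • (K r - K q)‖ ≤ Q * (r - a) ^ (δ - α) / (δ - α) := by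
  have hp : -1 < δ - 1 - α := by linarith
  have h := intervalIntegral.norm_integral_le_of_norm_le (μ := volume)
    (f := fun q => ((r - q) ^ (1 + α))⁻¹ • (K r - K q))
    (g := fun q => Q * (r - q) ^ (δ - 1 - α)) har ?_
    ((intervalIntegrable_sub_rpow_right hp r a r).const_mul Q)
  · refine h.trans (le_of_eq ?_)
    rw [intervalIntegral.integral_const_mul, integral_sub_rpow_right hp]
    have : δ - 1 - α + 1 = δ - α := by ring
    rw [this]; ring
  · have : ∀ᵐ q : ℝ, q ≠ r := by simp [ae_iff]
    filter_upwards [this] with q hq hqm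
    have hlt : q < r := lt_of_le_of_ne hqm.2 hq
    exact norm_kernel_smul_le hlt (hQ q hqm.1.le hlt)

theorem norm_leftFracDeriv_le {α δ a r P Q : ℝ} {K : ℝ → E} (hα : 0 < α) (hα1 : α < 1)
    (hαδ : α < δ) (har : a ≤ r) (hP : ‖K r‖ ≤ P)
    (hQ : ∀ q, a ≤ q → q < r → ‖K r - K q‖ ≤ Q * (r - q) ^ δ) :
    ‖leftFracDeriv α a K r‖ ≤ (Real.Gamma (1 - α))⁻¹ *
      (P * (r - a) ^ (-α) + α * (Q * (r - a) ^ (δ - α) / (δ - α))) := by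
  have hΓ : 0 < Real.Gamma (1 - α) := Real.Gamma_pos_of_pos (by linarith)
  have h0 : 0 ≤ r - a := sub_nonneg.2 har
  rw [leftFracDeriv, norm_smul, norm_inv, Real.norm_of_nonneg hΓ.le]
  gcongr
  refine (norm_add_le _ _).trans ?_
  rw [norm_smul, norm_smul, norm_inv, Real.norm_of_nonneg (Real.rpow_nonneg h0 _),
    Real.norm_of_nonneg hα.le, ← Real.rpow_neg h0, mul_comm P]
  gcongr
  exact norm_left_inner_le hαδ har hQ

theorem norm_rightFracDeriv_le {γ δ b r P Q : ℝ} {f : ℝ → E} (hγ : 0 < γ) (hγ1 : γ < 1)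
    (hγδ : γ < δ) (hrb : r ≤ b) (hP : ‖f r‖ ≤ P)
    (hQ : ∀ q, r < q → q ≤ b → ‖f r - f q‖ ≤ Q * (q - r) ^ δ) :
    ‖rightFracDeriv γ b f r‖ ≤ (Real.Gamma (1 - γ))⁻¹ *
      (P * (b - r) ^ (-γ) + γ * (Q * (b - r) ^ (δ - γ) / (δ - γ))) := by
  rw [rightFracDeriv_eq_left]
  have := norm_leftFracDeriv_le (a := -b) (r := -r) (K := fun s => f (-s)) (P := P) (Q := Q)
    hγ hγ1 hγδ (by linarith) (by simpa using hP) (fun q h1 h2 => by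
      have := hQ (-q) (by linarith) (by linarith)
      simpa [sub_eq_add_neg, add_comm] using this)
  have e : -r - -b = b - r := by ring
  rwa [e] at this

/-- The variable endpoint is moved into an indicator on the plane, so that measurability of
parameter integrals applies. The two regions account for the two orientations of the interval. -/
theorem stronglyMeasurable_intervalIntegral {F : ℝ → ℝ → E}
    (hF : StronglyMeasurable (Function.uncurry F)) (a : ℝ) :
    StronglyMeasurable fun r => ∫ q in a..r, F r q := by
  have key : ∀ s : Set (ℝ × ℝ), MeasurableSet s →
      StronglyMeasurable fun r => ∫ q, s.indicator (Function.uncurry F) (r, q) := fun s hs =>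
    (hF.indicator hs).integral_prod_right'
  have h1 := key {p | a < p.2 ∧ p.2 ≤ p.1} (by measurability)
  have h2 := key {p | p.1 < p.2 ∧ p.2 ≤ a} (by measurability)
  convert h1.sub h2 using 2 with r
  rw [intervalIntegral]
  congr 1
  · rw [← integral_indicator measurableSet_Ioc]
    rfl
  · rw [← integral_indicator measurableSet_Ioc]
    rfl

theorem stronglyMeasurable_leftFracDeriv {K : ℝ → E} (hK : StronglyMeasurable K) (α a : ℝ) :
    StronglyMeasurable (leftFracDeriv α a K) := by
  have hm : Measurable fun r : ℝ => ((r - a) ^ α)⁻¹ := by measurability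
  have hm2 : Measurable fun p : ℝ × ℝ => ((p.1 - p.2) ^ (1 + α))⁻¹ := by measurability
  refine StronglyMeasurable.const_smul (StronglyMeasurable.add
    (hm.stronglyMeasurable.smul hK) (StronglyMeasurable.const_smul
      (stronglyMeasurable_intervalIntegral (F := fun r q => ((r - q) ^ (1 + α))⁻¹ • (K r - K q))
        ?_ a) _)) _
  exact hm2.stronglyMeasurable.smul ((hK.comp_measurable measurable_fst).sub
    (hK.comp_measurable measurable_snd))

theorem stronglyMeasurable_rightFracDeriv {f : ℝ → E} (hf : StronglyMeasurable f) (γ b : ℝ) :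
    StronglyMeasurable (rightFracDeriv γ b f) := by
  have : rightFracDeriv γ b f = fun r => leftFracDeriv γ (-b) (fun s => f (-s)) (-r) :=
    funext fun r => rightFracDeriv_eq_left γ b f r
  rw [this]
  exact (stronglyMeasurable_leftFracDeriv (hf.comp_measurable measurable_neg) _ _).comp_measurable
    measurable_neg

end FracDeriv

/-! ### Inversion of the fractional derivative -/

section ConstantIntegrand

variable {F : Type*} [NormedAddCommGroup F] [NormedSpace ℝ F]

/-- Fubini hypothesis for the substitution `y = x z` in `integral_rpow_smul_increment`. The kernel
is dominated by `H x ^ (δ-1) (z-1) ^ (δ-1-γ)`, whose integral over `1 < z < L/x` is a multiple of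
the Beta density `x ^ (γ-1) (L-x) ^ (δ-γ)`. -/
theorem integrable_scaled_kernel {h : ℝ → F} {H γ δ L : ℝ} (hm : StronglyMeasurable h) (hγ : 0 < γ)
    (hγδ : γ < δ)
    (hH : ∀ x y, 0 ≤ x → x ≤ y → y ≤ L → ‖h x - h y‖ ≤ H * (y - x) ^ δ) :
    Integrable (fun p : ℝ × ℝ => {p : ℝ × ℝ | p.1 * p.2 < L}.indicator
        (fun p => (p.1⁻¹ * (p.2 - 1) ^ (-1 - γ)) • (h p.1 - h (p.1 * p.2))) p)
      ((volume.restrict (Ioo 0 L)).prod (volume.restrict (Ioi 1))) := by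
  have hS : MeasurableSet {p : ℝ × ℝ | p.1 * p.2 < L} :=
    measurableSet_lt (by fun_prop) measurable_const
  have hp : -1 < δ - 1 - γ := by linarith
  have hdom : Integrable (fun p : ℝ × ℝ => {p : ℝ × ℝ | p.1 * p.2 < L}.indicator
        (fun p => H * (p.1 ^ (δ - 1) * (p.2 - 1) ^ (δ - 1 - γ))) p)
      ((volume.restrict (Ioo 0 L)).prod (volume.restrict (Ioi 1))) := by
    have hmeas : AEStronglyMeasurable (fun p : ℝ × ℝ => {p : ℝ × ℝ | p.1 * p.2 < L}.indicator
        (fun p => H * (p.1 ^ (δ - 1) * (p.2 - 1) ^ (δ - 1 - γ))) p)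
      ((volume.restrict (Ioo 0 L)).prod (volume.restrict (Ioi 1))) :=
      ((by fun_prop : Measurable fun p : ℝ × ℝ =>
        H * (p.1 ^ (δ - 1) * (p.2 - 1) ^ (δ - 1 - γ))).indicator hS).aestronglyMeasurable
    have hslice : ∀ x ∈ Ioo 0 L, ∀ z, {p : ℝ × ℝ | p.1 * p.2 < L}.indicator
        (fun p => H * (p.1 ^ (δ - 1) * (p.2 - 1) ^ (δ - 1 - γ))) (x, z)
        = (Iio (L / x)).indicator (fun z => H * x ^ (δ - 1) * (z - 1) ^ (δ - 1 - γ)) z := by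
      intro x hx z
      have : x * z < L ↔ z < L / x := by rw [lt_div_iff₀ hx.1, mul_comm]
      by_cases hz : z < L / x
      · rw [indicator_of_mem (by exact this.2 hz), indicator_of_mem (by exact hz)]; ring
      · rw [indicator_of_notMem (by exact fun h => hz (this.1 h)),
          indicator_of_notMem (by exact hz)]
    have hset : ∀ x, Ioi (1 : ℝ) ∩ Iio (L / x) = Ioo 1 (L / x) := fun x => rfl
    rw [integrable_prod_iff hmeas]
    constructor
    · refine (ae_restrict_iff' measurableSet_Ioo).2 (ae_of_all _ fun x hx => ?_)
      simp only [hslice x hx]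
      rw [integrable_indicator_iff measurableSet_Iio, IntegrableOn,
        Measure.restrict_restrict measurableSet_Iio, inter_comm, hset]
      have h1 : 1 ≤ L / x := by rw [le_div_iff₀ hx.1]; linarith [hx.2]
      have := ((intervalIntegrable_sub_rpow_left hp 1 1 (L / x)).const_mul (H * x ^ (δ - 1)))
      rw [intervalIntegrable_iff_integrableOn_Ioo_of_le h1] at this
      exact this
    · have hb := (intervalIntegrable_beta (p := γ - 1) (q := δ - γ) (by linarith) (by linarith)
        (a := 0) (b := max L 0) (le_max_right _ _)).const_mul (|H| / (δ - γ))
      rw [intervalIntegrable_iff_integrableOn_Ioo_of_le (le_max_right _ _)] at hb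
      have hb' : IntegrableOn (fun x => |H| / (δ - γ) * ((x - 0) ^ (γ - 1) * (max L 0 - x) ^ (δ - γ)))
        (Ioo 0 L) := hb.mono_set (Ioo_subset_Ioo_right (le_max_left _ _))
      refine hb'.congr ((ae_restrict_iff' measurableSet_Ioo).2 (ae_of_all _ fun x hx => ?_))
      have hL : 0 < L := hx.1.trans hx.2
      have h1 : 1 ≤ L / x := by rw [le_div_iff₀ hx.1]; linarith [hx.2]
      simp only [hslice x hx, norm_indicator_eq_indicator_norm]
      rw [MeasureTheory.integral_indicator measurableSet_Iio,
        Measure.restrict_restrict measurableSet_Iio, inter_comm, hset,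
        ← integral_Ioc_eq_integral_Ioo, ← intervalIntegral.integral_of_le h1]
      have : ∫ z in (1 : ℝ)..(L / x), ‖H * x ^ (δ - 1) * (z - 1) ^ (δ - 1 - γ)‖
          = ∫ z in (1 : ℝ)..(L / x), |H| * x ^ (δ - 1) * (z - 1) ^ (δ - 1 - γ) := by
        refine intervalIntegral.integral_congr fun z hz => ?_
        rw [uIcc_of_le h1] at hz
        simp only [norm_mul, Real.norm_eq_abs, abs_of_nonneg (Real.rpow_nonneg hx.1.le _),
          abs_of_nonneg (Real.rpow_nonneg (by linarith [hz.1] : 0 ≤ z - 1) _)]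
      rw [this, intervalIntegral.integral_const_mul, integral_sub_rpow_left hp, max_eq_left hL.le]
      have e1 : δ - 1 - γ + 1 = δ - γ := by ring
      have e2 : L / x - 1 = (L - x) / x := by have := hx.1.ne'; field_simp
      have e3 : x ^ (γ - 1) = x ^ (δ - 1) / x ^ (δ - γ) := by
        rw [← Real.rpow_sub hx.1]; ring_nf
      rw [e1, e2, Real.div_rpow (by linarith [hx.2]) hx.1.le, sub_zero, e3]
      ring
  refine hdom.mono' ?_ ?_
  · have hmk : Measurable fun p : ℝ × ℝ => p.1⁻¹ * (p.2 - 1) ^ (-1 - γ) := by fun_prop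
    exact ((hmk.stronglyMeasurable.smul ((hm.comp_measurable measurable_fst).sub
      (hm.comp_measurable (measurable_fst.mul measurable_snd)))).indicator hS).aestronglyMeasurable
  · rw [Measure.prod_restrict]
    refine (ae_restrict_iff' (measurableSet_Ioo.prod measurableSet_Ioi)).2
      (ae_of_all _ fun p hp' => ?_)
    obtain ⟨⟨hx0, hxL⟩, hz⟩ := hp'
    have hz1 : 0 < p.2 - 1 := sub_pos.2 hz
    by_cases hpL : p.1 * p.2 < L
    · rw [indicator_of_mem (by exact hpL), indicator_of_mem (by exact hpL), norm_smul, norm_mul,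
        norm_inv, Real.norm_of_nonneg hx0.le, Real.norm_of_nonneg (Real.rpow_nonneg hz1.le _)]
      have h1 : p.1 ≤ p.1 * p.2 := le_mul_of_one_le_right hx0.le (le_of_lt hz)
      have h2 := hH p.1 (p.1 * p.2) hx0.le h1 hpL.le
      have e : p.1 * p.2 - p.1 = p.1 * (p.2 - 1) := by ring
      rw [e, Real.mul_rpow hx0.le hz1.le] at h2
      calc p.1⁻¹ * (p.2 - 1) ^ (-1 - γ) * ‖h p.1 - h (p.1 * p.2)‖
          ≤ p.1⁻¹ * (p.2 - 1) ^ (-1 - γ) * (H * (p.1 ^ δ * (p.2 - 1) ^ δ)) := by gcongr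
        _ = H * ((p.1⁻¹ * p.1 ^ δ) * ((p.2 - 1) ^ (-1 - γ) * (p.2 - 1) ^ δ)) := by ring
        _ = _ := by
          rw [← Real.rpow_add hz1, ← Real.rpow_neg_one, ← Real.rpow_add hx0]
          ring_nf
    · rw [indicator_of_notMem (by exact hpL), indicator_of_notMem (by exact hpL), norm_zero]

/-- The complementary region, on which the `z`-integral is explicit. It is what remains after the
cancellation in `integral_rpow_smul_increment`. -/
theorem integrable_tail_kernel [CompleteSpace F] {h : ℝ → F} {H γ δ L : ℝ} (hm : StronglyMeasurable h) (hγ : 0 < γ)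
    (hγ1 : γ < 1) (hγδ : γ < δ) (hH : ∀ x, 0 ≤ x → x ≤ L → ‖h x‖ ≤ H * x ^ δ) :
    Integrable (fun p : ℝ × ℝ => {p : ℝ × ℝ | L < p.1 * p.2}.indicator
        (fun p => (p.2 - 1) ^ (-1 - γ) • (p.1⁻¹ • h p.1)) p)
      ((volume.restrict (Ioo 0 L)).prod (volume.restrict (Ioi 1))) ∧
    ∀ x ∈ Ioo 0 L, ∫ z in Ioi (1 : ℝ), {p : ℝ × ℝ | L < p.1 * p.2}.indicator
        (fun p => (p.2 - 1) ^ (-1 - γ) • (p.1⁻¹ • h p.1)) (x, z) =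
      γ⁻¹ • ((x ^ (γ - 1) * (L - x) ^ (-γ)) • h x) := by
  have hS : MeasurableSet {p : ℝ × ℝ | L < p.1 * p.2} :=
    measurableSet_lt measurable_const (by fun_prop)
  have hslice : ∀ x ∈ Ioo 0 L, ∀ z, {p : ℝ × ℝ | L < p.1 * p.2}.indicator
      (fun p => (p.2 - 1) ^ (-1 - γ) • (p.1⁻¹ • h p.1)) (x, z)
      = (Ioi (L / x)).indicator (fun z => (z - 1) ^ (-1 - γ) • (x⁻¹ • h x)) z := by
    intro x hx z
    have : L < x * z ↔ L / x < z := by rw [div_lt_iff₀ hx.1, mul_comm]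
    by_cases hz : L / x < z
    · rw [indicator_of_mem (by exact this.2 hz), indicator_of_mem (by exact hz)]
    · rw [indicator_of_notMem (by exact fun h => hz (this.1 h)),
        indicator_of_notMem (by exact hz)]
  have hset : ∀ x ∈ Ioo 0 L, Ioi (1 : ℝ) ∩ Ioi (L / x) = Ioi (L / x) := fun x hx => by
    rw [inter_eq_right]
    refine Ioi_subset_Ioi ?_
    rw [le_div_iff₀ hx.1]; linarith [hx.2]
  have hint : ∀ x ∈ Ioo 0 L, IntegrableOn (fun z => (z - 1) ^ (-1 - γ)) (Ioi (L / x)) := by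
    intro x hx
    have h1 : 1 < L / x := by rw [lt_div_iff₀ hx.1]; linarith [hx.2]
    simpa [sub_eq_add_neg] using integrableOn_add_rpow_Ioi_of_lt (a := -1 - γ) (m := -1)
      (c := L / x) (by linarith) (by linarith)
  have hval : ∀ x ∈ Ioo 0 L, ∫ z in Ioi (L / x), (z - 1) ^ (-1 - γ)
      = γ⁻¹ * (x ^ γ * (L - x) ^ (-γ)) := by
    intro x hx
    have h1 : 0 < L / x - 1 := by
      rw [sub_pos, lt_div_iff₀ hx.1]; linarith [hx.2]
    have h2 := integral_Ioi_rpow_of_lt (a := -1 - γ) (by linarith) h1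
    have h3 := (measurePreserving_sub_right volume (1 : ℝ)).setIntegral_preimage_emb
      (measurableEmbedding_subRight 1) (fun z : ℝ => z ^ (-1 - γ)) (Ioi (L / x - 1))
    have h4 : (fun z : ℝ => z - 1) ⁻¹' Ioi (L / x - 1) = Ioi (L / x) := by ext z; simp
    rw [h4] at h3
    rw [h3, h2]
    have e1 : -1 - γ + 1 = -γ := by ring
    have e2 : L / x - 1 = (L - x) / x := by have := hx.1.ne'; field_simp
    rw [e1, e2, Real.div_rpow (by linarith [hx.2]) hx.1.le, Real.rpow_neg hx.1.le, div_neg, neg_div,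
      neg_neg, div_inv_eq_mul]
    field_simp
  have hxx : ∀ x : ℝ, 0 < x → x ^ (γ - 1) = x ^ γ * x⁻¹ := fun x hx => by
    rw [Real.rpow_sub_one hx.ne']; rfl
  refine ⟨?_, fun x hx => ?_⟩
  · rw [integrable_prod_iff]
    · constructor
      · refine (ae_restrict_iff' measurableSet_Ioo).2 (ae_of_all _ fun x hx => ?_)
        simp only [hslice x hx]
        rw [integrable_indicator_iff measurableSet_Ioi, IntegrableOn,
          Measure.restrict_restrict measurableSet_Ioi, inter_comm, hset x hx]
        exact (hint x hx).smul_const _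
      · have hb := (intervalIntegrable_beta (p := δ + γ - 1) (q := -γ) (by linarith) (by linarith)
          (a := 0) (b := max L 0) (le_max_right _ _)).const_mul (γ⁻¹ * H)
        rw [intervalIntegrable_iff_integrableOn_Ioo_of_le (le_max_right _ _)] at hb
        have hb' : IntegrableOn (fun x => γ⁻¹ * H * ((x - 0) ^ (δ + γ - 1) *
          (max L 0 - x) ^ (-γ))) (Ioo 0 L) := hb.mono_set (Ioo_subset_Ioo_right (le_max_left _ _))
        have hnorm : ∀ x ∈ Ioo 0 L, ∫ z in Ioi (1 : ℝ), ‖{p : ℝ × ℝ | L < p.1 * p.2}.indicator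
            (fun p => (p.2 - 1) ^ (-1 - γ) • (p.1⁻¹ • h p.1)) (x, z)‖
            = γ⁻¹ * (x ^ γ * (L - x) ^ (-γ)) * (x⁻¹ * ‖h x‖) := by
          intro x hx
          have h1 : 1 < L / x := by rw [lt_div_iff₀ hx.1]; linarith [hx.2]
          simp only [hslice x hx, norm_indicator_eq_indicator_norm]
          rw [MeasureTheory.integral_indicator measurableSet_Ioi,
            Measure.restrict_restrict measurableSet_Ioi, inter_comm, hset x hx, ← hval x hx,
            ← integral_mul_const]
          refine setIntegral_congr_fun measurableSet_Ioi fun z hz => ?_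
          have hz' : 0 ≤ z - 1 := by have := hz.out; linarith
          simp only [norm_smul, norm_inv, Real.norm_of_nonneg hx.1.le,
            Real.norm_of_nonneg (Real.rpow_nonneg hz' _)]
        refine hb'.mono' ?_ ?_
        · refine AEStronglyMeasurable.congr (f := fun x =>
            γ⁻¹ * (x ^ γ * (L - x) ^ (-γ)) * (x⁻¹ * ‖h x‖)) ?_
            ((ae_restrict_iff' measurableSet_Ioo).2 (ae_of_all _ fun x hx => (hnorm x hx).symm))
          have h1 : Measurable fun x : ℝ => γ⁻¹ * (x ^ γ * (L - x) ^ (-γ)) := by fun_prop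
          have h2 : Measurable fun x : ℝ => x⁻¹ * ‖h x‖ :=
            measurable_inv.mul hm.norm.measurable
          exact (h1.mul h2).aestronglyMeasurable
        · refine (ae_restrict_iff' measurableSet_Ioo).2 (ae_of_all _ fun x hx => ?_)
          have hL : 0 < L := hx.1.trans hx.2
          have hLx : 0 ≤ L - x := by linarith [hx.2]
          have h0 : 0 ≤ γ⁻¹ * (x ^ γ * (L - x) ^ (-γ)) * x⁻¹ := by
            have := Real.rpow_nonneg hx.1.le γ
            have := Real.rpow_nonneg hLx (-γ)
            have := inv_nonneg.2 hx.1.le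
            positivity
          rw [hnorm x hx, Real.norm_of_nonneg (by rw [← mul_assoc]; positivity), max_eq_left hL.le,
            sub_zero]
          calc γ⁻¹ * (x ^ γ * (L - x) ^ (-γ)) * (x⁻¹ * ‖h x‖)
              = γ⁻¹ * (x ^ γ * (L - x) ^ (-γ)) * x⁻¹ * ‖h x‖ := by ring
            _ ≤ γ⁻¹ * (x ^ γ * (L - x) ^ (-γ)) * x⁻¹ * (H * x ^ δ) := by
              gcongr; exact hH x hx.1.le hx.2.le
            _ = γ⁻¹ * H * (x ^ (δ + γ - 1) * (L - x) ^ (-γ)) := by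
              rw [Real.rpow_sub_one hx.1.ne', Real.rpow_add hx.1]
              ring
    · have hmk : Measurable fun p : ℝ × ℝ => (p.2 - 1) ^ (-1 - γ) := by fun_prop
      have hmi : Measurable fun p : ℝ × ℝ => p.1⁻¹ := by fun_prop
      exact ((hmk.stronglyMeasurable.smul (hmi.stronglyMeasurable.smul
        (hm.comp_measurable measurable_fst))).indicator hS).aestronglyMeasurable
  · simp only [hslice x hx]
    rw [MeasureTheory.integral_indicator measurableSet_Ioi,
      Measure.restrict_restrict measurableSet_Ioi, inter_comm, hset x hx, integral_smul_const,
      hval x hx, hxx x hx.1, smul_smul, smul_smul]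
    congr 1
    ring

/-- A Frullani-type cancellation. After `y = x z` and an exchange of integrals, the inner integral
for fixed `z` is that of `(h(x) - h(x z))/x` over `(0, L/z)`. By scale invariance of `dx/x` it
equals minus the integral of `h(x)/x` over `(L/z, L)`. Exchanging back and integrating in `z` gives
the Beta weight. -/
theorem integral_rpow_smul_increment [CompleteSpace F] {h : ℝ → F} {H γ δ L : ℝ} (hm : StronglyMeasurable h)
    (hγ : 0 < γ) (hγ1 : γ < 1) (hγδ : γ < δ) (hL : 0 < L) (h0 : h 0 = 0)
    (hH : ∀ x y, 0 ≤ x → x ≤ y → y ≤ L → ‖h x - h y‖ ≤ H * (y - x) ^ δ) :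
    IntegrableOn (fun x => x ^ (γ - 1) • ∫ y in x..L, ((y - x) ^ (1 + γ))⁻¹ • (h x - h y))
      (Ioo 0 L) ∧
    ∫ x in Ioo 0 L, x ^ (γ - 1) • ∫ y in x..L, ((y - x) ^ (1 + γ))⁻¹ • (h x - h y) =
      -∫ x in Ioo 0 L, γ⁻¹ • ((x ^ (γ - 1) * (L - x) ^ (-γ)) • h x) := by
  have hH0 : ∀ x, 0 ≤ x → x ≤ L → ‖h x‖ ≤ H * x ^ δ := fun x hx hxL => by
    have := hH 0 x le_rfl hx hxL
    rwa [h0, zero_sub, norm_neg, sub_zero] at this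
  have hQ := integrable_scaled_kernel hm hγ hγδ hH
  obtain ⟨hN, hNv⟩ := integrable_tail_kernel hm hγ hγ1 hγδ hH0
  -- Here `h 0 = 0` is used: by Hölder continuity `h(x)/x` is `O(x ^ (δ-1))`, so both halves of the
  -- cancellation converge separately.
  have hdiv : IntervalIntegrable (fun x => x⁻¹ • h x) volume 0 L := by
    have h1 : Measurable fun x : ℝ => x⁻¹ := measurable_inv
    refine ((intervalIntegral.intervalIntegrable_rpow' (a := 0) (b := L) (r := δ - 1)
      (by linarith)).const_mul H).mono_fun' (h1.stronglyMeasurable.smul hm).aestronglyMeasurable ?_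
    rw [uIoc_of_le hL.le]
    refine (ae_restrict_iff' measurableSet_Ioc).2 (ae_of_all _ fun x hx => ?_)
    simp only [norm_smul, norm_inv, Real.norm_of_nonneg hx.1.le]
    calc x⁻¹ * ‖h x‖ ≤ x⁻¹ * (H * x ^ δ) := by
          have := hx.1
          gcongr; exact hH0 x hx.1.le hx.2
      _ = H * x ^ (δ - 1) := by rw [Real.rpow_sub_one hx.1.ne']; ring
  have hlhs : ∀ x ∈ Ioo 0 L, x ^ (γ - 1) • ∫ y in x..L, ((y - x) ^ (1 + γ))⁻¹ • (h x - h y)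
      = ∫ z in Ioi (1 : ℝ), {p : ℝ × ℝ | p.1 * p.2 < L}.indicator
        (fun p => (p.1⁻¹ * (p.2 - 1) ^ (-1 - γ)) • (h p.1 - h (p.1 * p.2))) (x, z) := by
    intro x hx
    have h1 : 1 ≤ L / x := by rw [le_div_iff₀ hx.1]; linarith [hx.2]
    have hs : ∀ z, {p : ℝ × ℝ | p.1 * p.2 < L}.indicator
        (fun p => (p.1⁻¹ * (p.2 - 1) ^ (-1 - γ)) • (h p.1 - h (p.1 * p.2))) (x, z)
        = (Iio (L / x)).indicator
          (fun z => (x⁻¹ * (z - 1) ^ (-1 - γ)) • (h x - h (x * z))) z := by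
      intro z
      have : x * z < L ↔ z < L / x := by rw [lt_div_iff₀ hx.1, mul_comm]
      by_cases hz : z < L / x
      · rw [indicator_of_mem (by exact this.2 hz), indicator_of_mem (by exact hz)]
      · rw [indicator_of_notMem (by exact fun h => hz (this.1 h)),
          indicator_of_notMem (by exact hz)]
    simp only [hs]
    rw [MeasureTheory.integral_indicator measurableSet_Iio,
      Measure.restrict_restrict measurableSet_Iio, inter_comm]
    have hset : Ioi (1 : ℝ) ∩ Iio (L / x) = Ioo 1 (L / x) := rfl
    rw [hset, ← integral_Ioc_eq_integral_Ioo, ← intervalIntegral.integral_of_le h1]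
    have hc := intervalIntegral.integral_comp_mul_left (a := 1) (b := L / x)
      (fun y => ((y - x) ^ (1 + γ))⁻¹ • (h x - h y)) hx.1.ne'
    rw [mul_one, mul_div_cancel₀ _ hx.1.ne'] at hc
    have hc' : ∫ y in x..L, ((y - x) ^ (1 + γ))⁻¹ • (h x - h y)
        = x • ∫ z in (1 : ℝ)..L / x, ((x * z - x) ^ (1 + γ))⁻¹ • (h x - h (x * z)) := by
      rw [hc, smul_inv_smul₀ hx.1.ne']
    rw [hc', smul_smul, ← intervalIntegral.integral_smul]
    refine intervalIntegral.integral_congr fun z hz => ?_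
    rw [uIcc_of_le h1] at hz
    have hz0 : 0 ≤ z - 1 := by linarith [hz.1]
    have e : x * z - x = x * (z - 1) := by ring
    simp only [smul_smul]
    rw [e, ← Real.rpow_neg (mul_nonneg hx.1.le hz0), Real.mul_rpow hx.1.le hz0, ← mul_assoc]
    congr 2
    · rw [← Real.rpow_add_one hx.1.ne', ← Real.rpow_add hx.1, ← Real.rpow_neg_one]
      ring_nf
    · ring_nf
  have hrhs : ∀ z ∈ Ioi (1 : ℝ), ∫ x in Ioo 0 L, {p : ℝ × ℝ | p.1 * p.2 < L}.indicator
        (fun p => (p.1⁻¹ * (p.2 - 1) ^ (-1 - γ)) • (h p.1 - h (p.1 * p.2))) (x, z)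
      = -∫ y in Ioo 0 L, {p : ℝ × ℝ | L < p.1 * p.2}.indicator
        (fun p => (p.2 - 1) ^ (-1 - γ) • (p.1⁻¹ • h p.1)) (y, z) := by
    intro z hz
    have hz0 : 0 < z := zero_lt_one.trans hz
    have hLz : L / z < L := div_lt_self hL hz
    have hLz0 : 0 < L / z := div_pos hL hz0
    have hs1 : ∀ x, {p : ℝ × ℝ | p.1 * p.2 < L}.indicator
        (fun p => (p.1⁻¹ * (p.2 - 1) ^ (-1 - γ)) • (h p.1 - h (p.1 * p.2))) (x, z)
        = (Iio (L / z)).indicator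
          (fun x => (z - 1) ^ (-1 - γ) • (x⁻¹ • h x - x⁻¹ • h (x * z))) x := by
      intro x
      have : x * z < L ↔ x < L / z := by rw [lt_div_iff₀ hz0]
      by_cases hx : x < L / z
      · rw [indicator_of_mem (by exact this.2 hx), indicator_of_mem (by exact hx), ← smul_sub,
          smul_smul, mul_comm]
      · rw [indicator_of_notMem (by exact fun h => hx (this.1 h)),
          indicator_of_notMem (by exact hx)]
    have hs2 : ∀ y, {p : ℝ × ℝ | L < p.1 * p.2}.indicator
        (fun p => (p.2 - 1) ^ (-1 - γ) • (p.1⁻¹ • h p.1)) (y, z)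
        = (Ioi (L / z)).indicator (fun y => (z - 1) ^ (-1 - γ) • (y⁻¹ • h y)) y := by
      intro y
      have : L < y * z ↔ L / z < y := by rw [div_lt_iff₀ hz0]
      by_cases hy : L / z < y
      · rw [indicator_of_mem (by exact this.2 hy), indicator_of_mem (by exact hy)]
      · rw [indicator_of_notMem (by exact fun h => hy (this.1 h)),
          indicator_of_notMem (by exact hy)]
    have hset1 : Ioo 0 L ∩ Iio (L / z) = Ioo 0 (L / z) := by
      rw [Ioo_inter_Iio, min_eq_right hLz.le]
    have hset2 : Ioo 0 L ∩ Ioi (L / z) = Ioo (L / z) L := by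
      rw [Ioo_inter_Ioi, max_eq_right hLz0.le]
    simp only [hs1, hs2]
    rw [MeasureTheory.integral_indicator measurableSet_Iio,
      Measure.restrict_restrict measurableSet_Iio, inter_comm, hset1,
      MeasureTheory.integral_indicator measurableSet_Ioi,
      Measure.restrict_restrict measurableSet_Ioi, inter_comm, hset2,
      ← integral_Ioc_eq_integral_Ioo, ← integral_Ioc_eq_integral_Ioo,
      ← intervalIntegral.integral_of_le hLz0.le, ← intervalIntegral.integral_of_le hLz.le,
      intervalIntegral.integral_smul, intervalIntegral.integral_smul, ← smul_neg]
    congr 1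
    have hI1 : IntervalIntegrable (fun x => x⁻¹ • h x) volume 0 (L / z) :=
      hdiv.mono_set (by
        rw [uIcc_of_le hL.le, uIcc_of_le hLz0.le]; exact Icc_subset_Icc_right hLz.le)
    have hI2 : IntervalIntegrable (fun x => x⁻¹ • h x) volume (L / z) L :=
      hdiv.mono_set (by
        rw [uIcc_of_le hL.le, uIcc_of_le hLz.le]; exact Icc_subset_Icc_left hLz0.le)
    have hscale : ∀ x : ℝ, x⁻¹ • h (x * z) = z • ((x * z)⁻¹ • h (x * z)) := fun x => by
      rw [smul_smul, mul_inv, mul_left_comm, mul_inv_cancel₀ hz0.ne', mul_one]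
    have hI3 : IntervalIntegrable (fun x => x⁻¹ • h (x * z)) volume 0 (L / z) := by
      simp only [hscale]
      have := hdiv.comp_mul_right (c := z)
      rw [zero_div] at this
      exact this.smul z
    have hval : ∫ x in (0 : ℝ)..L / z, x⁻¹ • h (x * z) = ∫ y in (0 : ℝ)..L, y⁻¹ • h y := by
      simp only [hscale]
      rw [intervalIntegral.integral_smul,
        intervalIntegral.integral_comp_mul_right (fun y => y⁻¹ • h y) hz0.ne', zero_mul,
        div_mul_cancel₀ _ hz0.ne', smul_inv_smul₀ hz0.ne']
    rw [intervalIntegral.integral_sub hI1 hI3, hval,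
      ← intervalIntegral.integral_add_adjacent_intervals hI1 hI2]
    abel
  refine ⟨hQ.integral_prod_left.congr ((ae_restrict_iff' measurableSet_Ioo).2
    (ae_of_all _ fun x hx => (hlhs x hx).symm)), ?_⟩
  rw [setIntegral_congr_fun measurableSet_Ioo hlhs, integral_integral_swap hQ, setIntegral_congr_fun measurableSet_Ioi hrhs,
    integral_neg, ← integral_integral_swap hN]
  congr 1
  exact setIntegral_congr_fun measurableSet_Ioo hNv

/-- Fractional integration undoes the fractional derivative, evaluated at the left endpoint. Write
`f` as the constant `f a` plus a part `h` vanishing there. The constant gives the Beta integral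
`Γ(γ) Γ(1-γ)`, and the two contributions of `h` cancel by `integral_rpow_smul_increment`. -/
theorem integral_rpow_smul_rightFracDeriv [CompleteSpace F] {f : ℝ → F} {H γ δ a c : ℝ} (hm : StronglyMeasurable f)
    (hγ : 0 < γ) (hγ1 : γ < 1) (hγδ : γ < δ) (hac : a < c)
    (hH : ∀ x y, a ≤ x → x ≤ y → y ≤ c → ‖f x - f y‖ ≤ H * (y - x) ^ δ) :
    ∫ r in a..c, (r - a) ^ (γ - 1) • rightFracDeriv γ c f r = Real.Gamma γ • f a := by
  set L := c - a with hLdef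
  have hL : 0 < L := sub_pos.2 hac
  set h : ℝ → F := fun x => f (x + a) - f a with hh
  have hhm : StronglyMeasurable h :=
    (hm.comp_measurable (measurable_id.add_const a)).sub stronglyMeasurable_const
  have hhH : ∀ x y, 0 ≤ x → x ≤ y → y ≤ L → ‖h x - h y‖ ≤ H * (y - x) ^ δ := by
    intro x y hx hxy hy
    have := hH (x + a) (y + a) (by linarith) (by linarith) (by linarith)
    simpa [hh] using this
  have hH0 : 0 ≤ H := by
    have := (norm_nonneg _).trans (hH a c le_rfl hac.le le_rfl)
    exact nonneg_of_mul_nonneg_left this (Real.rpow_pos_of_pos hL δ)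
  obtain ⟨hi, hv⟩ := integral_rpow_smul_increment hhm hγ hγ1 hγδ hL (by simp [hh]) hhH
  have hshift := intervalIntegral.integral_comp_add_right (a := 0) (b := L)
    (fun r => (r - a) ^ (γ - 1) • rightFracDeriv γ c f r) a
  rw [zero_add, hLdef, sub_add_cancel, ← hLdef] at hshift
  rw [← hshift]
  have hbeta := intervalIntegrable_beta (p := γ - 1) (q := -γ) (by linarith) (by linarith) hL.le
  simp only [sub_zero] at hbeta
  rw [intervalIntegrable_iff_integrableOn_Ioo_of_le hL.le] at hbeta
  have hb2 : IntegrableOn (fun x => (x ^ (γ - 1) * (L - x) ^ (-γ)) • h x) (Ioo 0 L) := by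
    have hmk : Measurable fun x : ℝ => x ^ (γ - 1) * (L - x) ^ (-γ) := by fun_prop
    refine (hbeta.const_mul (H * L ^ δ)).mono' (hmk.stronglyMeasurable.smul hhm).aestronglyMeasurable
      ((ae_restrict_iff' measurableSet_Ioo).2 (ae_of_all _ fun x hx => ?_))
    have hk : 0 ≤ x ^ (γ - 1) * (L - x) ^ (-γ) :=
      mul_nonneg (Real.rpow_nonneg hx.1.le _) (Real.rpow_nonneg (by linarith [hx.2]) _)
    rw [norm_smul, Real.norm_of_nonneg hk, mul_comm]
    gcongr
    have h1 := hhH 0 x le_rfl hx.1.le hx.2.le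
    have h2 : h 0 = 0 := by simp [hh]
    rw [h2, zero_sub, norm_neg, sub_zero] at h1
    refine h1.trans ?_
    have := hx.1.le
    have := hx.2.le
    have : 0 ≤ δ := by linarith
    gcongr
  have hpt : ∀ x ∈ Ioo 0 L, (x + a - a) ^ (γ - 1) • rightFracDeriv γ c f (x + a)
      = (Real.Gamma (1 - γ))⁻¹ • ((x ^ (γ - 1) * (L - x) ^ (-γ)) • f a
        + ((x ^ (γ - 1) * (L - x) ^ (-γ)) • h x
        + γ • (x ^ (γ - 1) • ∫ y in x..L, ((y - x) ^ (1 + γ))⁻¹ • (h x - h y)))) := by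
    intro x hx
    have e1 : c - (x + a) = L - x := by rw [hLdef]; ring
    have e2 : ∫ y in x..L, ((y - x) ^ (1 + γ))⁻¹ • (h x - h y)
        = ∫ q in (x + a)..c, ((q - (x + a)) ^ (1 + γ))⁻¹ • (f (x + a) - f q) := by
      have := intervalIntegral.integral_comp_add_right (a := x) (b := L)
        (fun q => ((q - (x + a)) ^ (1 + γ))⁻¹ • (f (x + a) - f q)) a
      rw [show L + a = c by rw [hLdef]; ring] at this
      rw [← this]
      refine intervalIntegral.integral_congr fun y _ => ?_
      simp [hh]
    rw [rightFracDeriv, e2, e1, add_sub_cancel_right, ← Real.rpow_neg (by linarith [hx.2]), hh]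
    module
  have hi' : IntegrableOn (fun x => γ • (x ^ (γ - 1) •
      ∫ y in x..L, ((y - x) ^ (1 + γ))⁻¹ • (h x - h y))) (Ioo 0 L) := hi.smul γ
  have hb3 : IntegrableOn (fun x => (x ^ (γ - 1) * (L - x) ^ (-γ)) • h x + γ • (x ^ (γ - 1) •
      ∫ y in x..L, ((y - x) ^ (1 + γ))⁻¹ • (h x - h y))) (Ioo 0 L) := hb2.add hi'
  rw [intervalIntegral.integral_of_le hL.le, integral_Ioc_eq_integral_Ioo,
    setIntegral_congr_fun measurableSet_Ioo hpt, integral_smul,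
    integral_add (hbeta.smul_const _) hb3, integral_add hb2 hi',
    integral_smul, hv, integral_smul_const, integral_smul, smul_neg, smul_inv_smul₀ hγ.ne',
    add_neg_cancel, add_zero, ← integral_Ioc_eq_integral_Ioo, ← intervalIntegral.integral_of_le hL.le]
  have hbv := integral_beta (γ - 1) (-γ) hL
  simp only [sub_zero] at hbv
  have hΓ : Real.Gamma (1 - γ) ≠ 0 := (Real.Gamma_pos_of_pos (by linarith)).ne'
  rw [hbv, betaInt_eq_Gamma hγ hγ1, show γ - 1 + -γ + 1 = 0 by ring, Real.rpow_zero, one_mul,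
    smul_smul]
  congr 1
  field_simp

end ConstantIntegrand

/-! ### Hölder bounds, with a possible singularity at the right endpoint -/

section HolderBounds

variable {E : Type*} [NormedAddCommGroup E]

/-- The bound `‖f t - f s‖ ≤ H (t - s) ^ δ` for `s ≤ t` in `[a, b]`. -/
def IsHolderBound (δ H : ℝ) (f : ℝ → E) (a b : ℝ) : Prop :=
  ∀ s t, a ≤ s → s ≤ t → t ≤ b → ‖f t - f s‖ ≤ H * (t - s) ^ δ

theorem IsHolderBound.mono {δ H : ℝ} {f : ℝ → E} {a b a' b' : ℝ} (h : IsHolderBound δ H f a b)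
    (ha : a ≤ a') (hb : b' ≤ b) : IsHolderBound δ H f a' b' :=
  fun s t hs hst ht => h s t (ha.trans hs) hst (ht.trans hb)

/-- `K` is Hölder of order `δ` on `[a, b)`, with controlled singularities at `b`. -/
structure IsSingHolder (κ ρ δ R : ℝ) (K : ℝ → E) (a b : ℝ) : Prop where
  norm_le : ∀ r, a ≤ r → r < b → ‖K r‖ ≤ R * (b - r) ^ (-κ)
  norm_sub_le : ∀ q r, a ≤ q → q < r → r < b → ‖K r - K q‖ ≤ R * (b - r) ^ (-ρ) * (r - q) ^ δ

theorem IsSingHolder.mono {κ ρ δ R R' : ℝ} {K : ℝ → E} {a b a' : ℝ}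
    (h : IsSingHolder κ ρ δ R K a b) (ha : a ≤ a') (hR : R ≤ R') :
    IsSingHolder κ ρ δ R' K a' b where
  norm_le r hr hrb := (h.norm_le r (ha.trans hr) hrb).trans (by
    have := Real.rpow_nonneg (sub_nonneg.2 hrb.le) (-κ)
    gcongr)
  norm_sub_le q r hq hqr hrb := (h.norm_sub_le q r (ha.trans hq) hqr hrb).trans (by
    have := Real.rpow_nonneg (sub_nonneg.2 hrb.le) (-ρ)
    have := Real.rpow_nonneg (sub_nonneg.2 hqr.le) δ
    gcongr)

end HolderBounds

/-! ### Estimates for the pathwise integral -/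

section FracIntegral

variable {E F W : Type*} [NormedAddCommGroup E] [NormedSpace ℝ E] [NormedAddCommGroup F]
  [NormedSpace ℝ F] [NormedAddCommGroup W] [NormedSpace ℝ W]

/-- The pathwise integral of Weyl type with respect to a bilinear pairing `B`. -/
noncomputable def fracIntegral (B : E →L[ℝ] F →L[ℝ] W) (α a b : ℝ) (K : ℝ → E) (ω : ℝ → F) : W :=
  -∫ r in a..b, B (leftFracDeriv α a K r) (rightFracDeriv (1 - α) b (fun s => ω s - ω b) r)

/-- Subtracting `ω b` makes the boundary term as small as the increment term. The exponent `α + δ -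
1` is positive, which leaves room for an integrand that blows up at `b`. -/
theorem norm_rightFracDeriv_path_le {α δ H a b r : ℝ} {ω : ℝ → F} (hα : 0 < α) (hα1 : α < 1)
    (hδ : 1 - α < δ) (hω : IsHolderBound δ H ω a b) (har : a ≤ r) (hrb : r < b) :
    ‖rightFracDeriv (1 - α) b (fun s => ω s - ω b) r‖ ≤
      (Real.Gamma α)⁻¹ * (1 + (1 - α) / (δ - (1 - α))) * H * (b - r) ^ (α + δ - 1) := by
  have hbr : 0 < b - r := sub_pos.2 hrb
  have h := norm_rightFracDeriv_le (γ := 1 - α) (f := fun s => ω s - ω b) (r := r) (b := b)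
    (P := H * (b - r) ^ δ) (Q := H) (by linarith) (by linarith) hδ hrb.le
    (by rw [norm_sub_rev]; exact hω r b har hrb.le le_rfl) (fun q hrq hqb => by
      have := hω r q har hrq.le hqb
      rw [norm_sub_rev] at this
      simpa using this)
  rw [sub_sub_cancel] at h
  refine h.trans (le_of_eq ?_)
  have e1 : (b - r) ^ δ * (b - r) ^ (-(1 - α)) = (b - r) ^ (α + δ - 1) := by
    rw [← Real.rpow_add hbr]; ring_nf
  have e2 : δ - (1 - α) = α + δ - 1 := by ring
  rw [mul_assoc H, e1, e2]
  ring

theorem norm_leftFracDeriv_sing_le {α κ ρ δ R a b r : ℝ} {K : ℝ → E} (hα : 0 < α) (hα1 : α < 1)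
    (hαδ : α < δ) (hK : IsSingHolder κ ρ δ R K a b) (har : a ≤ r) (hrb : r < b) :
    ‖leftFracDeriv α a K r‖ ≤ (Real.Gamma (1 - α))⁻¹ * R *
      ((r - a) ^ (-α) * (b - r) ^ (-κ) + α / (δ - α) * ((r - a) ^ (δ - α) * (b - r) ^ (-ρ))) := by
  refine (norm_leftFracDeriv_le hα hα1 hαδ har (hK.norm_le r har hrb)
    (fun q haq hqr => hK.norm_sub_le q r haq hqr hrb)).trans (le_of_eq ?_)
  ring

/-- The constant in the estimate of the pathwise integral. -/
noncomputable def fracConst (α δ' κ ρ δ : ℝ) : ℝ :=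
  (Real.Gamma (1 - α))⁻¹ * ((Real.Gamma α)⁻¹ * (1 + (1 - α) / (δ' - (1 - α)))) *
    (betaInt (-α) (α + δ' - 1 - κ) + α / (δ - α) * betaInt (δ - α) (α + δ' - 1 - ρ))

theorem fracConst_nonneg {α δ' κ ρ δ : ℝ} (hα : 0 < α) (hα1 : α < 1) (hαδ : α < δ)
    (hδ' : 1 - α < δ') : 0 ≤ fracConst α δ' κ ρ δ := by
  have h1 := Real.Gamma_pos_of_pos hα
  have h2 := Real.Gamma_pos_of_pos (s := 1 - α) (by linarith)
  have h3 := betaInt_nonneg (-α) (α + δ' - 1 - κ)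
  have h4 := betaInt_nonneg (δ - α) (α + δ' - 1 - ρ)
  have h5 : 0 < δ' - (1 - α) := by linarith
  have h6 : 0 < δ - α := by linarith
  have h7 : 0 < 1 - α := by linarith
  unfold fracConst
  positivity

section Estimate

variable {α κ ρ δ δ' R H a b : ℝ} {K : ℝ → E} {ω : ℝ → F}

theorem norm_fracIntegrand_le (B : E →L[ℝ] F →L[ℝ] W) (hα : 0 < α) (hα1 : α < 1)
    (hαδ : α < δ) (hδ' : 1 - α < δ') (hR : 0 ≤ R) (hK : IsSingHolder κ ρ δ R K a b)
    (hω : IsHolderBound δ' H ω a b) {r : ℝ} (har : a < r) (hrb : r < b) :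
    ‖B (leftFracDeriv α a K r) (rightFracDeriv (1 - α) b (fun s => ω s - ω b) r)‖ ≤
      ‖B‖ * ((Real.Gamma (1 - α))⁻¹ * R) * ((Real.Gamma α)⁻¹ * (1 + (1 - α) / (δ' - (1 - α))) * H) *
        ((r - a) ^ (-α) * (b - r) ^ (α + δ' - 1 - κ) +
          α / (δ - α) * ((r - a) ^ (δ - α) * (b - r) ^ (α + δ' - 1 - ρ))) := by
  have hbr : 0 < b - r := sub_pos.2 hrb
  have hra : 0 < r - a := sub_pos.2 har
  have hΓ : 0 < Real.Gamma (1 - α) := Real.Gamma_pos_of_pos (by linarith)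
  have h6 : 0 < δ - α := by linarith
  refine (B.le_opNorm₂ _ _).trans ?_
  have h1 := norm_leftFracDeriv_sing_le hα hα1 hαδ hK har.le hrb
  have h2 := norm_rightFracDeriv_path_le hα hα1 hδ' hω har.le hrb
  calc _ ≤ ‖B‖ * ((Real.Gamma (1 - α))⁻¹ * R *
      ((r - a) ^ (-α) * (b - r) ^ (-κ) + α / (δ - α) * ((r - a) ^ (δ - α) * (b - r) ^ (-ρ)))) *
      ((Real.Gamma α)⁻¹ * (1 + (1 - α) / (δ' - (1 - α))) * H * (b - r) ^ (α + δ' - 1)) := by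
        gcongr
    _ = _ := by
      have e1 : (b - r) ^ (α + δ' - 1 - κ) = (b - r) ^ (-κ) * (b - r) ^ (α + δ' - 1) := by
        rw [← Real.rpow_add hbr]; ring_nf
      have e2 : (b - r) ^ (α + δ' - 1 - ρ) = (b - r) ^ (-ρ) * (b - r) ^ (α + δ' - 1) := by
        rw [← Real.rpow_add hbr]; ring_nf
      rw [e1, e2]
      ring

theorem intervalIntegrable_fracBound (hα1 : α < 1) (hαδ : α < δ) (hκ : κ < α + δ')
    (hρ : ρ < α + δ') (hab : a ≤ b) :
    IntervalIntegrable (fun r => (r - a) ^ (-α) * (b - r) ^ (α + δ' - 1 - κ) +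
          α / (δ - α) * ((r - a) ^ (δ - α) * (b - r) ^ (α + δ' - 1 - ρ))) volume a b :=
  (intervalIntegrable_beta (by linarith) (by linarith) hab).add
    ((intervalIntegrable_beta (by linarith) (by linarith) hab).const_mul _)

theorem intervalIntegrable_fracIntegrand (B : E →L[ℝ] F →L[ℝ] W) (hα : 0 < α) (hα1 : α < 1)
    (hαδ : α < δ) (hδ' : 1 - α < δ') (hR : 0 ≤ R) (hκ : κ < α + δ') (hρ : ρ < α + δ')
    (hK : IsSingHolder κ ρ δ R K a b) (hω : IsHolderBound δ' H ω a b)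
    (hKm : StronglyMeasurable K) (hωm : StronglyMeasurable ω) (hab : a ≤ b) :
    IntervalIntegrable (fun r => B (leftFracDeriv α a K r)
      (rightFracDeriv (1 - α) b (fun s => ω s - ω b) r)) volume a b := by
  rw [intervalIntegrable_iff_integrableOn_Ioo_of_le hab]
  have h := (intervalIntegrable_fracBound hα1 hαδ hκ hρ hab).const_mul (‖B‖ *
    ((Real.Gamma (1 - α))⁻¹ * R) * ((Real.Gamma α)⁻¹ * (1 + (1 - α) / (δ' - (1 - α))) * H))
  rw [intervalIntegrable_iff_integrableOn_Ioo_of_le hab] at h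
  refine h.mono' ?_ ((ae_restrict_iff' measurableSet_Ioo).2 (ae_of_all _ fun r hr =>
    norm_fracIntegrand_le B hα hα1 hαδ hδ' hR hK hω hr.1 hr.2))
  exact (B.aestronglyMeasurable_comp₂
    (stronglyMeasurable_leftFracDeriv hKm _ _).aestronglyMeasurable
    (stronglyMeasurable_rightFracDeriv (hωm.sub stronglyMeasurable_const) _ _).aestronglyMeasurable)

/-- The pointwise bound is a sum of two Beta integrands. The relation `ρ = κ + δ` makes both of them
scale like `(b - a) ^ (δ' - κ)`. -/
theorem norm_fracIntegral_le (B : E →L[ℝ] F →L[ℝ] W) (hα : 0 < α) (hα1 : α < 1)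
    (hαδ : α < δ) (hδ' : 1 - α < δ') (hR : 0 ≤ R) (hκ : κ < α + δ')
    (hρδ : ρ = κ + δ) (hρ : ρ < α + δ')
    (hK : IsSingHolder κ ρ δ R K a b) (hω : IsHolderBound δ' H ω a b) (hab : a < b) :
    ‖fracIntegral B α a b K ω‖ ≤
      fracConst α δ' κ ρ δ * ‖B‖ * R * H * (b - a) ^ (δ' - κ) := by
  rw [fracIntegral, norm_neg]
  -- The integrand is cut off at `r = b`, where `K` is uncontrolled; this does not change the
  -- integral.
  have h := intervalIntegral.norm_integral_le_of_norm_le (μ := volume) hab.le (ae_of_all _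
    (fun r (hr : r ∈ Ioc a b) => ?_)) ((intervalIntegrable_fracBound hα1 hαδ hκ hρ hab.le).const_mul
      (‖B‖ * ((Real.Gamma (1 - α))⁻¹ * R) *
        ((Real.Gamma α)⁻¹ * (1 + (1 - α) / (δ' - (1 - α))) * H)))
    (f := fun r => (Ioo a b).indicator (fun r => B (leftFracDeriv α a K r)
      (rightFracDeriv (1 - α) b (fun s => ω s - ω b) r)) r)
  · have e : ∫ r in a..b, (Ioo a b).indicator (fun r => B (leftFracDeriv α a K r)
        (rightFracDeriv (1 - α) b (fun s => ω s - ω b) r)) r = ∫ r in a..b,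
        B (leftFracDeriv α a K r) (rightFracDeriv (1 - α) b (fun s => ω s - ω b) r) := by
      rw [intervalIntegral.integral_of_le hab.le, intervalIntegral.integral_of_le hab.le,
        integral_Ioc_eq_integral_Ioo, integral_Ioc_eq_integral_Ioo,
        setIntegral_indicator measurableSet_Ioo, inter_self]
    rw [e] at h
    refine h.trans (le_of_eq ?_)
    rw [intervalIntegral.integral_const_mul, intervalIntegral.integral_add
      (intervalIntegrable_beta (by linarith) (by linarith) hab.le)
      ((intervalIntegrable_beta (by linarith) (by linarith) hab.le).const_mul _),
      intervalIntegral.integral_const_mul, integral_beta _ _ hab, integral_beta _ _ hab]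
    have e1 : -α + (α + δ' - 1 - κ) + 1 = δ' - κ := by ring
    have e2 : δ - α + (α + δ' - 1 - ρ) + 1 = δ' - κ := by rw [hρδ]; ring
    rw [e1, e2, fracConst]
    ring
  · by_cases hrb : r < b
    · rw [indicator_of_mem (by exact ⟨hr.1, hrb⟩)]
      exact norm_fracIntegrand_le B hα hα1 hαδ hδ' hR hK hω hr.1 hrb
    · have hrb' : r = b := le_antisymm hr.2 (not_lt.1 hrb)
      rw [indicator_of_notMem (fun hh => hrb hh.2), norm_zero]
      have h1 := Real.Gamma_pos_of_pos hα
      have h2 := Real.Gamma_pos_of_pos (s := 1 - α) (by linarith)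
      have h5 : 0 < δ' - (1 - α) := by linarith
      have h6 : 0 < δ - α := by linarith
      have h7 : 0 < 1 - α := by linarith
      have hH : 0 ≤ H := by
        have := (norm_nonneg _).trans (hω a b le_rfl hab.le le_rfl)
        exact nonneg_of_mul_nonneg_left this (Real.rpow_pos_of_pos (sub_pos.2 hab) _)
      have h8 : 0 ≤ r - a := by linarith [hr.1]
      have h9 : 0 ≤ b - r := by linarith [hr.2]
      have := Real.rpow_nonneg h8 (-α)
      have := Real.rpow_nonneg h8 (δ - α)
      have := Real.rpow_nonneg h9 (α + δ' - 1 - κ)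
      have := Real.rpow_nonneg h9 (α + δ' - 1 - ρ)
      positivity

theorem intervalIntegrable_left_inner {r Q : ℝ} (hαδ : α < δ) (har : a ≤ r)
    (hKm : StronglyMeasurable K)
    (hQ : ∀ q, a ≤ q → q < r → ‖K r - K q‖ ≤ Q * (r - q) ^ δ) :
    IntervalIntegrable (fun q => ((r - q) ^ (1 + α))⁻¹ • (K r - K q)) volume a r := by
  have h := (intervalIntegrable_sub_rpow_right (p := δ - 1 - α) (by linarith) r a r).const_mul Q
  rw [intervalIntegrable_iff_integrableOn_Ioo_of_le har] at h ⊢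
  have hm : Measurable fun q : ℝ => ((r - q) ^ (1 + α))⁻¹ := by fun_prop
  refine h.mono' (hm.stronglyMeasurable.smul
    (stronglyMeasurable_const.sub hKm)).aestronglyMeasurable
    ((ae_restrict_iff' measurableSet_Ioo).2 (ae_of_all _ fun q hq =>
      norm_kernel_smul_le hq.2 (hQ q hq.1.le hq.2)))

/-- Bounded operators are pulled through the inner and the outer integral. Integrability holds for
singular integrands too, so this applies to the convolution kernel. -/
theorem fracIntegral_map {E' W' : Type*} [NormedAddCommGroup E'] [NormedSpace ℝ E']
    [NormedAddCommGroup W'] [NormedSpace ℝ W'] [CompleteSpace E] [CompleteSpace E']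
    [CompleteSpace W] [CompleteSpace W']
    (B : E →L[ℝ] F →L[ℝ] W) (B' : E' →L[ℝ] F →L[ℝ] W') (M : E →L[ℝ] E') (N : W →L[ℝ] W')
    (hMN : ∀ x y, B' (M x) y = N (B x y)) (hα : 0 < α) (hα1 : α < 1)
    (hαδ : α < δ) (hδ' : 1 - α < δ') (hR : 0 ≤ R) (hκ : κ < α + δ') (hρ : ρ < α + δ')
    (hK : IsSingHolder κ ρ δ R K a b) (hω : IsHolderBound δ' H ω a b)
    (hKm : StronglyMeasurable K) (hωm : StronglyMeasurable ω) (hab : a ≤ b) :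
    fracIntegral B' α a b (fun r => M (K r)) ω = N (fracIntegral B α a b K ω) := by
  have hpt : ∀ r ∈ Ioo a b, B' (leftFracDeriv α a (fun r => M (K r)) r)
      (rightFracDeriv (1 - α) b (fun s => ω s - ω b) r) = N (B (leftFracDeriv α a K r)
      (rightFracDeriv (1 - α) b (fun s => ω s - ω b) r)) := by
    intro r hr
    rw [← hMN]
    congr 2
    have hi := intervalIntegrable_left_inner hαδ hr.1.le hKm
      (fun q haq hqr => hK.norm_sub_le q r haq hqr hr.2)
    rw [leftFracDeriv, leftFracDeriv, map_smul, map_add, map_smul, map_smul,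
      ← ContinuousLinearMap.intervalIntegral_comp_comm M hi]
    simp only [map_smul, map_sub]
  have hi := intervalIntegrable_fracIntegrand B hα hα1 hαδ hδ' hR hκ hρ hK hω hKm hωm hab
  rw [fracIntegral, fracIntegral, map_neg, ← ContinuousLinearMap.intervalIntegral_comp_comm N hi]
  congr 1
  rw [intervalIntegral.integral_of_le hab, intervalIntegral.integral_of_le hab,
    integral_Ioc_eq_integral_Ioo, integral_Ioc_eq_integral_Ioo]
  exact setIntegral_congr_fun measurableSet_Ioo hpt

theorem fracIntegral_congr (B : E →L[ℝ] F →L[ℝ] W) {K' : ℝ → E}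
    (hab : a ≤ b) (h : ∀ r, a ≤ r → r < b → K r = K' r) :
    fracIntegral B α a b K ω = fracIntegral B α a b K' ω := by
  rw [fracIntegral, fracIntegral]
  congr 1
  rw [intervalIntegral.integral_of_le hab, intervalIntegral.integral_of_le hab,
    integral_Ioc_eq_integral_Ioo, integral_Ioc_eq_integral_Ioo]
  refine setIntegral_congr_fun measurableSet_Ioo fun r hr => ?_
  congr 2
  rw [leftFracDeriv, leftFracDeriv, h r hr.1.le hr.2]
  congr 3
  refine intervalIntegral.integral_congr fun q hq => ?_
  rw [uIcc_of_le hr.1.le] at hq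
  simp only [h q hq.1 (hq.2.trans_lt hr.2)]

end Estimate

theorem fracIntegral_self (B : E →L[ℝ] F →L[ℝ] W) (α a : ℝ) (K : ℝ → E) (ω : ℝ → F) :
    fracIntegral B α a a K ω = 0 := by
  simp [fracIntegral]

end FracIntegral

section HolderBounds

theorem IsHolderBound.isSingHolder {E : Type*} [NormedAddCommGroup E] {β R a b : ℝ} {K : ℝ → E}
    (hβ : 0 ≤ β) (hR : 0 ≤ R)
    (hK : IsHolderBound β R K a b) :
    IsSingHolder 0 0 β (‖K a‖ + R * (b - a) ^ β + R) K a b where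
  norm_le r hr hrb := by
    have h1 := hK a r le_rfl hr hrb.le
    have h2 : ‖K r‖ ≤ ‖K a‖ + ‖K r - K a‖ := by
      simpa using norm_add_le (K a) (K r - K a)
    have h3 : R * (r - a) ^ β ≤ R * (b - a) ^ β := by
      have : 0 ≤ r - a := by linarith
      gcongr
    simp only [neg_zero, Real.rpow_zero, mul_one]
    linarith
  norm_sub_le q r hq hqr hrb := by
    refine (hK q r hq hqr.le hrb.le).trans ?_
    simp only [neg_zero, Real.rpow_zero, mul_one]
    have h4 : 0 ≤ (b - a) ^ β := Real.rpow_nonneg (by linarith) _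
    have h5 := Real.rpow_nonneg (sub_nonneg.2 hqr.le) β
    gcongr
    have := norm_nonneg (K a)
    have := mul_nonneg hR h4
    linarith

end HolderBounds

/-! ### Additivity of the pathwise integral over adjacent intervals -/

section Additivity

variable {E F W : Type*} [NormedAddCommGroup E] [NormedSpace ℝ E] [NormedAddCommGroup F]
  [NormedSpace ℝ F] [NormedAddCommGroup W] [NormedSpace ℝ W]

/-- An exponent above 1 forces the derivative to vanish. -/
theorem eq_of_norm_sub_le_rpow {f : ℝ → W} {a b C ε : ℝ} (hε : 0 < ε) (hab : a ≤ b)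
    (h : ∀ x y, a ≤ x → x < y → y ≤ b → ‖f y - f x‖ ≤ C * (y - x) ^ (1 + ε)) : f b = f a := by
  have hd : ∀ x ∈ Icc a b, HasDerivWithinAt f 0 (Icc a b) x := by
    intro x hx
    rw [hasDerivWithinAt_iff_isLittleO]
    have hO : (fun y => f y - f x - (y - x) • (0 : W)) =O[nhdsWithin x (Icc a b)]
        fun y => |y - x| ^ (1 + ε) := by
      refine Asymptotics.IsBigO.of_bound |C| ?_
      filter_upwards [self_mem_nhdsWithin] with y hy
      rw [smul_zero, sub_zero, Real.norm_of_nonneg (Real.rpow_nonneg (abs_nonneg _) _)]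
      rcases lt_trichotomy x y with hxy | rfl | hxy
      · rw [abs_of_pos (sub_pos.2 hxy)]
        refine (h x y hx.1 hxy hy.2).trans ?_
        have := Real.rpow_nonneg (sub_pos.2 hxy).le (1 + ε)
        gcongr
        exact le_abs_self _
      · simp only [sub_self, norm_zero]
        positivity
      · rw [abs_of_neg (sub_neg.2 hxy), neg_sub, norm_sub_rev]
        refine (h y x hy.1 hxy hx.2).trans ?_
        have := Real.rpow_nonneg (sub_pos.2 hxy).le (1 + ε)
        gcongr
        exact le_abs_self _
    refine hO.trans_isLittleO ?_
    rw [Asymptotics.isLittleO_iff]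
    intro c hc
    have ht : Filter.Tendsto (fun y => |y - x| ^ ε) (nhds x) (nhds 0) := by
      have : Continuous fun y : ℝ => |y - x| ^ ε :=
        Continuous.rpow_const (by fun_prop) fun _ => Or.inr hε.le
      simpa [Real.zero_rpow hε.ne'] using this.tendsto x
    filter_upwards [mem_nhdsWithin_of_mem_nhds (ht.eventually (ge_mem_nhds hc))] with y hy
    rw [Real.norm_of_nonneg (Real.rpow_nonneg (abs_nonneg _) _), Real.norm_eq_abs, add_comm 1 ε,
      Real.rpow_add_one' (abs_nonneg _) (by linarith)]
    gcongr
  refine constant_of_derivWithin_zero (fun x hx => (hd x hx).differentiableWithinAt)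
    (fun x hx => ?_) b ⟨hab, le_rfl⟩
  rcases hab.eq_or_lt with rfl | hlt
  · exact absurd hx (by simp)
  · exact (hd x ⟨hx.1, hx.2.le⟩).derivWithin (uniqueDiffOn_Icc hlt x ⟨hx.1, hx.2.le⟩)

variable {α β δ' R H a b c : ℝ} {K : ℝ → E} {ω : ℝ → F}

theorem leftFracDeriv_const (α a : ℝ) (v : E) (r : ℝ) :
    leftFracDeriv α a (fun _ => v) r = ((Real.Gamma (1 - α))⁻¹ * ((r - a) ^ α)⁻¹) • v := by
  simp [leftFracDeriv, smul_smul]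

theorem leftFracDeriv_sub_const (α a : ℝ) (K : ℝ → E) (v : E) (r : ℝ) :
    leftFracDeriv α a (fun s => K s - v) r = leftFracDeriv α a K r -
      leftFracDeriv α a (fun _ => v) r := by
  rw [leftFracDeriv_const, leftFracDeriv, leftFracDeriv]
  simp only [sub_sub_sub_cancel_right]
  module

/-- The left-sided derivative of a constant is a multiple of `(r - a) ^ (-α)`, so the integral is
exactly the inversion formula with `γ = 1 - α` for `ω - ω b`, evaluated at `a`. -/
theorem fracIntegral_const [CompleteSpace F] [CompleteSpace W] (B : E →L[ℝ] F →L[ℝ] W)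
    (hα : 0 < α) (hα1 : α < 1)
    (hδ' : 1 - α < δ') (hω : IsHolderBound δ' H ω a b) (hωm : StronglyMeasurable ω) (hab : a ≤ b)
    (v : E) : fracIntegral B α a b (fun _ => v) ω = B v (ω b - ω a) := by
  rcases hab.eq_or_lt with rfl | hlt
  · simp [fracIntegral_self]
  have hcm : StronglyMeasurable fun s => ω s - ω b := hωm.sub stronglyMeasurable_const
  have h := integral_rpow_smul_rightFracDeriv (γ := 1 - α) (H := H) (δ := δ') hcm
    (by linarith) (by linarith) hδ' hlt (fun x y hx hxy hy => by
      have := hω x y hx hxy hy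
      rw [norm_sub_rev] at this
      simpa using this)
  have hi : IntervalIntegrable (fun r => (r - a) ^ (1 - α - 1) •
      rightFracDeriv (1 - α) b (fun s => ω s - ω b) r) volume a b := by
    rw [intervalIntegrable_iff_integrableOn_Ioo_of_le hab]
    have hb := (intervalIntegrable_beta (p := -α) (q := α + δ' - 1) (by linarith) (by linarith)
      hab).const_mul ((Real.Gamma α)⁻¹ * (1 + (1 - α) / (δ' - (1 - α))) * H)
    rw [intervalIntegrable_iff_integrableOn_Ioo_of_le hab] at hb
    have hm : Measurable fun r : ℝ => (r - a) ^ (1 - α - 1) := by fun_prop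
    refine hb.mono' (hm.stronglyMeasurable.smul
      (stronglyMeasurable_rightFracDeriv hcm _ _)).aestronglyMeasurable
      ((ae_restrict_iff' measurableSet_Ioo).2 (ae_of_all _ fun r hr => ?_))
    rw [norm_smul, Real.norm_of_nonneg (Real.rpow_nonneg (by linarith [hr.1]) _),
      show 1 - α - 1 = -α by ring, mul_left_comm]
    have := Real.rpow_nonneg (by linarith [hr.1] : 0 ≤ r - a) (-α)
    gcongr
    exact norm_rightFracDeriv_path_le hα hα1 hδ' hω hr.1.le hr.2
  have hΓ : Real.Gamma (1 - α) ≠ 0 := (Real.Gamma_pos_of_pos (by linarith)).ne'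
  have e : ∫ r in a..b, B (leftFracDeriv α a (fun _ => v) r)
      (rightFracDeriv (1 - α) b (fun s => ω s - ω b) r)
      = ∫ r in a..b, ((Real.Gamma (1 - α))⁻¹ • B v) ((r - a) ^ (1 - α - 1) •
      rightFracDeriv (1 - α) b (fun s => ω s - ω b) r) := by
    refine intervalIntegral.integral_congr fun r hr => ?_
    rw [uIcc_of_le hab] at hr
    simp only [leftFracDeriv_const]
    rw [show 1 - α - 1 = -α by ring, Real.rpow_neg (by linarith [hr.1])]
    simp [smul_smul, mul_comm]
  rw [fracIntegral, e, ContinuousLinearMap.intervalIntegral_comp_comm _ hi, h]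
  simp [smul_smul, hΓ]

theorem fracIntegral_sub_const [CompleteSpace F] [CompleteSpace W] (B : E →L[ℝ] F →L[ℝ] W)
    (hα : 0 < α) (hα1 : α < 1) (hαβ : α < β) (hβ : β < 1) (hδ' : 1 - α < δ') (hR : 0 ≤ R)
    (hK : IsHolderBound β R K a b)
    (hω : IsHolderBound δ' H ω a b) (hKm : StronglyMeasurable K) (hωm : StronglyMeasurable ω)
    (hab : a ≤ b) (v : E) : fracIntegral B α a b (fun s => K s - v) ω =
      fracIntegral B α a b K ω - B v (ω b - ω a) := by
  have hβ0 : 0 ≤ β := by linarith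
  have hS : ∀ {K : ℝ → E}, IsHolderBound β R K a b → StronglyMeasurable K →
      IntervalIntegrable (fun r => B (leftFracDeriv α a K r)
        (rightFracDeriv (1 - α) b (fun s => ω s - ω b) r)) volume a b := fun hK hKm =>
    intervalIntegrable_fracIntegrand B hα hα1 hαβ hδ'
      (by have := Real.rpow_nonneg (sub_nonneg.2 hab) β; positivity)
      (by linarith) (by linarith) (hK.isSingHolder hβ0 hR) hω hKm hωm hab
  have hc : IsHolderBound β R (fun _ : ℝ => v) a b := fun s t _ hst _ => by
    have := Real.rpow_nonneg (sub_nonneg.2 hst) β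
    simpa using mul_nonneg hR this
  rw [← fracIntegral_const B hα hα1 hδ' hω hωm hab v, fracIntegral, fracIntegral, fracIntegral,
    ← neg_sub', ← intervalIntegral.integral_sub (hS hK hKm) (hS hc stronglyMeasurable_const)]
  congr 1
  refine intervalIntegral.integral_congr fun r hr => ?_
  rw [uIcc_of_le hab] at hr
  rw [leftFracDeriv_sub_const, map_sub]
  rfl

theorem norm_rightFracDeriv_path_le_const {Λ r : ℝ} (hα : 0 < α) (hα1 : α < 1) (hδ : 1 - α < δ')
    (hH : 0 ≤ H) (hω : IsHolderBound δ' H ω a b) (har : a ≤ r) (hrb : r ≤ b) (hΛ : b - a ≤ Λ) :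
    ‖rightFracDeriv (1 - α) b (fun s => ω s - ω b) r‖ ≤
      (Real.Gamma α)⁻¹ * (1 + (1 - α) / (δ' - (1 - α))) * H * Λ ^ (α + δ' - 1) := by
  have h1 := Real.Gamma_pos_of_pos hα
  have h5 : 0 < δ' - (1 - α) := by linarith
  have h7 : 0 < 1 - α := by linarith
  have hΛ0 : 0 ≤ Λ := by linarith
  rcases hrb.eq_or_lt with rfl | hlt
  · have : rightFracDeriv (1 - α) r (fun s => ω s - ω r) r = 0 := by simp [rightFracDeriv]
    rw [this, norm_zero]
    positivity
  · refine (norm_rightFracDeriv_path_le hα hα1 hδ hω har hlt).trans ?_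
    have : 0 ≤ b - r := by linarith
    have : 0 ≤ α + δ' - 1 := by linarith
    gcongr
    linarith

theorem norm_leftFracDeriv_le_of_vanish {r : ℝ} (hα : 0 < α) (hα1 : α < 1) (hαβ : α < β)
    (hK : IsHolderBound β R K a b) (hKa : K a = 0) (har : a < r) (hrb : r ≤ b) :
    ‖leftFracDeriv α a K r‖ ≤
      (Real.Gamma (1 - α))⁻¹ * (1 + α / (β - α)) * R * (r - a) ^ (β - α) := by
  have h0 := hK a r le_rfl har.le hrb
  rw [hKa, sub_zero] at h0
  refine (norm_leftFracDeriv_le hα hα1 hαβ har.le h0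
    (fun q haq hqr => hK q r haq hqr.le hrb)).trans (le_of_eq ?_)
  rw [mul_assoc R, ← Real.rpow_add (sub_pos.2 har), ← sub_eq_add_neg]
  ring

/-- In the difference all terms containing `K r` cancel. What remains is a multiple of the integral
of `(r-q) ^ (-1-α) K q` over `[a, s]`, where `K q` is at most `R (s-a) ^ β` because `K a = 0`. -/
theorem norm_leftFracDeriv_sub_le [CompleteSpace E] {s r : ℝ} (hα : 0 < α) (hα1 : α < 1) (hαβ : α < β)
    (hR : 0 ≤ R) (hK : IsHolderBound β R K a b) (hKm : StronglyMeasurable K) (hKa : K a = 0)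
    (has : a < s) (hsr : s < r) (hrb : r ≤ b) :
    ‖leftFracDeriv α a K r - leftFracDeriv α s K r‖ ≤
      (Real.Gamma (1 - α))⁻¹ * R * (s - a) ^ β * ((r - s) ^ (-α) - (r - a) ^ (-α)) := by
  have hΓ : 0 < Real.Gamma (1 - α) := Real.Gamma_pos_of_pos (by linarith)
  have har := has.trans hsr
  have hi := intervalIntegrable_left_inner hαβ har.le hKm
    (fun q haq hqr => hK q r haq hqr.le hrb)
  have hi1 := hi.mono_set (c := a) (d := s) (by
    rw [uIcc_of_le har.le, uIcc_of_le has.le]; exact Icc_subset_Icc_right hsr.le)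
  have hi2 := hi.mono_set (c := s) (d := r) (by
    rw [uIcc_of_le har.le, uIcc_of_le hsr.le]; exact Icc_subset_Icc_left has.le)
  have hk := intervalIntegrable_sub_rpow_neg_left (α := α) has.le hsr
  have hkK : ∫ q in a..s, ((r - q) ^ (1 + α))⁻¹ • K q
      = (∫ q in a..s, ((r - q) ^ (1 + α))⁻¹ • K r) -
        ∫ q in a..s, ((r - q) ^ (1 + α))⁻¹ • (K r - K q) := by
    rw [← intervalIntegral.integral_sub (hk.smul_continuousOn continuousOn_const) hi1]
    refine intervalIntegral.integral_congr fun q _ => ?_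
    simp only [smul_sub, sub_sub_cancel]
  have hconst : ∫ q in a..s, ((r - q) ^ (1 + α))⁻¹ • K r
      = (((r - s) ^ (-α) - (r - a) ^ (-α)) / α) • K r := by
    rw [intervalIntegral.integral_smul_const, integral_sub_rpow_neg_left hα has.le hsr]
  have e : leftFracDeriv α a K r - leftFracDeriv α s K r =
      -((Real.Gamma (1 - α))⁻¹ * α) • ∫ q in a..s, ((r - q) ^ (1 + α))⁻¹ • K q := by
    rw [hkK, hconst, leftFracDeriv, leftFracDeriv,
      ← intervalIntegral.integral_add_adjacent_intervals hi1 hi2,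
      Real.rpow_neg (by linarith), Real.rpow_neg (by linarith), smul_sub, smul_smul]
    rw [show -((Real.Gamma (1 - α))⁻¹ * α) * ((((r - s) ^ α)⁻¹ - ((r - a) ^ α)⁻¹) / α) =
      -(Real.Gamma (1 - α))⁻¹ * (((r - s) ^ α)⁻¹ - ((r - a) ^ α)⁻¹) by field_simp]
    module
  have hb : ‖∫ q in a..s, ((r - q) ^ (1 + α))⁻¹ • K q‖ ≤
      R * (s - a) ^ β * (((r - s) ^ (-α) - (r - a) ^ (-α)) / α) := by
    rw [← integral_sub_rpow_neg_left hα has.le hsr, ← intervalIntegral.integral_const_mul]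
    refine intervalIntegral.norm_integral_le_of_norm_le has.le (ae_of_all _ fun q hq => ?_)
      (hk.const_mul _)
    have h1 := hK a q le_rfl hq.1.le (by linarith [hq.2])
    rw [hKa, sub_zero] at h1
    have h2 : 0 ≤ ((r - q) ^ (1 + α))⁻¹ :=
      inv_nonneg.2 (Real.rpow_nonneg (by linarith [hq.2]) _)
    rw [norm_smul, Real.norm_of_nonneg h2, mul_comm]
    have h3 : R * (q - a) ^ β ≤ R * (s - a) ^ β := by
      have : 0 ≤ q - a := by linarith [hq.1]
      have : 0 ≤ β := by linarith
      gcongr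
      exact hq.2
    gcongr
    exact h1.trans h3
  rw [e, norm_smul, norm_neg, Real.norm_of_nonneg (by positivity)]
  calc _ ≤ (Real.Gamma (1 - α))⁻¹ * α *
      (R * (s - a) ^ β * (((r - s) ^ (-α) - (r - a) ^ (-α)) / α)) := by gcongr
    _ = _ := by field_simp

end Additivity

section Additivity

variable {E F W : Type*} [NormedAddCommGroup E] [NormedSpace ℝ E] [NormedAddCommGroup F]
  [NormedSpace ℝ F] [NormedAddCommGroup W] [NormedSpace ℝ W]
  {α β δ' R H a b c : ℝ} {K : ℝ → E} {ω : ℝ → F}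

theorem integral_rpow_sub_rpow_le {s : ℝ} (hα1 : α < 1) (has : a ≤ s) (hsc : s ≤ c) :
    ∫ r in s..c, ((r - s) ^ (-α) - (r - a) ^ (-α)) ≤ (s - a) ^ (1 - α) / (1 - α) := by
  have hp : -1 < -α := by linarith
  have h1 : (0 : ℝ) < 1 - α := by linarith
  rw [intervalIntegral.integral_sub (intervalIntegrable_sub_rpow_left hp s s c)
    (intervalIntegrable_sub_rpow_left hp a s c), integral_sub_rpow_left hp,
    intervalIntegral.integral_comp_sub_right (fun x => x ^ (-α)), integral_rpow (Or.inl hp),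
    show -α + 1 = 1 - α by ring, ← sub_div]
  have : (c - s) ^ (1 - α) ≤ (c - a) ^ (1 - α) := by
    have : 0 ≤ c - s := by linarith
    gcongr
  gcongr
  linarith

/-- The defect splits into two integrals over `[a, s]`, in which the derivative of `K` is `O((s-a) ^
(β-α))`, and one over `[s, c]` of the difference between the derivatives started at `a` and at `s`.
Each is `O((s-a) ^ (1+β-α))`, with a constant depending on `c` only through `Λ`. -/
theorem norm_fracIntegral_defect_le_of_vanish [CompleteSpace E]
    (B : E →L[ℝ] F →L[ℝ] W) (hα : 0 < α) (hα1 : α < 1) (hαβ : α < β) (hβ : β < 1)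
    (hδ' : 1 - α < δ') (hR : 0 ≤ R) (hH : 0 ≤ H) {s Λ : ℝ}
    (hK : IsHolderBound β R K a c) (hω : IsHolderBound δ' H ω a c)
    (hKm : StronglyMeasurable K) (hωm : StronglyMeasurable ω) (hKa : K a = 0)
    (has : a < s) (hsc : s < c) (hΛ : c - a ≤ Λ) :
    ‖fracIntegral B α a c K ω - fracIntegral B α a s K ω - fracIntegral B α s c K ω‖ ≤
      ‖B‖ * ((Real.Gamma α)⁻¹ * (1 + (1 - α) / (δ' - (1 - α))) * H * Λ ^ (α + δ' - 1)) *
        ((Real.Gamma (1 - α))⁻¹ * R) * (2 * (1 + α / (β - α)) + (1 - α)⁻¹) *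
        (s - a) ^ (1 + (β - α)) := by
  have hβ0 : 0 ≤ β := by linarith
  have hac := has.trans hsc
  have h1 := Real.Gamma_pos_of_pos hα
  have h2 := Real.Gamma_pos_of_pos (s := 1 - α) (by linarith)
  have h6 : 0 < β - α := by linarith
  have h7 : 0 < 1 - α := by linarith
  have h5 : 0 < δ' - (1 - α) := by linarith
  have hΛ0 : 0 ≤ Λ := by linarith
  have hh : 0 < s - a := sub_pos.2 has
  set M := (Real.Gamma α)⁻¹ * (1 + (1 - α) / (δ' - (1 - α))) * H * Λ ^ (α + δ' - 1) with hM
  set A := (Real.Gamma (1 - α))⁻¹ * (1 + α / (β - α)) * R with hA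
  have hM0 : 0 ≤ M := by positivity
  have hA0 : 0 ≤ A := by positivity
  have hS : ∀ {x y : ℝ}, a ≤ x → x ≤ y → y ≤ c →
      IntervalIntegrable (fun r => B (leftFracDeriv α x K r)
        (rightFracDeriv (1 - α) y (fun s => ω s - ω y) r)) volume x y := fun hx hxy hy =>
    intervalIntegrable_fracIntegrand B hα hα1 hαβ hδ'
      (by have := Real.rpow_nonneg (sub_nonneg.2 hxy) β; positivity)
      (by linarith) (by linarith) ((hK.mono hx hy).isSingHolder hβ0 hR) (hω.mono hx hy)
      hKm hωm hxy
  have hL : ∀ r, a < r → r ≤ s → ‖leftFracDeriv α a K r‖ ≤ A * (s - a) ^ (β - α) := by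
    intro r har hrs
    refine (norm_leftFracDeriv_le_of_vanish hα hα1 hαβ hK hKa har (hrs.trans hsc.le)).trans ?_
    have : 0 ≤ r - a := by linarith
    gcongr
  have hRc : ∀ r, a ≤ r → r ≤ c →
      ‖rightFracDeriv (1 - α) c (fun s => ω s - ω c) r‖ ≤ M := fun r har hrc =>
    norm_rightFracDeriv_path_le_const hα hα1 hδ' hH (hω.mono har le_rfl) le_rfl hrc (by linarith)
  have hRs : ∀ r, a ≤ r → r ≤ s →
      ‖rightFracDeriv (1 - α) s (fun x => ω x - ω s) r‖ ≤ M := fun r har hrc =>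
    norm_rightFracDeriv_path_le_const hα hα1 hδ' hH (hω.mono har hsc.le) le_rfl hrc (by linarith)
  have hac1 := (hS le_rfl hac.le le_rfl).mono_set (c := a) (d := s) (by
    rw [uIcc_of_le hac.le, uIcc_of_le has.le]; exact Icc_subset_Icc_right hsc.le)
  have hac2 := (hS le_rfl hac.le le_rfl).mono_set (c := s) (d := c) (by
    rw [uIcc_of_le hac.le, uIcc_of_le hsc.le]; exact Icc_subset_Icc_left has.le)
  have hpow : (s - a) ^ (β - α) * (s - a) = (s - a) ^ (1 + (β - α)) := by
    rw [add_comm, Real.rpow_add_one hh.ne']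
  have b1 : ‖∫ r in a..s, B (leftFracDeriv α a K r)
      (rightFracDeriv (1 - α) c (fun s => ω s - ω c) r)‖ ≤
      ‖B‖ * (A * (s - a) ^ (β - α)) * M * |s - a| := by
    refine intervalIntegral.norm_integral_le_of_norm_le_const fun r hr => ?_
    rw [uIoc_of_le has.le] at hr
    refine (B.le_opNorm₂ _ _).trans ?_
    have := hL r hr.1 hr.2
    have := hRc r hr.1.le (hr.2.trans hsc.le)
    gcongr
  have b2 : ‖∫ r in a..s, B (leftFracDeriv α a K r)
      (rightFracDeriv (1 - α) s (fun x => ω x - ω s) r)‖ ≤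
      ‖B‖ * (A * (s - a) ^ (β - α)) * M * |s - a| := by
    refine intervalIntegral.norm_integral_le_of_norm_le_const fun r hr => ?_
    rw [uIoc_of_le has.le] at hr
    refine (B.le_opNorm₂ _ _).trans ?_
    have := hL r hr.1 hr.2
    have := hRs r hr.1.le hr.2
    gcongr
  have b3 : ‖∫ r in s..c, (B (leftFracDeriv α a K r)
        (rightFracDeriv (1 - α) c (fun s => ω s - ω c) r) - B (leftFracDeriv α s K r)
        (rightFracDeriv (1 - α) c (fun s => ω s - ω c) r))‖ ≤
      ‖B‖ * ((Real.Gamma (1 - α))⁻¹ * R * (s - a) ^ β) * M *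
        ((s - a) ^ (1 - α) / (1 - α)) := by
    refine (intervalIntegral.norm_integral_le_of_norm_le (g := fun r => ‖B‖ *
      ((Real.Gamma (1 - α))⁻¹ * R * (s - a) ^ β) * M * ((r - s) ^ (-α) - (r - a) ^ (-α)))
      hsc.le (ae_of_all _ fun r hr => ?_)
      (((intervalIntegrable_sub_rpow_left (by linarith) s s c).sub
        (intervalIntegrable_sub_rpow_left (by linarith) a s c)).const_mul _)).trans ?_
    · rw [← sub_apply, ← map_sub]
      refine (B.le_opNorm₂ _ _).trans ?_
      have h8 := norm_leftFracDeriv_sub_le hα hα1 hαβ hR hK hKm hKa has hr.1 hr.2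
      have h9 := hRc r (has.trans hr.1).le hr.2
      have h10 := (norm_nonneg _).trans h8
      calc _ ≤ ‖B‖ * ((Real.Gamma (1 - α))⁻¹ * R * (s - a) ^ β *
            ((r - s) ^ (-α) - (r - a) ^ (-α))) * M := by gcongr
        _ = _ := by ring
    · rw [intervalIntegral.integral_const_mul]
      gcongr
      exact integral_rpow_sub_rpow_le hα1 has.le hsc.le
  have hid : fracIntegral B α a c K ω - fracIntegral B α a s K ω - fracIntegral B α s c K ω =
      -(∫ r in a..s, B (leftFracDeriv α a K r)
        (rightFracDeriv (1 - α) c (fun s => ω s - ω c) r))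
      + (∫ r in a..s, B (leftFracDeriv α a K r)
        (rightFracDeriv (1 - α) s (fun x => ω x - ω s) r))
      - ∫ r in s..c, (B (leftFracDeriv α a K r)
        (rightFracDeriv (1 - α) c (fun s => ω s - ω c) r) - B (leftFracDeriv α s K r)
        (rightFracDeriv (1 - α) c (fun s => ω s - ω c) r)) := by
    rw [intervalIntegral.integral_sub hac2 (hS has.le hsc.le le_rfl), fracIntegral, fracIntegral,
      fracIntegral, ← intervalIntegral.integral_add_adjacent_intervals hac1 hac2]
    abel
  rw [hid]
  rw [← norm_neg] at b1
  refine (norm_sub_le _ _).trans ((add_le_add ((norm_add_le _ _).trans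
    (add_le_add b1 b2)) b3).trans (le_of_eq ?_))
  have hpow2 : (s - a) ^ β * (s - a) ^ (1 - α) = (s - a) ^ (1 + (β - α)) := by
    rw [← Real.rpow_add hh]; ring_nf
  rw [abs_of_pos hh, ← hpow2]
  rw [← hpow2] at hpow
  calc _ = ‖B‖ * M * A * 2 * ((s - a) ^ (β - α) * (s - a)) + ‖B‖ * M *
        ((Real.Gamma (1 - α))⁻¹ * R) * (1 - α)⁻¹ * ((s - a) ^ β * (s - a) ^ (1 - α)) := by ring
    _ = _ := by rw [hpow, hA]; ring

/-- The defect at the cut `b` is regarded as a function of the left endpoint `x`. It vanishes at `x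
= b`, and its increments are differences of defects over short first pieces, so it is constant. -/
theorem fracIntegral_add_adjacent [CompleteSpace E] [CompleteSpace F] [CompleteSpace W]
    (B : E →L[ℝ] F →L[ℝ] W) (hα : 0 < α) (hα1 : α < 1) (hαβ : α < β) (hβ : β < 1)
    (hδ' : 1 - α < δ') (hR : 0 ≤ R) (hH : 0 ≤ H)
    (hK : IsHolderBound β R K a c) (hω : IsHolderBound δ' H ω a c)
    (hKm : StronglyMeasurable K) (hωm : StronglyMeasurable ω) (hab : a ≤ b) (hbc : b ≤ c) :
    fracIntegral B α a c K ω = fracIntegral B α a b K ω + fracIntegral B α b c K ω := by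
  obtain ⟨C, hC⟩ : ∃ C, ∀ x s y, a ≤ x → x < s → s ≤ y → y ≤ c →
      ‖fracIntegral B α x y K ω - fracIntegral B α x s K ω - fracIntegral B α s y K ω‖ ≤
        C * (s - x) ^ (1 + (β - α)) := by
    refine ⟨‖B‖ * ((Real.Gamma α)⁻¹ * (1 + (1 - α) / (δ' - (1 - α))) * H *
        (c - a) ^ (α + δ' - 1)) * ((Real.Gamma (1 - α))⁻¹ * R) *
        (2 * (1 + α / (β - α)) + (1 - α)⁻¹), fun x s y hx hxs hsy hy => ?_⟩
    rcases hsy.eq_or_lt with rfl | hlt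
    · rw [fracIntegral_self, sub_self, sub_zero, norm_zero]
      have h1 := Real.Gamma_pos_of_pos hα
      have h2 := Real.Gamma_pos_of_pos (s := 1 - α) (by linarith)
      have h6 : 0 < β - α := by linarith
      have h7 : 0 < 1 - α := by linarith
      have h5 : 0 < δ' - (1 - α) := by linarith
      have h8 : 0 ≤ c - a := by linarith
      have h9 : 0 ≤ s - x := by linarith
      positivity
    -- Subtracting `K x` makes the integrand vanish at the left endpoint. The defect is unaffected,
    -- since constants integrate to increments of `ω`, which are additive.
    have hv := norm_fracIntegral_defect_le_of_vanish B hα hα1 hαβ hβ hδ' hR hH (s := s)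
      (Λ := c - a) (K := fun r => K r - K x) (fun s t hs hst ht => by
        simpa using hK s t (hx.trans hs) hst (ht.trans hy)) (hω.mono hx hy)
      (hKm.sub stronglyMeasurable_const) hωm (sub_self _) hxs hlt (by linarith)
    have hsub : ∀ p q, x ≤ p → p ≤ q → q ≤ y →
        fracIntegral B α p q (fun r => K r - K x) ω =
          fracIntegral B α p q K ω - B (K x) (ω q - ω p) := fun p q hp hpq hq =>
      fracIntegral_sub_const B hα hα1 hαβ hβ hδ' hR (hK.mono (hx.trans hp) (hq.trans hy))
        (hω.mono (hx.trans hp) (hq.trans hy)) hKm hωm hpq _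
    rw [hsub x y le_rfl (by linarith) le_rfl, hsub x s le_rfl hxs.le hsy,
      hsub s y hxs.le hsy le_rfl] at hv
    convert hv using 2
    simp only [map_sub]
    abel
  set f : ℝ → W := fun x =>
    fracIntegral B α x c K ω - fracIntegral B α x b K ω - fracIntegral B α b c K ω with hf
  have hconst := eq_of_norm_sub_le_rpow (f := f) (a := a) (b := b) (C := C + C) (ε := β - α)
    (by linarith) hab (fun x s hx hxs hs => by
      have h1 := (hC x s c hx hxs (hs.trans hbc) le_rfl)
      have h2 := (hC x s b hx hxs hs hbc)
      have e : f s - f x =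
        (fracIntegral B α x b K ω - fracIntegral B α x s K ω - fracIntegral B α s b K ω) -
        (fracIntegral B α x c K ω - fracIntegral B α x s K ω - fracIntegral B α s c K ω) := by
        simp only [hf]; abel
      rw [e, add_mul]
      exact (norm_sub_le _ _).trans (add_le_add h2 h1))
  have h0 : f b = 0 := by simp [hf, fracIntegral_self]
  rw [h0] at hconst
  have : f a = 0 := hconst.symm
  simp only [hf] at this
  rw [sub_sub] at this
  exact sub_eq_zero.1 this

end Additivity

/-! ### Hilbert–Schmidt operators: evaluation and composition -/

section HilbertSchmidtBounds

variable {V : Type*} [NormedAddCommGroup V] [InnerProductSpace ℝ V]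

theorem HilbertBasis.norm_sq_eq_tsum (e : HilbertBasis ℕ ℝ V) (v : V) :
    ‖v‖ ^ 2 = ∑' i, (e.repr v i) ^ 2 := by
  have h := lp.norm_rpow_eq_tsum (p := 2) (by norm_num) (e.repr v)
  norm_num at h
  exact h

theorem HilbertBasis.summable_sq (e : HilbertBasis ℕ ℝ V) (v : V) :
    Summable fun i => (e.repr v i) ^ 2 := by
  have := (memℓp_gen_iff (p := 2) (by norm_num)).1 (lp.memℓp (e.repr v))
  simpa using this

theorem HSOp.summable_sq {e : HilbertBasis ℕ ℝ V} (T : HSOp e) :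
    Summable fun i => ‖T.toCLM (e i)‖ ^ 2 := by
  have h : Memℓp (fun i => T.toCLM (e i)) 2 := T.2
  have := (memℓp_gen_iff (p := 2) (by norm_num)).1 h
  simpa using this

theorem HSOp.norm_apply_le {e : HilbertBasis ℕ ℝ V} (T : HSOp e) (v : V) :
    ‖T.toCLM v‖ ≤ ‖T‖ * ‖v‖ := by
  have hsum : HasSum (fun i => e.repr v i • T.toCLM (e i)) (T.toCLM v) := by
    simpa using (e.hasSum_repr v).mapL T.toCLM
  have hpq : (2 : ℝ).HolderConjugate 2 := Real.HolderConjugate.two_two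
  obtain ⟨hs, hle⟩ := Real.summable_and_inner_le_Lp_mul_Lq_tsum_of_nonneg hpq
    (fun i => norm_nonneg (e.repr v i)) (fun i => norm_nonneg (T.toCLM (e i)))
    (by simpa using HilbertBasis.summable_sq e v) (by simpa using T.summable_sq)
  rw [← hsum.tsum_eq]
  refine (norm_tsum_le_tsum_norm (by simpa only [norm_smul] using hs)).trans ?_
  simp only [norm_smul]
  refine hle.trans (le_of_eq ?_)
  have h1 : (∑' i, ‖e.repr v i‖ ^ (2 : ℝ)) = ‖v‖ ^ 2 := by
    rw [HilbertBasis.norm_sq_eq_tsum e v]; simp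
  have h2 : (∑' i, ‖T.toCLM (e i)‖ ^ (2 : ℝ)) = ‖T‖ ^ 2 := by
    rw [T.norm_sq_eq]; simp
  rw [h1, h2, ← Real.sqrt_eq_rpow, ← Real.sqrt_eq_rpow, Real.sqrt_sq (norm_nonneg _),
    Real.sqrt_sq (norm_nonneg _), mul_comm]

theorem HSOp.norm_lcomp_le {e : HilbertBasis ℕ ℝ V} (B : V →L[ℝ] V) (T : HSOp e) :
    ‖HSOp.lcomp B T‖ ≤ ‖B‖ * ‖T‖ := by
  refine le_of_sq_le_sq ?_ (by positivity)
  rw [mul_pow, (HSOp.lcomp B T).norm_sq_eq, T.norm_sq_eq, ← tsum_mul_left]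
  refine (HSOp.lcomp B T).summable_sq.tsum_le_tsum (fun i => ?_) (T.summable_sq.mul_left _)
  rw [← mul_pow]
  gcongr
  exact B.le_opNorm _

/-- The evaluation pairing of a Hilbert-Schmidt operator and a vector. -/
noncomputable def hsApply (e : HilbertBasis ℕ ℝ V) : HSOp e →L[ℝ] V →L[ℝ] V :=
  LinearMap.mkContinuous
    { toFun := HSOp.toCLM
      map_add' := fun _ _ => rfl
      map_smul' := fun _ _ => rfl } 1 fun T => by
    rw [one_mul]
    exact T.toCLM.opNorm_le_bound (norm_nonneg _) T.norm_apply_le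

/-- The composition of a bounded operator and a Hilbert-Schmidt operator. -/
noncomputable def hsComp (e : HilbertBasis ℕ ℝ V) : (V →L[ℝ] V) →L[ℝ] HSOp e →L[ℝ] HSOp e :=
  LinearMap.mkContinuous₂
    (LinearMap.mk₂ ℝ HSOp.lcomp
      (fun B C T => by apply Subtype.ext; ext v; rfl)
      (fun c B T => by apply Subtype.ext; ext v; rfl)
      (fun B S T => by apply Subtype.ext; ext v; exact B.map_add _ _)
      (fun c B T => by apply Subtype.ext; ext v; exact B.map_smul _ _)) 1 fun B T => by
    rw [one_mul]
    exact HSOp.norm_lcomp_le B T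

theorem norm_hsComp_le (e : HilbertBasis ℕ ℝ V) (B : V →L[ℝ] V) (T : HSOp e) :
    ‖hsComp e B T‖ ≤ ‖B‖ * ‖T‖ := HSOp.norm_lcomp_le B T

theorem hsComp_comp (e : HilbertBasis ℕ ℝ V) (B C : V →L[ℝ] V) (T : HSOp e) :
    hsComp e B (hsComp e C T) = hsComp e (B.comp C) T := rfl

theorem pathIntegral_eq_fracIntegral {e : HilbertBasis ℕ ℝ V} (α a b : ℝ) (K : ℝ → HSOp e)
    (ω : ℝ → V) : pathIntegral α a b K ω = fracIntegral (hsApply e) α a b K ω := rfl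

end HilbertSchmidtBounds

/-! ### Diagonal operators and smoothing by the semigroup -/

section Diagonal

variable {V : Type*} [NormedAddCommGroup V] [InnerProductSpace ℝ V] {e : HilbertBasis ℕ ℝ V}
  {lam : ℕ → ℝ}

theorem norm_le_of_repr_le {v w : V} {C : ℝ} (hC : 0 ≤ C)
    (h : ∀ i, |e.repr w i| ≤ C * |e.repr v i|) : ‖w‖ ≤ C * ‖v‖ := by
  refine le_of_sq_le_sq ?_ (by positivity)
  rw [mul_pow, HilbertBasis.norm_sq_eq_tsum e w, HilbertBasis.norm_sq_eq_tsum e v,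
    ← tsum_mul_left]
  refine (HilbertBasis.summable_sq e w).tsum_le_tsum (fun i => ?_)
    ((HilbertBasis.summable_sq e v).mul_left _)
  rw [← sq_abs, ← sq_abs (e.repr v i), ← mul_pow]
  have := h i
  gcongr

theorem norm_le_fracNorm {v w : V} {C δ : ℝ} (hC : 0 ≤ C) (hv : MemFrac e lam δ v)
    (h : ∀ i, |e.repr w i| ≤ C * |lam i ^ δ * e.repr v i|) : ‖w‖ ≤ C * fracNorm e lam δ v := by
  have h0 : 0 ≤ fracNorm e lam δ v := Real.sqrt_nonneg _
  refine le_of_sq_le_sq ?_ (by positivity)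
  rw [mul_pow, HilbertBasis.norm_sq_eq_tsum e w, fracNorm,
    Real.sq_sqrt (tsum_nonneg fun i => sq_nonneg _), ← tsum_mul_left]
  refine (HilbertBasis.summable_sq e w).tsum_le_tsum (fun i => ?_) (hv.mul_left _)
  rw [← e.repr_apply_apply, ← sq_abs, ← sq_abs (lam i ^ δ * _), ← mul_pow]
  have := h i
  gcongr

theorem ext_repr (e : HilbertBasis ℕ ℝ V) {v w : V} (h : ∀ i, e.repr v i = e.repr w i) : v = w :=
  e.repr.injective (lp.ext (funext h))

theorem IsGeneratorData.lam_pos {A : V →ₗ.[ℝ] V} (hA : IsGeneratorData A e lam) (i : ℕ) :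
    0 < lam i := by
  obtain ⟨h, hi⟩ := hA.eigen i
  have hn : ‖e i‖ = 1 := e.orthonormal.1 i
  have hne : (⟨e i, h⟩ : A.domain) ≠ 0 := fun h0 => by
    have : e i = 0 := congrArg Subtype.val h0
    rw [this, norm_zero] at hn
    exact zero_ne_one hn
  have := hA.positive ⟨e i, h⟩ hne
  rw [hi, real_inner_smul_left, real_inner_self_eq_norm_sq, hn] at this
  simpa using this

theorem repr_semigroup (hl : ∀ i, 0 < lam i) {t : ℝ} (ht : 0 ≤ t) (v : V) (i : ℕ) :
    e.repr (semigroup e lam t v) i = Real.exp (-lam i * t) * e.repr v i := by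
  refine repr_diagOp e ⟨1, fun i => ?_⟩ v i
  rw [abs_of_pos (Real.exp_pos _)]
  exact Real.exp_le_one_iff.2 (by nlinarith [hl i])

theorem semigroup_zero (hl : ∀ i, 0 < lam i) : semigroup e lam 0 = ContinuousLinearMap.id ℝ V := by
  ext v
  refine ext_repr e fun i => ?_
  rw [repr_semigroup hl le_rfl]
  simp

theorem semigroup_add (hl : ∀ i, 0 < lam i) {s t : ℝ} (hs : 0 ≤ s) (ht : 0 ≤ t) :
    semigroup e lam (s + t) = (semigroup e lam s).comp (semigroup e lam t) := by
  ext v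
  refine ext_repr e fun i => ?_
  rw [ContinuousLinearMap.comp_apply, repr_semigroup hl (add_nonneg hs ht), repr_semigroup hl hs,
    repr_semigroup hl ht, ← mul_assoc, ← Real.exp_add]
  ring_nf

/-- This allows an identity in `V` to be checked after smoothing by `S(1)`. -/
theorem semigroup_injective (hl : ∀ i, 0 < lam i) {t : ℝ} (ht : 0 ≤ t) :
    Function.Injective (semigroup e lam t) := by
  intro v w h
  refine ext_repr e fun i => ?_
  have := congrArg (fun x => e.repr x i) h
  simp only [repr_semigroup hl ht] at this
  exact mul_left_cancel₀ (Real.exp_pos _).ne' this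

theorem norm_semigroup_apply_le (hl : ∀ i, 0 < lam i) (hm : Monotone lam) {t : ℝ} (ht : 0 ≤ t)
    (v : V) : ‖semigroup e lam t v‖ ≤ Real.exp (-lam 0 * t) * ‖v‖ := by
  refine norm_le_of_repr_le (e := e) (Real.exp_pos _).le fun i => ?_
  rw [repr_semigroup hl ht, abs_mul, abs_of_pos (Real.exp_pos _)]
  have := hm (Nat.zero_le i)
  gcongr

theorem one_sub_exp_neg_le_rpow {y θ : ℝ} (hy : 0 ≤ y) (hθ0 : 0 ≤ θ) (hθ1 : θ ≤ 1) :
    1 - Real.exp (-y) ≤ y ^ θ := by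
  rcases le_total 1 y with h | h
  · exact (sub_le_self _ (Real.exp_pos _).le).trans (Real.one_le_rpow h hθ0)
  · have h1 := Real.add_one_le_exp (-y)
    calc 1 - Real.exp (-y) ≤ y := by linarith
      _ = y ^ (1 : ℝ) := (Real.rpow_one y).symm
      _ ≤ y ^ θ := by
        rcases hy.eq_or_lt with rfl | hy
        · rw [Real.zero_rpow one_ne_zero]; exact Real.rpow_nonneg le_rfl _
        · exact Real.rpow_le_rpow_of_exponent_ge hy h hθ1

/-- The constant comes from `y² ≤ 2 exp y`; exponents up to 2 suffice for all smoothing estimates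
below. -/
theorem rpow_mul_exp_neg_le {y p : ℝ} (hy : 0 ≤ y) (hp0 : 0 ≤ p) (hp2 : p ≤ 2) :
    y ^ p * Real.exp (-y) ≤ 2 := by
  have h1 : y ^ p ≤ 2 * Real.exp y := by
    rcases le_total 1 y with h | h
    · have h2 : y ^ p ≤ y ^ (2 : ℝ) := Real.rpow_le_rpow_of_exponent_le h hp2
      have h3 := Real.quadratic_le_exp_of_nonneg hy
      rw [Real.rpow_two] at h2
      linarith
    · have h2 : y ^ p ≤ 1 := Real.rpow_le_one hy h hp0
      have := Real.one_le_exp hy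
      linarith
  rw [Real.exp_neg, ← div_eq_mul_inv, div_le_iff₀ (Real.exp_pos _)]
  exact h1

theorem rpow_mul_exp_neg_mul_le {l x p : ℝ} (hl : 0 ≤ l) (hx : 0 < x) (hp0 : 0 ≤ p) (hp2 : p ≤ 2) :
    l ^ p * Real.exp (-l * x) ≤ 2 * x ^ (-p) := by
  have h := rpow_mul_exp_neg_le (mul_nonneg hl hx.le) hp0 hp2
  rw [Real.mul_rpow hl hx.le] at h
  rw [Real.rpow_neg hx.le, ← div_eq_mul_inv, le_div_iff₀ (Real.rpow_pos_of_pos hx _), neg_mul]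
  linarith

/-- The operator `D` acts on the base by a multiplier `m` with `|m i| ≤ N lam i ^ κ`. -/
def IsMultiplier (e : HilbertBasis ℕ ℝ V) (lam : ℕ → ℝ) (κ N : ℝ) (D : V →L[ℝ] V) : Prop :=
  ∃ m : ℕ → ℝ, (∀ i, |m i| ≤ N * lam i ^ κ) ∧ ∀ v i, e.repr (D v) i = m i * e.repr v i

theorem isMultiplier_id : IsMultiplier e lam 0 1 (ContinuousLinearMap.id ℝ V) :=
  ⟨fun _ => 1, fun i => by simp, fun v i => by simp⟩

/-- Regularity is traded for a power of `h`: spatial singularity of order `κ` buys the time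
increment `h ^ κ`. With `κ = β` this is the source of the Hölder seminorm bound for `u`. -/
theorem isMultiplier_semigroup_sub_id (hl : ∀ i, 0 < lam i) {h κ : ℝ} (hh : 0 ≤ h) (hκ0 : 0 ≤ κ)
    (hκ1 : κ ≤ 1) :
    IsMultiplier e lam κ (h ^ κ) (semigroup e lam h - ContinuousLinearMap.id ℝ V) := by
  refine ⟨fun i => Real.exp (-lam i * h) - 1, fun i => ?_, fun v i => ?_⟩
  · have h0 : 0 ≤ lam i * h := mul_nonneg (hl i).le hh
    have h1 : Real.exp (-lam i * h) ≤ 1 := Real.exp_le_one_iff.2 (by linarith)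
    rw [abs_of_nonpos (by linarith), neg_sub, neg_mul, mul_comm (h ^ κ),
      ← Real.mul_rpow (hl i).le hh]
    exact one_sub_exp_neg_le_rpow h0 hκ0 hκ1
  · rw [sub_apply, map_sub, lp.coeFn_sub, Pi.sub_apply,
      repr_semigroup hl hh, sub_mul, one_mul]
    rfl

/-- Parabolic smoothing: on each mode, `lam i ^ κ exp(-lam i x)` is bounded by `2 x ^ (-κ)`. -/
theorem IsMultiplier.norm_comp_semigroup_le {κ N x : ℝ} {D : V →L[ℝ] V} (hl : ∀ i, 0 < lam i)
    (hN : 0 ≤ N) (hD : IsMultiplier e lam κ N D) (hκ0 : 0 ≤ κ) (hκ2 : κ ≤ 2) (hx : 0 < x) :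
    ‖D.comp (semigroup e lam x)‖ ≤ 2 * N * x ^ (-κ) := by
  obtain ⟨m, hm, hD⟩ := hD
  have h0 : 0 ≤ 2 * N * x ^ (-κ) := by positivity
  refine ContinuousLinearMap.opNorm_le_bound _ h0 fun v => norm_le_of_repr_le (e := e) h0 fun i => ?_
  rw [ContinuousLinearMap.comp_apply, hD, repr_semigroup hl hx.le, ← mul_assoc, abs_mul, abs_mul,
    abs_of_pos (Real.exp_pos _)]
  have h1 := rpow_mul_exp_neg_mul_le (hl i).le hx hκ0 hκ2
  refine mul_le_mul_of_nonneg_right ?_ (abs_nonneg _)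
  calc |m i| * Real.exp (-lam i * x) ≤ N * lam i ^ κ * Real.exp (-lam i * x) := by
        have := hm i; gcongr
    _ = N * (lam i ^ κ * Real.exp (-lam i * x)) := by ring
    _ ≤ N * (2 * x ^ (-κ)) := by gcongr
    _ = _ := by ring

/-- Factor `S(x) - S(y) = S(x) (1 - S(y - x))`. The second factor costs `lam i ^ δ (y-x) ^ δ`, and
`S(x)` absorbs the total power `κ + δ`. -/
theorem IsMultiplier.norm_comp_semigroup_sub_le {κ N x y δ : ℝ} {D : V →L[ℝ] V}
    (hl : ∀ i, 0 < lam i) (hN : 0 ≤ N) (hD : IsMultiplier e lam κ N D) (hκ0 : 0 ≤ κ) (hδ0 : 0 ≤ δ)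
    (hδ1 : δ ≤ 1) (hκ2 : κ + δ ≤ 2) (hx : 0 < x) (hxy : x ≤ y) :
    ‖D.comp (semigroup e lam x) - D.comp (semigroup e lam y)‖ ≤
      2 * N * x ^ (-(κ + δ)) * (y - x) ^ δ := by
  obtain ⟨m, hm, hD⟩ := hD
  have hyx : 0 ≤ y - x := sub_nonneg.2 hxy
  have h0 : 0 ≤ 2 * N * x ^ (-(κ + δ)) * (y - x) ^ δ := by positivity
  refine ContinuousLinearMap.opNorm_le_bound _ h0 fun v => norm_le_of_repr_le (e := e) h0 fun i => ?_
  rw [sub_apply, map_sub, lp.coeFn_sub, Pi.sub_apply,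
    ContinuousLinearMap.comp_apply, ContinuousLinearMap.comp_apply, hD, hD,
    repr_semigroup hl hx.le, repr_semigroup hl (hx.le.trans hxy)]
  have e1 : Real.exp (-lam i * y) = Real.exp (-lam i * x) * Real.exp (-(lam i * (y - x))) := by
    rw [← Real.exp_add]; ring_nf
  have e2 : m i * (Real.exp (-lam i * x) * e.repr v i) - m i * (Real.exp (-lam i * y) * e.repr v i)
      = m i * Real.exp (-lam i * x) * (1 - Real.exp (-(lam i * (y - x)))) * e.repr v i := by
    rw [e1]; ring
  have h2 : 0 ≤ lam i * (y - x) := mul_nonneg (hl i).le hyx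
  have h3 := one_sub_exp_neg_le_rpow h2 hδ0 hδ1
  have h4 : 0 ≤ 1 - Real.exp (-(lam i * (y - x))) :=
    sub_nonneg.2 (Real.exp_le_one_iff.2 (by linarith))
  rw [e2, abs_mul, abs_mul, abs_mul, abs_of_pos (Real.exp_pos _), abs_of_nonneg h4]
  have h1 := rpow_mul_exp_neg_mul_le (hl i).le hx (add_nonneg hκ0 hδ0) hκ2
  refine mul_le_mul_of_nonneg_right ?_ (abs_nonneg _)
  rw [Real.mul_rpow (hl i).le hyx] at h3
  have h5 := hl i
  calc |m i| * Real.exp (-lam i * x) * (1 - Real.exp (-(lam i * (y - x))))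
      ≤ N * lam i ^ κ * Real.exp (-lam i * x) * (lam i ^ δ * (y - x) ^ δ) := by
        have := hm i; gcongr
    _ = N * (lam i ^ (κ + δ) * Real.exp (-lam i * x)) * (y - x) ^ δ := by
        rw [Real.rpow_add h5]; ring
    _ ≤ N * (2 * x ^ (-(κ + δ))) * (y - x) ^ δ := by gcongr
    _ = _ := by ring

theorem continuousOn_semigroup (hl : ∀ i, 0 < lam i) : ContinuousOn (semigroup e lam) (Ioi 0) := by
  intro x hx
  have hx0 : 0 < x := hx
  refine ContinuousAt.continuousWithinAt ?_
  have hb : ∀ y z : ℝ, x / 2 ≤ y → y ≤ z → ‖semigroup e lam y - semigroup e lam z‖ ≤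
      2 * (x / 2) ^ (-1 : ℝ) * (z - y) := by
    intro y z hy hyz
    have hy0 : 0 < y := by linarith
    have h := (isMultiplier_id (e := e) (lam := lam)).norm_comp_semigroup_sub_le hl zero_le_one
      le_rfl zero_le_one le_rfl (by norm_num) hy0 hyz
    simp only [ContinuousLinearMap.id_comp, Real.rpow_one, mul_one, zero_add] at h
    refine h.trans ?_
    have : 0 ≤ z - y := by linarith
    have : y ^ (-1 : ℝ) ≤ (x / 2) ^ (-1 : ℝ) :=
      Real.rpow_le_rpow_of_nonpos (by linarith) hy (by norm_num)
    gcongr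
  rw [ContinuousAt, tendsto_iff_norm_sub_tendsto_zero]
  have hlim : Filter.Tendsto (fun y => 2 * (x / 2) ^ (-1 : ℝ) * |y - x|) (nhds x) (nhds 0) := by
    have : Continuous fun y => 2 * (x / 2) ^ (-1 : ℝ) * |y - x| := by fun_prop
    simpa using this.tendsto x
  refine squeeze_zero' (Filter.Eventually.of_forall fun _ => norm_nonneg _) ?_ hlim
  filter_upwards [Ioi_mem_nhds (show x / 2 < x by linarith)] with y hy
  rcases le_total x y with h | h
  · rw [abs_of_nonneg (by linarith), norm_sub_rev]
    exact hb x y (by linarith) h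
  · rw [abs_of_nonpos (by linarith), neg_sub]
    exact hb y x (le_of_lt hy) h

end Diagonal

/-! ### The convolution with the semigroup -/

section StochasticConvolution

variable {V : Type*} [NormedAddCommGroup V] [InnerProductSpace ℝ V] {e : HilbertBasis ℕ ℝ V}
  {lam : ℕ → ℝ} {α β β' κ δ P N H a b c : ℝ} {g : ℝ → HSOp e} {ω : ℝ → V} {D : V →L[ℝ] V}

/-- The convolution `∫_a^b S(b - r) g(r) dω(r)`. -/
noncomputable def convInt (e : HilbertBasis ℕ ℝ V) (lam : ℕ → ℝ) (α : ℝ) (g : ℝ → HSOp e)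
    (ω : ℝ → V) (a b : ℝ) : V :=
  fracIntegral (hsApply e) α a b (fun r => hsComp e (semigroup e lam |b - r|) (g r)) ω

/-- The absolute value keeps the time argument positive on both sides of `b`, so the kernel is
continuous off one point, which is enough for measurability. -/
theorem stronglyMeasurable_convKernel (hl : ∀ i, 0 < lam i) (hg : Continuous g) (b : ℝ) :
    StronglyMeasurable fun r => hsComp e (semigroup e lam |b - r|) (g r) := by
  refine ContinuousOn.stronglyMeasurable_of_countable_compl (s := {b}ᶜ) ?_ (by simp)
  refine ContinuousOn.clm_apply ((hsComp e).continuous.comp_continuousOn ?_) hg.continuousOn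
  refine (continuousOn_semigroup hl).comp (by fun_prop) fun r hr => ?_
  exact abs_pos.2 (sub_ne_zero.2 fun h => hr h.symm)

theorem isSingHolder_convKernel (hl : ∀ i, 0 < lam i) (hN : 0 ≤ N)
    (hD : IsMultiplier e lam κ N D) (hκ0 : 0 ≤ κ) (hδ0 : 0 ≤ δ) (hδ1 : δ ≤ 1) (hκ2 : κ + δ ≤ 2)
    (hδβ : δ ≤ β) (hP : ∀ r, a ≤ r → r ≤ b → ‖g r‖ ≤ P) (hg : IsHolderBound β P g a b) :
    IsSingHolder κ (κ + δ) δ (2 * N * P * (1 + (b - a) ^ β))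
      (fun r => hsComp e D (hsComp e (semigroup e lam |b - r|) (g r))) a b where
  norm_le r har hrb := by
    have hx : 0 < b - r := sub_pos.2 hrb
    have hP0 : 0 ≤ P := (norm_nonneg _).trans (hP r har hrb.le)
    have h1 := hD.norm_comp_semigroup_le hl hN hκ0 (by linarith) hx
    have h2 : 0 ≤ (b - a) ^ β := Real.rpow_nonneg (by linarith) _
    rw [hsComp_comp, abs_of_pos hx]
    refine (norm_hsComp_le _ _ _).trans ?_
    calc _ ≤ 2 * N * (b - r) ^ (-κ) * P := by
          have := hP r har hrb.le
          gcongr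
      _ = 2 * N * P * 1 * (b - r) ^ (-κ) := by ring
      _ ≤ _ := by gcongr; linarith
  norm_sub_le q r haq hqr hrb := by
    have hx : 0 < b - r := sub_pos.2 hrb
    have hrq : 0 < r - q := sub_pos.2 hqr
    have hP0 : 0 ≤ P := (norm_nonneg _).trans (hP r (haq.trans hqr.le) hrb.le)
    have h1 := hD.norm_comp_semigroup_le hl hN hκ0 (by linarith) hx
    have h2 := hD.norm_comp_semigroup_sub_le (y := b - q) hl hN hκ0 hδ0 hδ1 hκ2 hx (by linarith)
    rw [show b - q - (b - r) = r - q by ring] at h2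
    have e1 : hsComp e D (hsComp e (semigroup e lam |b - r|) (g r)) -
        hsComp e D (hsComp e (semigroup e lam |b - q|) (g q)) =
        hsComp e (D.comp (semigroup e lam (b - r))) (g r - g q) +
        hsComp e (D.comp (semigroup e lam (b - r)) - D.comp (semigroup e lam (b - q))) (g q) := by
      rw [hsComp_comp, hsComp_comp, abs_of_pos hx, abs_of_pos (by linarith), map_sub, map_sub,
        sub_apply]
      abel
    -- The increment of `g` carries the exponent `β` and the weaker singularity `κ`. It is brought
    -- to the common form with `δ` and `κ + δ` at the price of `(b - a) ^ β`.
    have h3 : (r - q) ^ β * (b - r) ^ (-κ) ≤ (b - a) ^ β * ((b - r) ^ (-(κ + δ)) * (r - q) ^ δ) := by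
      have e2 : (r - q) ^ β = (r - q) ^ (β - δ) * (r - q) ^ δ := by
        rw [← Real.rpow_add hrq]; ring_nf
      have e3 : (b - r) ^ (-κ) = (b - r) ^ δ * (b - r) ^ (-(κ + δ)) := by
        rw [← Real.rpow_add hx]; ring_nf
      have e4 : (b - a) ^ β = (b - a) ^ (β - δ) * (b - a) ^ δ := by
        rw [← Real.rpow_add (by linarith)]; ring_nf
      rw [e2, e3, e4]
      have h5 : (r - q) ^ (β - δ) ≤ (b - a) ^ (β - δ) :=
        Real.rpow_le_rpow hrq.le (by linarith) (by linarith)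
      have h6 : (b - r) ^ δ ≤ (b - a) ^ δ := Real.rpow_le_rpow hx.le (by linarith) hδ0
      have h7 : 0 ≤ b - a := by linarith
      calc _ = (r - q) ^ (β - δ) * (b - r) ^ δ * ((b - r) ^ (-(κ + δ)) * (r - q) ^ δ) := by ring
        _ ≤ _ := by gcongr
    rw [e1]
    refine (norm_add_le _ _).trans ((add_le_add (norm_hsComp_le _ _ _)
      (norm_hsComp_le _ _ _)).trans ?_)
    calc _ ≤ 2 * N * (b - r) ^ (-κ) * (P * (r - q) ^ β) +
          2 * N * (b - r) ^ (-(κ + δ)) * (r - q) ^ δ * P := by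
          have := hP q haq (hqr.le.trans hrb.le)
          have := hg q r haq hqr.le hrb.le
          gcongr
      _ = 2 * N * P * ((r - q) ^ β * (b - r) ^ (-κ) + (b - r) ^ (-(κ + δ)) * (r - q) ^ δ) := by ring
      _ ≤ 2 * N * P * ((b - a) ^ β * ((b - r) ^ (-(κ + δ)) * (r - q) ^ δ) +
          (b - r) ^ (-(κ + δ)) * (r - q) ^ δ) := by gcongr
      _ = _ := by ring

theorem isSingHolder_convKernel_id (hl : ∀ i, 0 < lam i) (hδ0 : 0 ≤ δ) (hδ1 : δ ≤ 1) (hδβ : δ ≤ β)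
    (hP : ∀ r, a ≤ r → r ≤ b → ‖g r‖ ≤ P) (hg : IsHolderBound β P g a b) :
    IsSingHolder 0 δ δ (2 * P * (1 + (b - a) ^ β))
      (fun r => hsComp e (semigroup e lam |b - r|) (g r)) a b := by
  have h := isSingHolder_convKernel hl zero_le_one (isMultiplier_id (e := e) (lam := lam)) le_rfl
    hδ0 hδ1 (by linarith) hδβ hP hg
  rw [zero_add, mul_one] at h
  exact h

theorem map_convInt [CompleteSpace V] (hl : ∀ i, 0 < lam i) (hα : 0 < α) (hαβ : α < β)
    (hββ' : β < β') (hβ' : β' < 1) (hα' : 1 - β' < α) (hP0 : 0 ≤ P)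
    (hP : ∀ r, a ≤ r → r ≤ b → ‖g r‖ ≤ P) (hg : IsHolderBound β P g a b) (hgc : Continuous g)
    (hω : IsHolderBound β' H ω a b) (hωc : Continuous ω) (hab : a ≤ b) (D : V →L[ℝ] V) :
    fracIntegral (hsApply e) α a b
      (fun r => hsComp e D (hsComp e (semigroup e lam |b - r|) (g r))) ω =
      D (convInt e lam α g ω a b) := by
  have h0 : 0 ≤ (b - a) ^ β := Real.rpow_nonneg (by linarith) _
  exact fracIntegral_map (hsApply e) (hsApply e) (hsComp e D) D (fun x y => rfl) hα
    (by linarith) hαβ (by linarith) (R := 2 * P * (1 + (b - a) ^ β)) (by positivity)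
    (by linarith) (by linarith)
    (isSingHolder_convKernel_id hl (by linarith) (by linarith) le_rfl hP hg) hω
    (stronglyMeasurable_convKernel hl hgc b) hωc.stronglyMeasurable hab

/-- `D` is moved inside the integral, where it only worsens the singularity of the kernel by the
order `κ`; the condition `κ + δ < α + β'` keeps this integrable. The factor 4 collects the 2 of the
smoothing estimates and `1 + (b-a) ^ β ≤ 2`. -/
theorem norm_map_convInt_le [CompleteSpace V] (hl : ∀ i, 0 < lam i) (hα : 0 < α) (hαβ : α < β)
    (hββ' : β < β') (hβ' : β' < 1) (hα' : 1 - β' < α) (hN : 0 ≤ N) (hD : IsMultiplier e lam κ N D)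
    (hκ0 : 0 ≤ κ) (hαδ : α < δ) (hδβ : δ ≤ β) (hκδ : κ + δ < α + β') (hP0 : 0 ≤ P)
    (hP : ∀ r, a ≤ r → r ≤ b → ‖g r‖ ≤ P) (hg : IsHolderBound β P g a b) (hgc : Continuous g)
    (hH : 0 ≤ H)
    (hω : IsHolderBound β' H ω a b) (hωc : Continuous ω) (hab : a ≤ b) (hab1 : b - a ≤ 1) :
    ‖D (convInt e lam α g ω a b)‖ ≤ 4 * fracConst α β' κ (κ + δ) δ * ‖hsApply e‖ * N * P * H *
      (b - a) ^ (β' - κ) := by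
  have hc := fracConst_nonneg (κ := κ) (ρ := κ + δ) (δ' := β') hα (by linarith) hαδ (by linarith)
  rcases hab.eq_or_lt with rfl | hlt
  · rw [convInt, fracIntegral_self, map_zero, norm_zero, sub_self]
    positivity
  rw [← map_convInt hl hα hαβ hββ' hβ' hα' hP0 hP hg hgc hω hωc hab D]
  have h0 : 0 ≤ (b - a) ^ β := Real.rpow_nonneg (by linarith) _
  have h1 : (b - a) ^ β ≤ 1 := Real.rpow_le_one (by linarith) hab1 (by linarith)
  have h2 : 0 ≤ (b - a) ^ (β' - κ) := Real.rpow_nonneg (by linarith) _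
  refine (norm_fracIntegral_le (hsApply e) hα (by linarith) hαδ (by linarith)
    (R := 2 * N * P * (1 + (b - a) ^ β)) (by positivity) (by linarith) rfl hκδ
    (isSingHolder_convKernel hl hN hD hκ0 (by linarith) (by linarith) (by linarith) hδβ hP hg) hω
    hlt).trans ?_
  calc _ ≤ fracConst α β' κ (κ + δ) δ * ‖hsApply e‖ * (2 * N * P * (1 + 1)) * H *
      (b - a) ^ (β' - κ) := by gcongr
    _ = _ := by ring

/-- After `S(1)` the semigroup acts at times at least 1, so the kernel is Hölder up to the right
endpoint. -/
theorem isHolderBound_smoothed_convKernel (hl : ∀ i, 0 < lam i) (hβ0 : 0 ≤ β) (hβ1 : β ≤ 1)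
    (hP : ∀ r, a ≤ r → r ≤ b → ‖g r‖ ≤ P) (hg : IsHolderBound β P g a b) :
    IsHolderBound β (4 * P)
      (fun r => hsComp e (semigroup e lam 1) (hsComp e (semigroup e lam |b - r|) (g r))) a b := by
  intro s t hs hst ht
  have hx : 0 < 1 + (b - t) := by linarith
  have hts : 0 ≤ t - s := by linarith
  have hid := isMultiplier_id (e := e) (lam := lam)
  have h1 := hid.norm_comp_semigroup_le hl zero_le_one le_rfl (by norm_num) hx
  have h2 := hid.norm_comp_semigroup_sub_le (y := 1 + (b - s)) hl zero_le_one le_rfl hβ0 hβ1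
    (by linarith) hx (by linarith)
  rw [show 1 + (b - s) - (1 + (b - t)) = t - s by ring, zero_add, mul_one] at h2
  rw [neg_zero, Real.rpow_zero, mul_one, mul_one] at h1
  simp only [ContinuousLinearMap.id_comp] at h1 h2
  have h3 : (1 + (b - t)) ^ (-β) ≤ 1 :=
    Real.rpow_le_one_of_one_le_of_nonpos (by linarith) (by linarith)
  have e1 : ∀ r, r ≤ b → hsComp e (semigroup e lam 1) (hsComp e (semigroup e lam |b - r|) (g r)) =
      hsComp e (semigroup e lam (1 + (b - r))) (g r) := fun r hr => by
    rw [hsComp_comp, abs_of_nonneg (by linarith), semigroup_add hl zero_le_one (by linarith)]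
  have e2 : hsComp e (semigroup e lam (1 + (b - t))) (g t) -
      hsComp e (semigroup e lam (1 + (b - s))) (g s) =
      hsComp e (semigroup e lam (1 + (b - t))) (g t - g s) +
      hsComp e (semigroup e lam (1 + (b - t)) - semigroup e lam (1 + (b - s))) (g s) := by
    rw [map_sub, map_sub, sub_apply]
    abel
  simp only
  rw [e1 t ht, e1 s (hst.trans ht), e2]
  refine (norm_add_le _ _).trans ((add_le_add (norm_hsComp_le _ _ _)
    (norm_hsComp_le _ _ _)).trans ?_)
  have h4 := hg s t hs hst ht
  have h5 := hP s hs (hst.trans ht)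
  have h6 := Real.rpow_nonneg hts β
  calc _ ≤ 2 * (P * (t - s) ^ β) + 2 * 1 * (t - s) ^ β * P := by
        gcongr
        exact h2.trans (by gcongr)
    _ = _ := by ring

/-- Additivity of the integral is available only for integrands that are Hölder on the closed
interval. It is therefore applied to the kernel smoothed by `S(1)`, and injectivity of `S(1)`
removes the smoothing. -/
theorem convInt_add_adjacent [CompleteSpace V] (hl : ∀ i, 0 < lam i) (hα : 0 < α) (hαβ : α < β)
    (hββ' : β < β') (hβ' : β' < 1) (hα' : 1 - β' < α) (hP0 : 0 ≤ P)
    (hP : ∀ r, a ≤ r → r ≤ c → ‖g r‖ ≤ P) (hg : IsHolderBound β P g a c) (hgc : Continuous g)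
    (hH : 0 ≤ H) (hω : IsHolderBound β' H ω a c) (hωc : Continuous ω) (hab : a ≤ b) (hbc : b ≤ c) :
    convInt e lam α g ω a c =
      semigroup e lam (c - b) (convInt e lam α g ω a b) + convInt e lam α g ω b c := by
  refine semigroup_injective (e := e) hl zero_le_one ?_
  have hKm : StronglyMeasurable fun r =>
      hsComp e (semigroup e lam 1) (hsComp e (semigroup e lam |c - r|) (g r)) :=
    (hsComp e (semigroup e lam 1)).continuous.comp_stronglyMeasurable
      (stronglyMeasurable_convKernel hl hgc c)
  have hadd := fracIntegral_add_adjacent (hsApply e) hα (by linarith) hαβ (by linarith)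
    (by linarith) (by positivity) hH
    (isHolderBound_smoothed_convKernel hl (by linarith) (by linarith) hP hg) hω hKm
    hωc.stronglyMeasurable hab hbc
  rw [map_add, ← map_convInt hl hα hαβ hββ' hβ' hα' hP0 hP hg hgc hω hωc (hab.trans hbc),
    ← map_convInt hl hα hαβ hββ' hβ' hα' hP0 (fun r hr => hP r (hab.trans hr))
      (hg.mono hab le_rfl) hgc (hω.mono hab le_rfl) hωc hbc, hadd]
  congr 1
  -- On `[a, b]` the operators `S(1) S(c-b)` go inside the integral, and `S(c-b) S(b-r) = S(c-r)`
  -- matches the kernels.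
  rw [← ContinuousLinearMap.comp_apply, ← map_convInt hl hα hαβ hββ' hβ' hα' hP0
    (fun r hr hrb => hP r hr (hrb.trans hbc))
    (hg.mono le_rfl hbc) hgc (hω.mono le_rfl hbc) hωc hab]
  refine fracIntegral_congr _ hab fun r har hrb => ?_
  rw [← hsComp_comp, hsComp_comp e (semigroup e lam (c - b)), abs_of_nonneg (by linarith),
    abs_of_nonneg (by linarith), ← semigroup_add hl (by linarith) (by linarith),
    sub_add_sub_cancel]

end StochasticConvolution

/-! ### The Hölder norm as a supremum -/

section HolderNorm

variable {E : Type*} [NormedAddCommGroup E] {β a b : ℝ} {f : ℝ → E}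

theorem MemHolder.exists_isHolderBound (hβ : 0 ≤ β) (h : MemHolder β f a b) :
    ∃ H, 0 ≤ H ∧ IsHolderBound β H f a b := by
  obtain ⟨C, hC⟩ := h
  refine ⟨C, C.2, fun s t hs hst ht => ?_⟩
  have := hC.dist_le (show t ∈ Icc a b from ⟨hs.trans hst, ht⟩) (show s ∈ Icc a b from
    ⟨hs, hst.trans ht⟩)
  rwa [dist_eq_norm, Real.dist_eq, abs_of_nonneg (sub_nonneg.2 hst), Real.coe_toNNReal _ hβ] at this

theorem IsHolderBound.weaken {γ H : ℝ} (hγβ : γ < β) (hH : 0 ≤ H) (h : IsHolderBound β H f a b) :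
    IsHolderBound γ (H * (b - a) ^ (β - γ)) f a b := by
  intro s t hs hst ht
  rcases hst.eq_or_lt with rfl | hlt
  · have := Real.rpow_nonneg (sub_self s).ge γ
    have : 0 ≤ b - a := by linarith
    rw [sub_self, norm_zero]
    positivity
  · refine (h s t hs hst ht).trans ?_
    have h0 : 0 < t - s := sub_pos.2 hlt
    have h1 : (t - s) ^ (β - γ) ≤ (b - a) ^ (β - γ) :=
      Real.rpow_le_rpow h0.le (by linarith) (by linarith)
    calc H * (t - s) ^ β = H * (t - s) ^ (β - γ) * (t - s) ^ γ := by
          rw [mul_assoc, ← Real.rpow_add h0, sub_add_cancel]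
      _ ≤ _ := by gcongr

theorem IsHolderBound.bddAbove {H : ℝ} (h : IsHolderBound β H f a b) :
    BddAbove {x | ∃ s t, a ≤ s ∧ s < t ∧ t ≤ b ∧ x = ‖f t - f s‖ / |t - s| ^ β} := by
  refine ⟨H, ?_⟩
  rintro _ ⟨s, t, hs, hst, ht, rfl⟩
  rw [abs_of_pos (sub_pos.2 hst), div_le_iff₀ (Real.rpow_pos_of_pos (sub_pos.2 hst) _)]
  exact h s t hs hst.le ht

theorem IsHolderBound.holderSeminorm_le {H : ℝ} (hH : 0 ≤ H) (h : IsHolderBound β H f a b) :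
    holderSeminorm β f a b ≤ H := by
  refine Real.sSup_le ?_ hH
  rintro _ ⟨s, t, hs, hst, ht, rfl⟩
  rw [abs_of_pos (sub_pos.2 hst), div_le_iff₀ (Real.rpow_pos_of_pos (sub_pos.2 hst) _)]
  exact h s t hs hst.le ht

theorem holderSeminorm_nonneg (β : ℝ) (f : ℝ → E) (a b : ℝ) : 0 ≤ holderSeminorm β f a b := by
  refine Real.sSup_nonneg ?_
  rintro _ ⟨s, t, hs, hst, ht, rfl⟩
  positivity

theorem holderNorm_nonneg (β : ℝ) (f : ℝ → E) (a b : ℝ) : 0 ≤ holderNorm β f a b := by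
  refine add_nonneg (Real.sSup_nonneg ?_) (holderSeminorm_nonneg _ _ _ _)
  rintro _ ⟨s, -, rfl⟩
  exact norm_nonneg _

/-- The given bound serves only to make the supremum finite: the supremum of an unbounded set is 0
by default and would bound nothing. -/
theorem IsHolderBound.isHolderBound_seminorm {H : ℝ} (hβ : 0 < β) (h : IsHolderBound β H f a b) :
    IsHolderBound β (holderSeminorm β f a b) f a b := by
  intro s t hs hst ht
  rcases hst.eq_or_lt with rfl | hlt
  · simp [Real.zero_rpow hβ.ne']
  · have := le_csSup h.bddAbove ⟨s, t, hs, hlt, ht, rfl⟩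
    rw [abs_of_pos (sub_pos.2 hlt), div_le_iff₀ (Real.rpow_pos_of_pos (sub_pos.2 hlt) _)] at this
    exact this

theorem IsHolderBound.norm_le_holderNorm {H r : ℝ} (hβ : 0 < β) (hH : 0 ≤ H)
    (h : IsHolderBound β H f a b) (har : a ≤ r) (hrb : r ≤ b) : ‖f r‖ ≤ holderNorm β f a b := by
  have hbdd : BddAbove ((fun s => ‖f s‖) '' Icc a b) := by
    refine ⟨‖f a‖ + H * (b - a) ^ β, ?_⟩
    rintro _ ⟨s, hs, rfl⟩
    have h1 := h a s le_rfl hs.1 hs.2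
    have h2 : ‖f s‖ ≤ ‖f a‖ + ‖f s - f a‖ := by simpa using norm_add_le (f a) (f s - f a)
    have h3 : (s - a) ^ β ≤ (b - a) ^ β :=
      Real.rpow_le_rpow (by linarith [hs.1]) (by linarith [hs.2]) hβ.le
    have h4 := mul_le_mul_of_nonneg_left h3 hH
    simp only
    linarith
  have h1 : ‖f r‖ ≤ sSup ((fun s => ‖f s‖) '' Icc a b) :=
    le_csSup hbdd ⟨r, ⟨har, hrb⟩, rfl⟩
  have h2 := holderSeminorm_nonneg β f a b
  rw [holderNorm]
  linarith

theorem IsHolderBound.isHolderBound_holderNorm {H : ℝ} (hβ : 0 < β) (h : IsHolderBound β H f a b) :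
    IsHolderBound β (holderNorm β f a b) f a b := by
  intro s t hs hst ht
  refine (h.isHolderBound_seminorm hβ s t hs hst ht).trans ?_
  have := Real.rpow_nonneg (sub_nonneg.2 hst) β
  gcongr
  refine le_add_of_nonneg_left (Real.sSup_nonneg ?_)
  rintro _ ⟨s, -, rfl⟩
  exact norm_nonneg _

theorem holderNorm_le {X Y : ℝ} (hX : 0 ≤ X) (hY : 0 ≤ Y) (h : ∀ r, a ≤ r → r ≤ b → ‖f r‖ ≤ X)
    (h' : IsHolderBound β Y f a b) : holderNorm β f a b ≤ X + Y := by
  refine add_le_add (Real.sSup_le ?_ hX) (h'.holderSeminorm_le hY)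
  rintro _ ⟨s, hs, rfl⟩
  exact h s hs.1 hs.2

end HolderNorm

/-! ### Stopping times -/

section StoppingTimes

variable {V : Type*} [NormedAddCommGroup V] {β' β'' μ : ℝ} {ω : ℝ → V}

theorem continuous_of_mem_pathSpace (hβ'' : 0 < β'') (hω : ω ∈ pathSpace V β'') :
    Continuous ω := by
  refine continuous_iff_continuousAt.2 fun x => ?_
  obtain ⟨C, hC⟩ := hω.2 (x - 1) (x + 1)
  exact (hC.continuousOn (Real.toNNReal_pos.2 hβ'')).continuousAt
    (Icc_mem_nhds (by linarith) (by linarith))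

theorem shift_mem_pathSpace (hω : ω ∈ pathSpace V β'') (t : ℝ) : shift t ω ∈ pathSpace V β'' := by
  refine ⟨by simp [shift], fun a b => ?_⟩
  obtain ⟨C, hC⟩ := hω.2 (t + a) (t + b)
  refine ⟨C, fun x hx y hy => ?_⟩
  have := hC (t + x) ⟨by linarith [hx.1], by linarith [hx.2]⟩ (t + y)
    ⟨by linarith [hy.1], by linarith [hy.2]⟩
  simpa [shift, edist_eq_enorm_sub] using this

theorem exists_isHolderBound_of_mem_pathSpace (hβ' : 0 < β') (hβ : β' < β'')
    (hω : ω ∈ pathSpace V β'') {a b : ℝ} (hab : a ≤ b) :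
    ∃ H, 0 ≤ H ∧ IsHolderBound β' H ω a b := by
  obtain ⟨H, hH, h⟩ := (hω.2 a b).exists_isHolderBound (by linarith)
  have : 0 ≤ b - a := by linarith
  exact ⟨_, by positivity, h.weaken hβ hH⟩

theorem stopFwd_nonneg (μ β' : ℝ) (ω : ℝ → V) : 0 ≤ stopFwd μ β' ω :=
  Real.sInf_nonneg fun _ h => h.1.le

/-- At `τ = 1` the second summand alone equals `μ`. -/
theorem stopFwd_le_one (μ β' : ℝ) (ω : ℝ → V) : stopFwd μ β' ω ≤ 1 := by
  refine csInf_le ⟨0, fun _ h => h.1.le⟩ ⟨one_pos, ?_⟩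
  rw [Real.one_rpow, mul_one]
  exact le_add_of_nonneg_left (holderSeminorm_nonneg _ _ _ _)

/-- Strictly before the stopping time the defining inequality fails, so the seminorm is below `μ`.
The endpoint is reached by continuity of `ω`. A vanishing stopping time does no harm, since only `s
= t` is then left. -/
theorem isHolderBound_stopFwd (hμ : 0 < μ) (hβ' : 0 < β') (hβ : β' < β'')
    (hω : ω ∈ pathSpace V β'') : IsHolderBound β' μ ω 0 (stopFwd μ β' ω) := by
  have hlt : ∀ s t, 0 ≤ s → s < t → t < stopFwd μ β' ω →
      ‖ω t - ω s‖ ≤ μ * (t - s) ^ β' := by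
    intro s t hs hst ht
    have ht0 : 0 < t := hs.trans_lt hst
    have hnot : ¬ (0 < t ∧ μ ≤ holderSeminorm β' ω 0 t + μ * t ^ (1 - β')) := fun h =>
      notMem_of_lt_csInf ht ⟨0, fun _ h => h.1.le⟩ h
    have h1 : holderSeminorm β' ω 0 t + μ * t ^ (1 - β') < μ := by
      by_contra h
      exact hnot ⟨ht0, not_lt.1 h⟩
    have h2 : 0 ≤ μ * t ^ (1 - β') := by positivity
    obtain ⟨H, hH, hb⟩ := exists_isHolderBound_of_mem_pathSpace hβ' hβ hω ht0.le
    refine (hb.isHolderBound_seminorm hβ' s t hs hst.le le_rfl).trans ?_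
    have : 0 ≤ t - s := by linarith
    gcongr
    linarith
  intro s t hs hst ht
  rcases hst.eq_or_lt with rfl | hst
  · simp [Real.zero_rpow hβ'.ne']
  rcases ht.lt_or_eq with ht | rfl
  · exact hlt s t hs hst ht
  have hc := continuous_of_mem_pathSpace (hβ'.trans hβ) hω
  have hc1 : Continuous fun t => ‖ω t - ω s‖ := by fun_prop
  have hc2 : Continuous fun t => μ * (t - s) ^ β' :=
    continuous_const.mul (Continuous.rpow_const (by fun_prop) fun _ => Or.inr hβ'.le)
  refine le_of_tendsto_of_tendsto (b := nhdsWithin (stopFwd μ β' ω) (Iio (stopFwd μ β' ω)))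
    ((hc1.tendsto _).mono_left nhdsWithin_le_nhds) ((hc2.tendsto _).mono_left nhdsWithin_le_nhds) ?_
  filter_upwards [Ioo_mem_nhdsLT hst] with r hr
  exact hlt s r hs hr.1 hr.2

theorem stopPos_le_succ (μ β' : ℝ) (ω : ℝ → V) (n : ℕ) :
    stopPos μ β' ω n ≤ stopPos μ β' ω (n + 1) :=
  le_add_of_nonneg_right (stopFwd_nonneg _ _ _)

theorem stopPos_succ_sub_le_one (μ β' : ℝ) (ω : ℝ → V) (n : ℕ) :
    stopPos μ β' ω (n + 1) - stopPos μ β' ω n ≤ 1 := by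
  have := stopFwd_le_one μ β' (shift (stopPos μ β' ω n) ω)
  rw [stopPos]
  linarith

theorem isHolderBound_stopPos (hμ : 0 < μ) (hβ' : 0 < β') (hβ : β' < β'')
    (hω : ω ∈ pathSpace V β'') (n : ℕ) :
    IsHolderBound β' μ ω (stopPos μ β' ω n) (stopPos μ β' ω (n + 1)) := by
  intro s t hs hst ht
  rw [stopPos] at ht
  set τ := stopPos μ β' ω n
  have h := isHolderBound_stopFwd hμ hβ' hβ (shift_mem_pathSpace hω τ) (s - τ) (t - τ)
    (by linarith) (by linarith) (by linarith)
  simpa [shift] using h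

end StoppingTimes

/-! ### A discrete Gronwall inequality -/

section Gronwall

/-- Let `S_n` and `T_n` be the right-hand sides of the hypothesis and of the conclusion. With `y =
exp(-(l/2) (τ (n+1) - τ n))` they satisfy `S_{n+1} ≤ (y² + k₁) S_n + 2 k₁` and `T_{n+1} = (1 + k₁) y
T_n + 2 k₁`, so the comparison is `y² + k₁ ≤ (1 + k₁) y`, which is `(1 - y)(y - k₁) ≥ 0`. -/
theorem discrete_gronwall {l k₀ k₁ U : ℝ} {τ X : ℕ → ℝ} (hl : 0 < l) (hk₁ : 0 < k₁)
    (hlog : 1 < -(2 / l) * Real.log k₁) (hτ0 : τ 0 = 0) (hτ : ∀ n, τ n ≤ τ (n + 1))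
    (hτ1 : ∀ n, τ (n + 1) - τ n ≤ 1) (hX0 : ∀ n, 0 ≤ X n)
    (hX : ∀ n, X n ≤ k₀ * Real.exp (-l * τ n) * U
      + k₁ * ∑ m ∈ Finset.range n, Real.exp (-l * (τ n - τ (m + 1))) * (X m + 1) + k₁) (n : ℕ) :
    X n ≤ (1 + k₁) ^ n * Real.exp (-(l / 2) * τ n) * (k₀ * U + k₁) +
      ∑ m ∈ Finset.range n, 2 * k₁ * (1 + k₁) ^ (n - (m + 1)) *
        Real.exp (-(l / 2) * (τ n - τ (m + 1))) := by
  -- The induction runs on the right-hand side, which, unlike `X n`, obeys an exact recursion.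
  refine (hX n).trans ?_
  -- This is the content of the logarithmic condition; with steps of length at most 1 it gives `k₁ ≤
  -- y` below.
  have hk : k₁ ≤ Real.exp (-(l / 2)) := by
    rw [← Real.log_le_iff_le_exp hk₁]
    have : -(2 / l) * Real.log k₁ = -Real.log k₁ / (l / 2) := by field_simp
    rw [this, lt_div_iff₀ (by positivity)] at hlog
    linarith
  induction n with
  | zero => simp [hτ0]
  | succ n ih =>
    set S := k₀ * Real.exp (-l * τ n) * U + k₁ * ∑ m ∈ Finset.range n,
      Real.exp (-l * (τ n - τ (m + 1))) * (X m + 1) + k₁ with hS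
    set T := (1 + k₁) ^ n * Real.exp (-(l / 2) * τ n) * (k₀ * U + k₁) + ∑ m ∈ Finset.range n,
      2 * k₁ * (1 + k₁) ^ (n - (m + 1)) * Real.exp (-(l / 2) * (τ n - τ (m + 1))) with hT
    set y := Real.exp (-(l / 2) * (τ (n + 1) - τ n)) with hy
    have hy1 : y ≤ 1 := Real.exp_le_one_iff.2 (by nlinarith [hτ n])
    have hky : k₁ ≤ y := hk.trans (Real.exp_le_exp.2 (by nlinarith [hτ1 n]))
    have hy0 : 0 < y := Real.exp_pos _
    have hyy : y * y = Real.exp (-l * (τ (n + 1) - τ n)) := by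
      rw [hy, ← Real.exp_add]; ring_nf
    have e1 : k₀ * Real.exp (-l * τ (n + 1)) * U + k₁ * ∑ m ∈ Finset.range (n + 1),
        Real.exp (-l * (τ (n + 1) - τ (m + 1))) * (X m + 1) + k₁ =
        y * y * (S - k₁) + k₁ * (X n + 1) + k₁ := by
      have e : ∀ x, Real.exp (-l * (τ (n + 1) - x)) = y * y * Real.exp (-l * (τ n - x)) := by
        intro x
        rw [hyy, ← Real.exp_add]; ring_nf
      have e0 := e 0
      rw [sub_zero, sub_zero] at e0
      rw [Finset.sum_range_succ, sub_self, mul_zero, Real.exp_zero, hS, e0]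
      simp only [e, mul_assoc, ← Finset.mul_sum]
      ring
    have e2 : (1 + k₁) ^ (n + 1) * Real.exp (-(l / 2) * τ (n + 1)) * (k₀ * U + k₁) +
        ∑ m ∈ Finset.range (n + 1), 2 * k₁ * (1 + k₁) ^ (n + 1 - (m + 1)) *
          Real.exp (-(l / 2) * (τ (n + 1) - τ (m + 1))) = (1 + k₁) * y * T + 2 * k₁ := by
      have e : ∀ x, Real.exp (-(l / 2) * (τ (n + 1) - x)) =
          y * Real.exp (-(l / 2) * (τ n - x)) := by
        intro x
        rw [hy, ← Real.exp_add]; ring_nf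
      have e0 := e 0
      rw [sub_zero, sub_zero] at e0
      have e3 : ∑ m ∈ Finset.range n, 2 * k₁ * (1 + k₁) ^ (n + 1 - (m + 1)) *
          Real.exp (-(l / 2) * (τ (n + 1) - τ (m + 1))) = (1 + k₁) * y * ∑ m ∈ Finset.range n,
          2 * k₁ * (1 + k₁) ^ (n - (m + 1)) * Real.exp (-(l / 2) * (τ n - τ (m + 1))) := by
        rw [Finset.mul_sum]
        refine Finset.sum_congr rfl fun m hm => ?_
        have hmn : n + 1 - (m + 1) = n - (m + 1) + 1 := by
          have := Finset.mem_range.1 hm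
          omega
        rw [e, hmn, pow_succ]
        ring
      rw [Finset.sum_range_succ, e3, sub_self, mul_zero, Real.exp_zero, Nat.sub_self, pow_zero, e0,
        hT, pow_succ]
      ring
    rw [e1, e2]
    have hXS : X n ≤ S := hX n
    have hS0 : 0 ≤ S := (hX0 n).trans hXS
    have h1 : y * y + k₁ ≤ (1 + k₁) * y := by nlinarith
    have h2 : k₁ * X n ≤ k₁ * S := by gcongr
    have h3 : (y * y + k₁) * S ≤ (1 + k₁) * y * S := by gcongr
    have h4 : (1 + k₁) * y * S ≤ (1 + k₁) * y * T := by gcongr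
    nlinarith [mul_pos (mul_pos hy0 hy0) hk₁]

end Gronwall

/-! ### The mild solution on one interval -/

section MildSolution

variable {V : Type*} [NormedAddCommGroup V] [InnerProductSpace ℝ V] {e : HilbertBasis ℕ ℝ V}
  {lam : ℕ → ℝ} {α β β' β'' κ δ P N H a b c : ℝ} {g : ℝ → HSOp e} {ω : ℝ → V}

theorem norm_semigroup_apply_le_fracNorm (hl : ∀ i, 0 < lam i) (hm : Monotone lam) (hβ : 0 ≤ β)
    {v : V} (hv : MemFrac e lam β v) {t s : ℝ} (hs : 0 ≤ s) (hst : s ≤ t) :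
    ‖semigroup e lam t v‖ ≤ lam 0 ^ (-β) * Real.exp (-lam 0 * s) * fracNorm e lam β v := by
  have h0 := hl 0
  refine norm_le_fracNorm (by positivity) hv fun i => ?_
  have hi := hm (Nat.zero_le i)
  have h1 : lam 0 ^ β ≤ lam i ^ β := by gcongr
  have h2 : 0 < lam 0 ^ β := by positivity
  rw [repr_semigroup hl (hs.trans hst), abs_mul, abs_mul, abs_of_pos (Real.exp_pos _),
    abs_of_pos (Real.rpow_pos_of_pos (hl i) _), Real.rpow_neg h0.le]
  have h3 : Real.exp (-lam i * t) ≤ Real.exp (-lam 0 * s) := by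
    refine Real.exp_le_exp.2 ?_
    nlinarith
  calc Real.exp (-lam i * t) * |e.repr v i| ≤ Real.exp (-lam 0 * s) * |e.repr v i| := by gcongr
    _ = (lam 0 ^ β)⁻¹ * Real.exp (-lam 0 * s) * (lam 0 ^ β * |e.repr v i|) := by field_simp
    _ ≤ _ := by gcongr

/-- The factor `lam i ^ β` produced by `S(h) - 1` is paid for by the `V_β` norm of the initial
value, so no singularity at time 0 arises. -/
theorem norm_semigroup_sub_apply_le_fracNorm (hl : ∀ i, 0 < lam i) (hm : Monotone lam)
    (hβ0 : 0 ≤ β) (hβ1 : β ≤ 1)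
    {v : V} (hv : MemFrac e lam β v) {h s : ℝ} (hs : 0 ≤ s) (hh : 0 ≤ h) :
    ‖semigroup e lam h (semigroup e lam s v) - semigroup e lam s v‖ ≤
      h ^ β * Real.exp (-lam 0 * s) * fracNorm e lam β v := by
  obtain ⟨m, hm', hD⟩ := isMultiplier_semigroup_sub_id (e := e) hl hh hβ0 hβ1
  refine norm_le_fracNorm (by positivity) hv fun i => ?_
  have hi := hm (Nat.zero_le i)
  have e1 : semigroup e lam h (semigroup e lam s v) - semigroup e lam s v =
    (semigroup e lam h - ContinuousLinearMap.id ℝ V) (semigroup e lam s v) := rfl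
  rw [e1, hD, repr_semigroup hl hs, abs_mul, abs_mul, abs_mul, abs_of_pos (Real.exp_pos _),
    abs_of_pos (Real.rpow_pos_of_pos (hl i) _)]
  have h3 : Real.exp (-lam i * s) ≤ Real.exp (-lam 0 * s) := by
    refine Real.exp_le_exp.2 ?_
    nlinarith
  have h4 := hm' i
  have h5 := Real.rpow_nonneg (hl i).le β
  calc _ ≤ (h ^ β * lam i ^ β) * (Real.exp (-lam 0 * s) * |e.repr v i|) := by gcongr
    _ = _ := by ring

theorem convInt_eq_sum {J : ℝ → ℝ → V} {τ : ℕ → ℝ} (hl : ∀ i, 0 < lam i) (hτ0 : τ 0 = 0)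
    (hτ : ∀ n, τ n ≤ τ (n + 1)) (hJ0 : J 0 0 = 0)
    (hJ : ∀ b c, 0 ≤ b → b ≤ c → J 0 c = semigroup e lam (c - b) (J 0 b) + J b c) (n : ℕ) :
    J 0 (τ n) = ∑ m ∈ Finset.range n, semigroup e lam (τ n - τ (m + 1)) (J (τ m) (τ (m + 1))) := by
  have hmono : Monotone τ := monotone_nat_of_le_succ hτ
  have hτn : ∀ n, 0 ≤ τ n := fun n => hτ0 ▸ hmono (Nat.zero_le n)
  induction n with
  | zero => simp [hτ0, hJ0]
  | succ n ih =>
    rw [hJ (τ n) (τ (n + 1)) (hτn n) (hτ n), ih, Finset.sum_range_succ, sub_self,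
      semigroup_zero hl, map_sum]
    congr 1
    refine Finset.sum_congr rfl fun m hm => ?_
    have hmn : τ (m + 1) ≤ τ n := hmono (Finset.mem_range.1 hm)
    rw [← ContinuousLinearMap.comp_apply, ← semigroup_add hl (sub_nonneg.2 (hτ n))
      (sub_nonneg.2 hmn), sub_add_sub_cancel]

theorem semigroup_comm (hl : ∀ i, 0 < lam i) {s t : ℝ} (hs : 0 ≤ s) (ht : 0 ≤ t) (v : V) :
    semigroup e lam s (semigroup e lam t v) = semigroup e lam t (semigroup e lam s v) := by
  rw [← ContinuousLinearMap.comp_apply, ← ContinuousLinearMap.comp_apply, ← semigroup_add hl hs ht,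
    ← semigroup_add hl ht hs, add_comm]

/-- The Hölder norm on `[τ n, τ (n + 1)]` of `u(t) = S(t) u₀ + J(0, t)`, in terms of bounds on the
contributions `J` of the single intervals. -/
theorem holderNorm_mild_le {J : ℝ → ℝ → V} {τ : ℕ → ℝ} {u : ℝ → V} {u₀ : V} {Q₁ Q₂ : ℕ → ℝ}
    (hl : ∀ i, 0 < lam i) (hm : Monotone lam)
    (hβ0 : 0 < β) (hβ1 : β ≤ 1) (hββ' : β ≤ β') (hu₀ : MemFrac e lam β u₀) (hτ0 : τ 0 = 0)
    (hτ : ∀ n, τ n ≤ τ (n + 1)) (hτ1 : ∀ n, τ (n + 1) - τ n ≤ 1) (hJ0 : J 0 0 = 0)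
    (hJ : ∀ b c, 0 ≤ b → b ≤ c → J 0 c = semigroup e lam (c - b) (J 0 b) + J b c)
    (hQ₁0 : ∀ n, 0 ≤ Q₁ n) (hQ₂0 : ∀ n, 0 ≤ Q₂ n)
    (hQ₁ : ∀ n a b, τ n ≤ a → a ≤ b → b ≤ τ (n + 1) → ‖J a b‖ ≤ Q₁ n * (b - a) ^ β')
    (hQ₂ : ∀ n a b h, τ n ≤ a → a ≤ b → b ≤ τ (n + 1) → 0 ≤ h →
      ‖semigroup e lam h (J a b) - J a b‖ ≤ Q₂ n * h ^ β)
    (hu : ∀ t, 0 ≤ t → u t = semigroup e lam t u₀ + J 0 t) (n : ℕ) :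
    holderNorm β u (τ n) (τ (n + 1)) ≤
      (lam 0 ^ (-β) + 1) * Real.exp (-lam 0 * τ n) * fracNorm e lam β u₀ +
      ∑ m ∈ Finset.range n, Real.exp (-lam 0 * (τ n - τ (m + 1))) * (Q₁ m + Q₂ m) +
      (2 * Q₁ n + Q₂ n) := by
  have hmono : Monotone τ := monotone_nat_of_le_succ hτ
  have hτn : ∀ n, 0 ≤ τ n := fun n => hτ0 ▸ hmono (Nat.zero_le n)
  have hl0 := hl 0
  have hU : 0 ≤ fracNorm e lam β u₀ := Real.sqrt_nonneg _
  have hus : ∀ s, τ n ≤ s → s ≤ τ (n + 1) → u s = semigroup e lam s u₀ +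
      (∑ m ∈ Finset.range n, semigroup e lam (s - τ (m + 1)) (J (τ m) (τ (m + 1)))) +
      J (τ n) s := by
    intro s hs _
    rw [hu s ((hτn n).trans hs), hJ (τ n) s (hτn n) hs, convInt_eq_sum hl hτ0 hτ hJ0 hJ, map_sum,
      ← add_assoc]
    congr 2
    refine Finset.sum_congr rfl fun m hm => ?_
    have hmn : τ (m + 1) ≤ τ n := hmono (Finset.mem_range.1 hm)
    rw [← ContinuousLinearMap.comp_apply, ← semigroup_add hl (sub_nonneg.2 hs)
      (sub_nonneg.2 hmn), sub_add_sub_cancel]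
  have hdecay : ∀ s, τ n ≤ s → ∀ m ∈ Finset.range n, ∀ v : V,
      ‖semigroup e lam (s - τ (m + 1)) v‖ ≤ Real.exp (-lam 0 * (τ n - τ (m + 1))) * ‖v‖ := by
    intro s hs m hm' v
    have hmn : τ (m + 1) ≤ τ n := hmono (Finset.mem_range.1 hm')
    refine (norm_semigroup_apply_le hl hm (by linarith) v).trans ?_
    have : Real.exp (-lam 0 * (s - τ (m + 1))) ≤ Real.exp (-lam 0 * (τ n - τ (m + 1))) :=
      Real.exp_le_exp.2 (by nlinarith)
    gcongr
  have hpow1 : ∀ x p : ℝ, 0 ≤ x → x ≤ 1 → 0 ≤ p → x ^ p ≤ 1 := fun x p hx hx1 hp =>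
    Real.rpow_le_one hx hx1 hp
  have hsup : ∀ s, τ n ≤ s → s ≤ τ (n + 1) → ‖u s‖ ≤
      lam 0 ^ (-β) * Real.exp (-lam 0 * τ n) * fracNorm e lam β u₀ +
      ∑ m ∈ Finset.range n, Real.exp (-lam 0 * (τ n - τ (m + 1))) * Q₁ m + Q₁ n := by
    intro s hs hs'
    rw [hus s hs hs']
    refine (norm_add_le _ _).trans (add_le_add ((norm_add_le _ _).trans (add_le_add
      (norm_semigroup_apply_le_fracNorm hl hm hβ0.le hu₀ (hτn n) hs)
      ((norm_sum_le _ _).trans (Finset.sum_le_sum fun m hm' => ?_)))) ?_)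
    · refine (hdecay s hs m hm' _).trans ?_
      have h1 := hQ₁ m (τ m) (τ (m + 1)) le_rfl (hτ m) le_rfl
      have h2 := hpow1 (τ (m + 1) - τ m) β' (sub_nonneg.2 (hτ m)) (hτ1 m) (by linarith)
      have h3 := hQ₁0 m
      gcongr
      exact h1.trans (mul_le_of_le_one_right h3 h2)
    · exact (hQ₁ n (τ n) s le_rfl hs hs').trans (mul_le_of_le_one_right (hQ₁0 n)
        (hpow1 _ _ (by linarith) (by linarith [hτ1 n]) (by linarith)))
  have hsemi : IsHolderBound β (Real.exp (-lam 0 * τ n) * fracNorm e lam β u₀ +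
      ∑ m ∈ Finset.range n, Real.exp (-lam 0 * (τ n - τ (m + 1))) * Q₂ m + (Q₁ n + Q₂ n))
      u (τ n) (τ (n + 1)) := by
    intro s t hs hst ht
    have hs0 : 0 ≤ s := (hτn n).trans hs
    have hh : 0 ≤ t - s := sub_nonneg.2 hst
    have hut : u t = semigroup e lam (t - s) (u s) + J s t := by
      rw [hu t (hs0.trans hst), hu s hs0, hJ s t hs0 hst, map_add, ← ContinuousLinearMap.comp_apply,
        ← semigroup_add hl hh hs0, sub_add_cancel, add_assoc]
    -- `S(t-s) - 1` falls on the blocks `J` themselves, while `S(s - τ (m+1))` contributes only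
    -- decay. Letting the latter smooth instead would produce a singularity as `s` approaches `τ
    -- (m+1)`.
    have hsplit : u t - u s = (semigroup e lam (t - s) (semigroup e lam s u₀) -
        semigroup e lam s u₀) + (∑ m ∈ Finset.range n, semigroup e lam (s - τ (m + 1))
          (semigroup e lam (t - s) (J (τ m) (τ (m + 1))) - J (τ m) (τ (m + 1)))) +
        (J s t + (semigroup e lam (t - s) (J (τ n) s) - J (τ n) s)) := by
      have hsum : ∑ m ∈ Finset.range n, semigroup e lam (s - τ (m + 1))
          (semigroup e lam (t - s) (J (τ m) (τ (m + 1))) - J (τ m) (τ (m + 1))) =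
          (∑ m ∈ Finset.range n, semigroup e lam (t - s) (semigroup e lam (s - τ (m + 1))
            (J (τ m) (τ (m + 1))))) -
          ∑ m ∈ Finset.range n, semigroup e lam (s - τ (m + 1)) (J (τ m) (τ (m + 1))) := by
        rw [← Finset.sum_sub_distrib]
        refine Finset.sum_congr rfl fun m hm' => ?_
        have hmn : τ (m + 1) ≤ τ n := hmono (Finset.mem_range.1 hm')
        rw [map_sub, semigroup_comm hl (by linarith) hh]
      rw [hut, hus s hs (hst.trans ht), map_add, map_add, map_sum, hsum]
      abel
    -- The interval has length at most 1, so the higher exponent gives the smaller power.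
    have hx : (t - s) ^ β' ≤ (t - s) ^ β := by
      rcases hh.eq_or_lt with h0 | h0
      · rw [← h0, Real.zero_rpow hβ0.ne', Real.zero_rpow (by linarith)]
      · exact Real.rpow_le_rpow_of_exponent_ge h0 (by linarith [hτ1 n]) hββ'
    have hy : 0 ≤ (t - s) ^ β := Real.rpow_nonneg hh _
    rw [hsplit, add_mul, add_mul, add_mul, Finset.sum_mul]
    refine (norm_add_le _ _).trans (add_le_add ((norm_add_le _ _).trans (add_le_add ?_
      ((norm_sum_le _ _).trans (Finset.sum_le_sum fun m hm' => ?_))))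
      ((norm_add_le _ _).trans (add_le_add ?_ ?_)))
    · refine (norm_semigroup_sub_apply_le_fracNorm hl hm hβ0.le hβ1 hu₀ hs0 hh).trans ?_
      have : Real.exp (-lam 0 * s) ≤ Real.exp (-lam 0 * τ n) :=
        Real.exp_le_exp.2 (by nlinarith)
      calc _ ≤ (t - s) ^ β * Real.exp (-lam 0 * τ n) * fracNorm e lam β u₀ := by gcongr
        _ = _ := by ring
    · refine (hdecay s hs m hm' _).trans ?_
      rw [mul_assoc]
      have h1 := hQ₂ m (τ m) (τ (m + 1)) (t - s) le_rfl (hτ m) le_rfl hh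
      gcongr
    · refine (hQ₁ n s t hs hst ht).trans ?_
      have h3 := hQ₁0 n
      gcongr
    · exact hQ₂ n (τ n) s (t - s) le_rfl hs (hst.trans ht) hh
  have hS1 : 0 ≤ ∑ m ∈ Finset.range n, Real.exp (-lam 0 * (τ n - τ (m + 1))) * Q₁ m :=
    Finset.sum_nonneg fun m _ => mul_nonneg (Real.exp_pos _).le (hQ₁0 m)
  have hS2 : 0 ≤ ∑ m ∈ Finset.range n, Real.exp (-lam 0 * (τ n - τ (m + 1))) * Q₂ m :=
    Finset.sum_nonneg fun m _ => mul_nonneg (Real.exp_pos _).le (hQ₂0 m)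
  have h1 := hQ₁0 n
  have h2 := hQ₂0 n
  refine (holderNorm_le (by positivity) (by positivity) hsup hsemi).trans (le_of_eq ?_)
  simp only [mul_add, Finset.sum_add_distrib]
  ring

end MildSolution

/-! ### The recursive bound -/

section Recursion

variable {V : Type*} [NormedAddCommGroup V] [InnerProductSpace ℝ V] {e : HilbertBasis ℕ ℝ V}
  {lam : ℕ → ℝ} {α β β' β'' : ℝ} {G : V → HSOp e}

theorem exists_lipschitz_of_fderiv_bound (hG : ContDiff ℝ 2 G)
    (hDG : ∃ C : ℝ, ∀ v, ‖fderiv ℝ G v‖ ≤ C) :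
    ∃ L, 0 ≤ L ∧ (∀ v, ‖G v‖ ≤ L * (1 + ‖v‖)) ∧ ∀ v w, ‖G v - G w‖ ≤ L * ‖v - w‖ := by
  obtain ⟨C, hC⟩ := hDG
  have hC0 : 0 ≤ C := (norm_nonneg _).trans (hC 0)
  have hlip : ∀ v w, ‖G v - G w‖ ≤ C * ‖v - w‖ := fun v w =>
    convex_univ.norm_image_sub_le_of_norm_fderiv_le
      (fun x _ => (hG.differentiable (by norm_num)).differentiableAt)
      (fun x _ => hC x) (mem_univ w) (mem_univ v)
  -- One constant serves both the linear growth and the Lipschitz bound.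
  refine ⟨C + ‖G 0‖, by positivity, fun v => ?_, fun v w => (hlip v w).trans ?_⟩
  · have h1 := hlip v 0
    rw [sub_zero] at h1
    have h2 : ‖G v‖ ≤ ‖G 0‖ + ‖G v - G 0‖ := by simpa using norm_add_le (G 0) (G v - G 0)
    nlinarith [norm_nonneg (G 0), norm_nonneg v, mul_nonneg (norm_nonneg (G 0)) (norm_nonneg v)]
  · gcongr
    exact le_add_of_nonneg_right (norm_nonneg _)

theorem IsMildSolution.exists_isHolderBound {u : ℝ → V} {u₀ : V} {ω : ℝ → V} (hβ : 0 ≤ β)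
    (hu : IsMildSolution e lam G α β ω u₀ u) (hu₀ : MemFrac e lam β u₀) {a b : ℝ} (ha : 0 ≤ a) :
    ∃ H, 0 ≤ H ∧ IsHolderBound β H u a b := by
  obtain ⟨H, hH, h⟩ := (hu.mem_holder hu₀ (max b 1) (by positivity)).exists_isHolderBound hβ
  exact ⟨H, hH, h.mono ha (le_max_left _ _)⟩

/-- A mild solution is unconstrained at negative times. Freezing it there gives a globally
continuous integrand and leaves the integrals over `[0, t]` unchanged. -/
theorem IsMildSolution.continuous_extend {u : ℝ → V} {u₀ : V} {ω : ℝ → V}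
    (hu : IsMildSolution e lam G α β ω u₀ u) : Continuous fun r => u (max r 0) := by
  have hc : ContinuousOn u (Ici 0) := by
    intro x hx
    have hx0 : 0 ≤ x := hx
    have := (hu.mem_tilde (x + 1) (by linarith)).1 x ⟨hx, by linarith⟩
    refine this.mono_of_mem_nhdsWithin ?_
    rw [mem_nhdsWithin]
    exact ⟨Iio (x + 1), isOpen_Iio, by simp, fun y hy => ⟨hy.2, le_of_lt hy.1⟩⟩
  exact hc.comp_continuous (by fun_prop) fun r => le_max_right r 0

theorem IsMildSolution.eq_convInt {u : ℝ → V} {u₀ : V} {ω : ℝ → V}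
    (hu : IsMildSolution e lam G α β ω u₀ u) {t : ℝ} (ht : 0 ≤ t) :
    u t = semigroup e lam t u₀ + convInt e lam α (fun r => G (u (max r 0))) ω 0 t := by
  rw [hu.eq t ht, pathIntegral_eq_fracIntegral, convInt]
  congr 1
  refine fracIntegral_congr _ ht fun r hr hrt => ?_
  rw [abs_of_pos (sub_pos.2 hrt), max_eq_left hr]
  rfl

/-- Assertion (1) for a path in the path space, with `n = i - 1` and the summation index lowered by
one. The estimates of single intervals enter `holderNorm_mild_le` with `P = L (1 + ‖u‖)`, where the
norm is taken on that interval. -/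
theorem exists_recursive_bound [CompleteSpace V] (hl : ∀ i, 0 < lam i) (hm : Monotone lam)
    (hG : ContDiff ℝ 2 G) (hDG : ∃ C : ℝ, ∀ v, ‖fderiv ℝ G v‖ ≤ C)
    (hββ' : β < β') (hβ'β'' : β' < β'') (hβ'' : β'' < 1)
    (hα : 1 - β' < α) (hαβ : α < β) :
    ∃ c : ℝ, 0 < c ∧ ∀ μ > 0, ∀ ω ∈ pathSpace V β'', ∀ u₀ : V, MemFrac e lam β u₀ →
      ∀ u : ℝ → V, IsMildSolution e lam G α β ω u₀ u →
      ∀ τ : ℕ → ℝ, τ = stopPos μ β' ω → ∀ n : ℕ,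
        holderNorm β u (τ n) (τ (n + 1)) ≤ c * Real.exp (-lam 0 * τ n) * fracNorm e lam β u₀
          + c * μ * holderNorm β u (τ n) (τ (n + 1))
          + ∑ m ∈ Finset.range n,
              c * μ * Real.exp (-lam 0 * (τ n - τ (m + 1))) * holderNorm β u (τ m) (τ (m + 1))
          + ∑ m ∈ Finset.range n, Real.exp (-lam 0 * (τ n - τ (m + 1))) * (c * μ)
          + c * μ := by
  obtain ⟨L, hL0, hGn, hGl⟩ := exists_lipschitz_of_fderiv_bound hG hDG
  have hα0 : 0 < α := by linarith
  have hβ0 : 0 < β := by linarith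
  have hl0 := hl 0
  -- The auxiliary Hölder exponent of the kernel: above `α` so that the left derivative exists, at
  -- most `β` as for `g`, and small enough for the singularity `β + δ` caused by `S(h) - 1`. The gap
  -- is positive because `α < β < β'`.
  obtain ⟨δ, hαδ, hδβ, hδ⟩ : ∃ δ, α < δ ∧ δ ≤ β ∧ β + δ < α + β' := by
    refine ⟨α + min (β - α) (β' - β) / 2, ?_, ?_, ?_⟩
    · have : 0 < min (β - α) (β' - β) := lt_min (by linarith) (by linarith)
      linarith
    · have := min_le_left (β - α) (β' - β)
      linarith
    · have := min_le_right (β - α) (β' - β)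
      linarith
  -- `C₁` is the estimate with `D` the identity (`κ = 0`), and `C₂` the one with `D = S(h) - 1` (`κ
  -- = β`).
  set C₁ := 4 * fracConst α β' 0 (0 + δ) δ * ‖hsApply e‖ with hC₁
  set C₂ := 4 * fracConst α β' β (β + δ) δ * ‖hsApply e‖ with hC₂
  have hC₁0 : 0 ≤ C₁ := by
    have := fracConst_nonneg (κ := 0) (ρ := 0 + δ) (δ' := β') hα0 (by linarith) hαδ (by linarith)
    positivity
  have hC₂0 : 0 ≤ C₂ := by
    have := fracConst_nonneg (κ := β) (ρ := β + δ) (δ' := β') hα0 (by linarith) hαδ (by linarith)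
    positivity
  -- The first summand serves the initial value, sup norm plus seminorm. The second serves the
  -- current interval, where `C₁` counts twice, and so dominates the past ones.
  set c := (lam 0 ^ (-β) + 1) + (2 * C₁ + C₂) * L with hc
  have hc1 : lam 0 ^ (-β) + 1 ≤ c := le_add_of_nonneg_right (by positivity)
  have hc2 : (2 * C₁ + C₂) * L ≤ c := le_add_of_nonneg_left (by positivity)
  have hc0 : 0 < c := by positivity
  refine ⟨c, hc0, fun μ hμ ω hω u₀ hu₀ u hu τ hτdef n => ?_⟩
  have hτ0 : τ 0 = 0 := by rw [hτdef]; rfl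
  have hτ : ∀ n, τ n ≤ τ (n + 1) := fun n => by rw [hτdef]; exact stopPos_le_succ _ _ _ _
  have hτ1 : ∀ n, τ (n + 1) - τ n ≤ 1 := fun n => by
    rw [hτdef]; exact stopPos_succ_sub_le_one _ _ _ _
  have hωτ : ∀ n, IsHolderBound β' μ ω (τ n) (τ (n + 1)) := fun n => by
    rw [hτdef]; exact isHolderBound_stopPos hμ (by linarith) hβ'β'' hω n
  have hmono : Monotone τ := monotone_nat_of_le_succ hτ
  have hτn : ∀ n, 0 ≤ τ n := fun n => hτ0 ▸ hmono (Nat.zero_le n)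
  have hωc : Continuous ω := continuous_of_mem_pathSpace (by linarith) hω
  set g : ℝ → HSOp e := fun r => G (u (max r 0)) with hg
  have hgc : Continuous g := hG.continuous.comp hu.continuous_extend
  have hgP : ∀ a b, 0 ≤ a → (∀ r, a ≤ r → r ≤ b → ‖g r‖ ≤ L * (1 + holderNorm β u a b)) ∧
      IsHolderBound β (L * (1 + holderNorm β u a b)) g a b := by
    intro a b ha
    obtain ⟨H, hH, hb⟩ := hu.exists_isHolderBound hβ0.le hu₀ ha (b := b)
    refine ⟨fun r har hrb => ?_, fun s t hs hst ht => ?_⟩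
    · have h1 := hb.norm_le_holderNorm hβ0 hH har hrb
      simp only [hg, max_eq_left (ha.trans har)]
      exact (hGn _).trans (by gcongr)
    · have h1 := hb.isHolderBound_holderNorm hβ0 s t hs hst ht
      have h2 := Real.rpow_nonneg (sub_nonneg.2 hst) β
      simp only [hg, max_eq_left (ha.trans hs), max_eq_left (ha.trans (hs.trans hst))]
      refine (hGl _ _).trans ?_
      calc _ ≤ L * (holderNorm β u a b * (t - s) ^ β) := by gcongr
        _ ≤ L * (1 + holderNorm β u a b) * (t - s) ^ β := by nlinarith [mul_nonneg hL0 h2]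
  set X : ℕ → ℝ := fun n => holderNorm β u (τ n) (τ (n + 1)) with hX
  have hX0 : ∀ n, 0 ≤ X n := fun n => holderNorm_nonneg _ _ _ _
  have hmain := holderNorm_mild_le (J := convInt e lam α g ω) (u := u) (u₀ := u₀)
    (Q₁ := fun m => C₁ * (L * (1 + X m)) * μ) (Q₂ := fun m => C₂ * (L * (1 + X m)) * μ) hl hm hβ0
    (by linarith) hββ'.le hu₀ hτ0 hτ hτ1 (fracIntegral_self _ _ _ _ _)
    (fun b c hb hbc => by
      obtain ⟨H, hH, hωH⟩ := exists_isHolderBound_of_mem_pathSpace (β' := β') (by linarith) hβ'β'' hω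
        (hb.trans hbc)
      obtain ⟨h1, h2⟩ := hgP 0 c le_rfl
      have h3 := holderNorm_nonneg β u 0 c
      exact convInt_add_adjacent hl hα0 hαβ hββ' (by linarith) hα (by positivity) h1 h2 hgc hH hωH
        hωc hb hbc)
    (fun m => by have := hX0 m; positivity) (fun m => by have := hX0 m; positivity)
    (fun m a b ha hab hb => by
      obtain ⟨h1, h2⟩ := hgP (τ m) (τ (m + 1)) (hτn m)
      have h3 := hX0 m
      have h4 := norm_map_convInt_le (e := e) (D := ContinuousLinearMap.id ℝ V) hl hα0 hαβ hββ'
        (by linarith) hα zero_le_one (isMultiplier_id (e := e) (lam := lam)) le_rfl hαδ hδβ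
        (by linarith) (P := L * (1 + X m)) (by positivity)
        (fun r har hrb => h1 r (ha.trans har) (hrb.trans hb)) (h2.mono ha hb) hgc hμ.le
        ((hωτ m).mono ha hb) hωc hab (by linarith [hτ1 m])
      rw [mul_one, sub_zero] at h4
      exact h4)
    (fun m a b h ha hab hb hh => by
      obtain ⟨h1, h2⟩ := hgP (τ m) (τ (m + 1)) (hτn m)
      have h3 := hX0 m
      have h4 := norm_map_convInt_le (e := e) hl hα0 hαβ hββ'
        (by linarith) hα (by positivity) (isMultiplier_semigroup_sub_id (e := e) hl hh hβ0.le
        (by linarith)) hβ0.le hαδ hδβ hδ (P := L * (1 + X m)) (by positivity)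
        (fun r har hrb => h1 r (ha.trans har) (hrb.trans hb)) (h2.mono ha hb) hgc hμ.le
        ((hωτ m).mono ha hb) hωc hab (by linarith [hτ1 m])
      refine h4.trans ?_
      -- The leftover power of the interval length is discarded, since the length is at most 1.
      have h5 : (b - a) ^ (β' - β) ≤ 1 :=
        Real.rpow_le_one (by linarith) (by linarith [hτ1 m]) (by linarith)
      have h6 : 0 ≤ h ^ β := by positivity
      calc _ ≤ C₂ * h ^ β * (L * (1 + X m)) * μ * 1 := by gcongr
        _ = _ := by ring)
    (fun t ht => hu.eq_convInt ht) n
  have hU : 0 ≤ fracNorm e lam β u₀ := Real.sqrt_nonneg _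
  have hterm : ∀ m, C₁ * (L * (1 + X m)) * μ + C₂ * (L * (1 + X m)) * μ ≤ c * μ * X m + c * μ := by
    intro m
    have h1 := hX0 m
    calc _ = (C₁ + C₂) * L * (μ * (1 + X m)) := by ring
      _ ≤ c * (μ * (1 + X m)) := by
        gcongr
        refine le_trans ?_ hc2
        gcongr
        linarith
      _ = _ := by ring
  have hlast : 2 * (C₁ * (L * (1 + X n)) * μ) + C₂ * (L * (1 + X n)) * μ ≤ c * μ * X n + c * μ := by
    have h1 := hX0 n
    calc _ = (2 * C₁ + C₂) * L * (μ * (1 + X n)) := by ring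
      _ ≤ c * (μ * (1 + X n)) := by gcongr
      _ = _ := by ring
  have hfirst : (lam 0 ^ (-β) + 1) * Real.exp (-lam 0 * τ n) * fracNorm e lam β u₀ ≤
      c * Real.exp (-lam 0 * τ n) * fracNorm e lam β u₀ := by gcongr
  have hsum : ∑ m ∈ Finset.range n, Real.exp (-lam 0 * (τ n - τ (m + 1))) *
      (C₁ * (L * (1 + X m)) * μ + C₂ * (L * (1 + X m)) * μ) ≤
      ∑ m ∈ Finset.range n, c * μ * Real.exp (-lam 0 * (τ n - τ (m + 1))) * X m +
      ∑ m ∈ Finset.range n, Real.exp (-lam 0 * (τ n - τ (m + 1))) * (c * μ) := by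
    rw [← Finset.sum_add_distrib]
    refine Finset.sum_le_sum fun m _ => ?_
    calc _ ≤ Real.exp (-lam 0 * (τ n - τ (m + 1))) * (c * μ * X m + c * μ) := by
          have := hterm m
          gcongr
      _ = _ := by ring
  simp only [hX] at hsum hlast hmain ⊢
  linarith

theorem sum_Icc_one_eq_sum_range (f : ℕ → ℝ) (n : ℕ) :
    ∑ m ∈ Finset.Icc 1 n, f m = ∑ m ∈ Finset.range n, f (m + 1) := by
  induction n with
  | zero => simp
  | succ n ih => rw [Finset.sum_Icc_succ_top (by omega), ih, Finset.sum_range_succ]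

end Recursion

end HolderSPDE

/-! ### The two assertions -/

theorem mainTheorem5 {V : Type*} [NormedAddCommGroup V] [InnerProductSpace ℝ V] [CompleteSpace V]
    (A : V →ₗ.[ℝ] V) (e : HilbertBasis ℕ ℝ V) (lam : ℕ → ℝ) (hA : IsGeneratorData A e lam)
    (G : V → HSOp e) (hG : ContDiff ℝ 2 G)
    (hDG : ∃ C : ℝ, ∀ v, ‖fderiv ℝ G v‖ ≤ C)
    (hD2G : ∃ C : ℝ, ∀ v, ‖fderiv ℝ (fderiv ℝ G) v‖ ≤ C)
    (α β β' β'' : ℝ) (hβ : 1 / 2 < β) (hββ' : β < β') (hβ'β'' : β' < β'') (hβ'' : β'' < 1)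
    (hα : 1 - β' < α) (hαβ : α < β) :
    ∃ c : ℝ, 0 < c ∧
      -- the recursive bound on the intervals between consecutive stopping times
      (∀ μ > 0, ∀ ω ∈ pathSpace V β'', ∀ j : ℤ, ∀ u₀ : V, MemFrac e lam β u₀ →
        ∀ u : ℝ → V, IsMildSolution e lam G α β (shift (stopTime μ β' ω j) ω) u₀ u →
        ∀ T : ℤ → ℝ, T = stopTime μ β' (shift (stopTime μ β' ω j) ω) →
        ∀ i : ℕ, 1 ≤ i →
          holderNorm β u (T (i - 1)) (T i) ≤
            c * Real.exp (-lam 0 * T (i - 1)) * fracNorm e lam β u₀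
            + c * μ * holderNorm β u (T (i - 1)) (T i)
            + ∑ m ∈ Finset.Icc (1 : ℕ) (i - 1),
                c * μ * Real.exp (-lam 0 * (T (i - 1) - T m)) * holderNorm β u (T (m - 1)) (T m)
            + ∑ m ∈ Finset.Icc (1 : ℕ) (i - 1), Real.exp (-lam 0 * (T (i - 1) - T m)) * (c * μ)
            + c * μ) ∧
      -- the exponential bound on `Φ` for small `μ`, with the same constant `c`
      (∀ μ > 0,
        ∀ k₀ k₁ k₂ : ℝ, k₀ = c / (1 - c * μ) → k₁ = c * μ / (1 - c * μ) → k₂ = k₁ →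
        c * μ < 1 → k₁ < 1 → 1 < -(2 / lam 0) * Real.log k₁ →
        ∀ ω ∈ pathSpace V β'', ∀ j : ℤ, ∀ u₀ : V, MemFrac e lam β u₀ →
        ∀ T : ℤ → ℝ, T = stopTime μ β' (shift (stopTime μ β' ω j) ω) →
        ∀ i : ℕ, 1 ≤ i →
          ∀ B : ℝ, B = (1 + k₁) ^ (i - 1) * Real.exp (-(lam 0 / 2) * T (i - 1))
                * (k₀ * fracNorm e lam β u₀ + k₂)
            + ∑ m ∈ Finset.Icc (1 : ℕ) (i - 1),
                2 * k₂ * (1 + k₁) ^ (i - 1 - m) * Real.exp (-(lam 0 / 2) * (T (i - 1) - T m)) →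
          ‖Phi e lam G α β β' μ i j ω u₀‖ ≤ B ∧
          ∀ u : ℝ → V, IsMildSolution e lam G α β (shift (stopTime μ β' ω j) ω) u₀ u →
            ‖u (T i)‖ ≤ B) := by
  have hl := hA.lam_pos
  obtain ⟨c, hc, hrec⟩ := exists_recursive_bound hl hA.monotone hG hDG hββ' hβ'β'' hβ'' hα hαβ
  have hcast : ∀ n : ℕ, (((n + 1 : ℕ) : ℤ) - 1) = (n : ℤ) := fun n => by simp
  refine ⟨c, hc, ?_, ?_⟩
  · intro μ hμ ω hω j u₀ hu₀ u hu T hT i hi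
    obtain ⟨n, rfl⟩ : ∃ n, i = n + 1 := ⟨i - 1, by omega⟩
    have h := hrec μ hμ _ (shift_mem_pathSpace hω _) u₀ hu₀ u hu _ rfl n
    have hTn : ∀ n : ℕ, T (n : ℤ) = stopPos μ β' (shift (stopTime μ β' ω j) ω) n := fun n => by
      rw [hT]; rfl
    rw [Nat.add_sub_cancel, sum_Icc_one_eq_sum_range, sum_Icc_one_eq_sum_range]
    simp only [hcast, hTn]
    exact h
  · intro μ hμ k₀ k₁ k₂ hk₀ hk₁ hk₂ hcμ hk₁1 hlog ω hω j u₀ hu₀ T hT i hi B hB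
    obtain ⟨n, rfl⟩ : ∃ n, i = n + 1 := ⟨i - 1, by omega⟩
    have hTn : ∀ n : ℕ, T (n : ℤ) = stopPos μ β' (shift (stopTime μ β' ω j) ω) n := fun n => by
      rw [hT]; rfl
    rw [Nat.add_sub_cancel, sum_Icc_one_eq_sum_range] at hB
    simp only [hcast, hTn] at hB
    have hd : 0 < 1 - c * μ := by linarith
    have hk₁0 : 0 < k₁ := by rw [hk₁]; positivity
    have hk₀0 : 0 < k₀ := by rw [hk₀]; positivity
    have hU : 0 ≤ fracNorm e lam β u₀ := Real.sqrt_nonneg _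
    have hsol : ∀ u : ℝ → V, IsMildSolution e lam G α β (shift (stopTime μ β' ω j) ω) u₀ u →
        ‖u (T ((n + 1 : ℕ) : ℤ))‖ ≤ B := by
      intro u hu
      set τ := stopPos μ β' (shift (stopTime μ β' ω j) ω) with hτ
      have hrec' := hrec μ hμ _ (shift_mem_pathSpace hω _) u₀ hu₀ u hu τ hτ
      have hτs : ∀ n, τ n ≤ τ (n + 1) := fun n => stopPos_le_succ _ _ _ _
      have hτ0 : 0 ≤ τ n := (monotone_nat_of_le_succ hτs) (Nat.zero_le n)
      -- Finiteness of the Hölder norm on the last interval, so that it dominates the value of `u`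
      -- at its right end.
      obtain ⟨H, hH, hb⟩ := hu.exists_isHolderBound (by linarith) hu₀ hτ0 (b := τ (n + 1))
      have hgr := discrete_gronwall (l := lam 0) (k₀ := k₀) (k₁ := k₁) (U := fracNorm e lam β u₀)
        (τ := τ) (X := fun n => holderNorm β u (τ n) (τ (n + 1))) (hl 0) hk₁0 hlog rfl
        hτs (fun n => stopPos_succ_sub_le_one _ _ _ _)
        (fun n => holderNorm_nonneg _ _ _ _) (fun n => by
          have h := hrec' n
          have e1 : ∑ m ∈ Finset.range n, c * μ * Real.exp (-lam 0 * (τ n - τ (m + 1))) *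
              holderNorm β u (τ m) (τ (m + 1)) +
              ∑ m ∈ Finset.range n, Real.exp (-lam 0 * (τ n - τ (m + 1))) * (c * μ) =
              c * μ * ∑ m ∈ Finset.range n, Real.exp (-lam 0 * (τ n - τ (m + 1))) *
                (holderNorm β u (τ m) (τ (m + 1)) + 1) := by
            rw [← Finset.sum_add_distrib, Finset.mul_sum]
            exact Finset.sum_congr rfl fun m _ => by ring
          -- Absorption: moving `c μ X n` to the left and dividing by `1 - c μ` turns `c` into `k₀`
          -- and `c μ` into `k₁`.
          have e2 : k₀ * Real.exp (-lam 0 * τ n) * fracNorm e lam β u₀ +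
              k₁ * ∑ m ∈ Finset.range n, Real.exp (-lam 0 * (τ n - τ (m + 1))) *
                (holderNorm β u (τ m) (τ (m + 1)) + 1) + k₁ =
              (c * Real.exp (-lam 0 * τ n) * fracNorm e lam β u₀ +
              c * μ * ∑ m ∈ Finset.range n, Real.exp (-lam 0 * (τ n - τ (m + 1))) *
                (holderNorm β u (τ m) (τ (m + 1)) + 1) + c * μ) / (1 - c * μ) := by
            rw [hk₀, hk₁]; ring
          rw [e2, le_div_iff₀ hd]
          linarith) n
      rw [hTn, hB, hk₂]
      exact (hb.norm_le_holderNorm (by linarith) hH (hτs n) le_rfl).trans hgr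
    refine ⟨?_, hsol⟩
    rw [Phi, solutionMap]
    -- The chosen solution is covered by the bound for all solutions, so uniqueness plays no role.
    -- Without a solution the value is 0 and the bound is nonnegative.
    split_ifs with h
    · have := hsol _ h.choose_spec
      rwa [hT] at this
    · rw [norm_zero, hB, hk₂]
      positivity
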